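/- Let $\mathbb{F}$ be a field. All simplicial complexes are finite and contain the empty face. For a complex $K$ with $\dim K=d-1$, whose vertices lie in a finite set $V$, let $A=\mathbb{F}[x_v:v\in V]$, let $I_K\subseteq A$ be the ideal generated by the monomials whose support is not a face of $K$, and let $\mathbb{F}[K]=A/I_K$. A linear system of parameters (l.s.o.p.) of $\mathbb{F}[K]$ is a sequence $\Theta=(\theta_1,\dots,\theta_d)$ of linear forms in $A$ such that $H(K,\Theta)=\mathbb{F}[K]/(\Theta)$ has finite dimension over $\mathbb{F}$; $H(K,\Theta)=\bigoplus_i H(K,\Theta)_i$ is graded by degree. A linear form $\omega\in A_1$ is an *$i$-Lefschetz element* of $H(K,\Theta)$ ($0\le i\le d/2$) if multiplication by $\omega^{d-2i}$ is a bijection $H(K,\Theta)_i\to H(K,\Theta)_{d-i}$, and an *HL element* for $K$ with respect to $\Theta$ if this holds for every $0\le i\le d/2$. The complex $K$ is *Cohen–Macaulay* over $\mathbb{F}$ if $\mathbb{F}[K]$ is a free $\mathbb{F}[\Theta]$-module for some l.s.o.p. $\Theta$. It is *HL* over $\mathbb{F}$ if it is Cohen–Macaulay, its $h$-vector is symmetric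 ($h_k=h_{d-k}$ for $0\le k\le d$), and $H(K,\Theta)$ has an HL element for some l.s.o.p. $\Theta$. The complex $K$ is *Gorenstein\** over $\mathbb{F}$ if it is pure and, for every face $F\in K$ (including $\emptyset$), the link $\mathrm{lk}(F,K)$ has the reduced homology over $\mathbb{F}$ of a sphere of dimension $\dim \mathrm{lk}(F,K)$. **Theorem.** Let $d\ge 1$, and let $K$ and $L$ be Gorenstein\* complexes over $\mathbb{F}$ which intersect in a common facet $\sigma$ of dimension $d-1$, that is, $\sigma$ is a facet of $K$ and of $L$, and $K\cap L=\langle\sigma\rangle$ is the complex of all subsets of $\sigma$. Let $K\#_\sigma L=(K\cup L)\setminus\{\sigma\}$, and take $A=\mathbb{F}[x_v: v\in V]$ for a finite set $V$ that contains all vertices of $K\cup L$. Then: (0) $K\#_\sigma L$ is Gorenstein\* over $\mathbb{F}$ of dimension $d-1$, and its $h$-vector is symmetric. (1) If $\mathbb{F}$ is infinite, there is a common l.s.o.p. $\Theta\in A_1^d$ for $K$, $L$, $\langle\sigma\rangle$ and $K\#_\sigma L$. For any field $\mathbb{F}$, if $\Theta$ is such a common l.s.o.p. and $\omega\in A_1$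 is an HL element for both $K$ and $L$ with respect to $\Theta$, then $\omega$ is an $i$-Lefschetz element of $\mathbb{F}[K\#_\sigma L]/(\Theta)$ for every integer $i$ with $0<i\le d/2$. (2) Suppose that $\mathbb{F}$ is infinite. If there are $\Theta$ and $\omega$ as in (1), or if $K$ and $L$ are both HL over $\mathbb{F}$, then $K\#_\sigma L$ is HL over $\mathbb{F}$. -/

import Mathlib

open MvPolynomial

noncomputable section

/-! Finite simplicial complexes are Mathlib's `PreAbstractSimplicialComplex V` on a finite type `V`
(not every element of `V` has to be a vertex). Mathlib lists only the nonempty faces; the empty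
face is always present here, through `IsFace`. -/

namespace SComplex

universe u v

/-- `s` is a face of `K`, where the empty set is a face of every complex. -/
def IsFace {V : Type u} (K : PreAbstractSimplicialComplex V) (s : Finset V) : Prop :=
  s = ∅ ∨ s ∈ K.faces

/-- `s` is a facet, i.e. an inclusion-maximal face. -/
def IsFacet {V : Type u} (K : PreAbstractSimplicialComplex V) (s : Finset V) : Prop :=
  IsFace K s ∧ ∀ t, IsFace K t → s ⊆ t → s = t

open Classical in
/-- `dim K + 1`, the largest number of vertices of a face. -/
def size {V : Type u} [Fintype V] (K : PreAbstractSimplicialComplex V) : ℕ :=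
  (Finset.univ.filter (fun s : Finset V => IsFace K s)).sup Finset.card

/-- All facets have the same dimension. -/
def IsPure {V : Type u} [Fintype V] (K : PreAbstractSimplicialComplex V) : Prop :=
  ∀ s, IsFacet K s → s.card = size K

/-- The link `lk(s, K) = {t : t ∩ s = ∅, t ∪ s ∈ K}`. -/
def link {V : Type u} [DecidableEq V] (K : PreAbstractSimplicialComplex V) (s : Finset V) :
    PreAbstractSimplicialComplex V where
  faces := {t | t.Nonempty ∧ Disjoint t s ∧ t ∪ s ∈ K.faces}
  isRelLowerSet_faces := by
    rintro t ⟨hne, hd, hf⟩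
    refine ⟨hne, fun r hr hrne => ⟨hrne, Finset.disjoint_of_subset_left hr hd, ?_⟩⟩
    exact (K.isRelLowerSet_faces hf).2 (Finset.union_subset_union_left hr)
      (hrne.mono Finset.subset_union_left)

/-- The simplex `<σ>`: all subsets of `σ`. -/
def simplex {V : Type u} (σ : Finset V) : PreAbstractSimplicialComplex V where
  faces := {t | t.Nonempty ∧ t ⊆ σ}
  isRelLowerSet_faces := by
    rintro t ⟨hne, ht⟩
    exact ⟨hne, fun r hr hrne => ⟨hrne, hr.trans ht⟩⟩

/-- The connected sum `K #_σ L = (K ∪ L) \ {σ}`. To get a complex for every `σ`, all faces that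
contain `σ` are removed; if `σ` is a common facet this is only `σ` itself,
see `connectedSum_faces`. -/
def connectedSum {V : Type u} (K L : PreAbstractSimplicialComplex V) (σ : Finset V) :
    PreAbstractSimplicialComplex V where
  faces := {t | t ∈ K.faces ∪ L.faces ∧ ¬ σ ⊆ t}
  isRelLowerSet_faces := by
    rintro t ⟨hf, hσ⟩
    refine ⟨((K ⊔ L).isRelLowerSet_faces hf).1, fun r hr hrne => ⟨?_, fun h => hσ (h.trans hr)⟩⟩
    exact ((K ⊔ L).isRelLowerSet_faces hf).2 hr hrne

theorem connectedSum_faces {V : Type u} (K L : PreAbstractSimplicialComplex V) (σ : Finset V)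
    (hK : IsFacet K σ) (hL : IsFacet L σ) :
    (connectedSum K L σ).faces = (K.faces ∪ L.faces) \ {σ} := by
  ext t
  constructor
  · rintro ⟨h, hσ⟩
    exact ⟨h, fun h' => hσ (by rw [Set.mem_singleton_iff.mp h'])⟩
  · rintro ⟨h, hσ⟩
    refine ⟨h, fun h' => hσ ?_⟩
    rcases h with h | h
    · exact (hK.2 t (Or.inr h) h').symm
    · exact (hL.2 t (Or.inr h) h').symm

/-! ### Reduced simplicial homology -/

/-- The augmented simplicial boundary operator, with chains written as functions on `Finset V`:
`∂ s = ∑_{v ∈ s} (-1)^{#{w ∈ s : w < v}} (s \ {v})` on basis vectors. -/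
def boundary (F : Type v) [Field F] (V : Type u) [Fintype V] [LinearOrder V] :
    (Finset V → F) →ₗ[F] (Finset V → F) :=
  Fintype.linearCombination F (fun s : Finset V =>
    ∑ v ∈ s, Pi.single (s.erase v) ((-1 : F) ^ (s.filter (fun w => w < v)).card))

/-- The chains of `K` on the faces with `k` vertices, i.e. of dimension `k - 1`. -/
def chains (F : Type v) [Field F] {V : Type u} (K : PreAbstractSimplicialComplex V) (k : ℕ) :
    Submodule F (Finset V → F) where
  carrier := {c | ∀ s, ¬ (IsFace K s ∧ s.card = k) → c s = 0}
  add_mem' := by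
    intro a b ha hb s hs
    simp [ha s hs, hb s hs]
  zero_mem' := fun _ _ => rfl
  smul_mem' := by
    intro r a ha s hs
    simp [ha s hs]

/-- Cycles of dimension `k - 1`. -/
def cycles (F : Type v) [Field F] {V : Type u} [Fintype V] [LinearOrder V]
    (K : PreAbstractSimplicialComplex V) (k : ℕ) : Submodule F (Finset V → F) :=
  chains F K k ⊓ LinearMap.ker (boundary F V)

/-- Boundaries of dimension `k - 1`. -/
def boundaries (F : Type v) [Field F] {V : Type u} [Fintype V] [LinearOrder V]
    (K : PreAbstractSimplicialComplex V) (k : ℕ) : Submodule F (Finset V → F) :=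
  (chains F K (k + 1)).map (boundary F V)

/-- The reduced simplicial homology `H̃_{k-1}(K; F)`. -/
abbrev ReducedHomology (F : Type v) [Field F] {V : Type u} [Fintype V] [LinearOrder V]
    (K : PreAbstractSimplicialComplex V) (k : ℕ) : Type (max u v) :=
  ↥(cycles F K k) ⧸ (boundaries F K k).comap (cycles F K k).subtype

/-- `K` has the reduced homology over `F` of a sphere of dimension `dim K`
(the `(-1)`-sphere is the complex whose only face is the empty one). -/
def HasSphereHomology (F : Type v) [Field F] {V : Type u} [Fintype V] [LinearOrder V]
    (K : PreAbstractSimplicialComplex V) : Prop :=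
  ∀ k : ℕ, Module.finrank F (ReducedHomology F K k) = if k = size K then 1 else 0

/-- Gorenstein* complexes over `F` (homology spheres): pure, and the link of every face, including
the empty one, has the homology of a sphere of the dimension of the link. -/
def IsGorensteinStar (F : Type v) [Field F] {V : Type u} [Fintype V] [LinearOrder V]
    (K : PreAbstractSimplicialComplex V) : Prop :=
  IsPure K ∧ ∀ s, IsFace K s → HasSphereHomology F (link K s)

/-! ### `f`- and `h`-numbers -/

open Classical in
/-- `f_{i-1}(K)`, the number of faces with `i` vertices. -/
def numFaces {V : Type u} [Fintype V] (K : PreAbstractSimplicialComplex V) (i : ℕ) : ℕ :=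
  (Finset.univ.filter (fun s : Finset V => IsFace K s ∧ s.card = i)).card

/-- `h_k = ∑_{i=0}^{k} (-1)^{k-i} (d-i choose k-i) f_{i-1}` with `d = dim K + 1`, `0 ≤ k ≤ d`. -/
def hNumber {V : Type u} [Fintype V] (K : PreAbstractSimplicialComplex V) (k : ℕ) : ℤ :=
  ∑ i ∈ Finset.range (k + 1),
    (-1 : ℤ) ^ (k - i) * ((size K - i).choose (k - i) : ℤ) * (numFaces K i : ℤ)

/-- `h_k = h_{d-k}` for `0 ≤ k ≤ d = dim K + 1`. -/
def HasSymmetricH {V : Type u} [Fintype V] (K : PreAbstractSimplicialComplex V) : Prop :=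
  ∀ k, k ≤ size K → hNumber K k = hNumber K (size K - k)

/-! ### Face rings -/

/-- The ideal `I_K` spanned by the monomials whose support is not a face. -/
def faceIdeal (F : Type v) [Field F] {V : Type u} (K : PreAbstractSimplicialComplex V) :
    Ideal (MvPolynomial V F) :=
  Ideal.span {p | ∃ a : V →₀ ℕ, ¬ IsFace K a.support ∧ p = monomial a 1}

/-- The face ring `F[K] = A / I_K`, `A = F[x_v : v ∈ V]`. -/
abbrev FaceRing (F : Type v) [Field F] {V : Type u} (K : PreAbstractSimplicialComplex V) :
    Type (max u v) :=
  MvPolynomial V F ⧸ faceIdeal F K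

/-- The ideal `I_K + (Θ)` of `A`. -/
def thetaIdeal {F : Type v} [Field F] {V : Type u} (K : PreAbstractSimplicialComplex V)
    {d : ℕ} (Θ : Fin d → MvPolynomial V F) : Ideal (MvPolynomial V F) :=
  faceIdeal F K ⊔ Ideal.span (Set.range Θ)

/-- `H(K, Θ) = F[K] / (Θ)`, written as `A / (I_K + (Θ))`. -/
abbrev ReducedRing {F : Type v} [Field F] {V : Type u} (K : PreAbstractSimplicialComplex V)
    {d : ℕ} (Θ : Fin d → MvPolynomial V F) : Type (max u v) :=
  MvPolynomial V F ⧸ thetaIdeal K Θ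

/-- The degree `i` part `H(K, Θ)_i`: the classes of the forms of degree `i`. -/
def gradedPiece {F : Type v} [Field F] {V : Type u} (K : PreAbstractSimplicialComplex V)
    {d : ℕ} (Θ : Fin d → MvPolynomial V F) (i : ℕ) : Submodule F (ReducedRing K Θ) :=
  (homogeneousSubmodule V F i).map (Ideal.Quotient.mkₐ F (thetaIdeal K Θ)).toLinearMap

/-- `Θ = (θ_1, …, θ_d)` is a linear system of parameters of `F[K]`: `d = dim K + 1` (the Krull
dimension of `F[K]`), the `θ_j` are linear forms, and `F[K] / (Θ)` has finite dimension over `F`. -/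
structure IsLSOP {F : Type v} [Field F] {V : Type u} [Fintype V]
    (K : PreAbstractSimplicialComplex V) {d : ℕ} (Θ : Fin d → MvPolynomial V F) : Prop where
  size_eq : d = size K
  linear : ∀ j, (Θ j).IsHomogeneous 1
  finite : Module.Finite F (ReducedRing K Θ)

/-- The subring `F[Θ]` of the face ring generated by the classes of the `θ_j`. -/
abbrev thetaSubalgebra {F : Type v} [Field F] {V : Type u} (K : PreAbstractSimplicialComplex V)
    {d : ℕ} (Θ : Fin d → MvPolynomial V F) : Subalgebra F (FaceRing F K) :=
  Algebra.adjoin F (Set.range fun j => Ideal.Quotient.mk (faceIdeal F K) (Θ j))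

/-- `K` is Cohen-Macaulay over `F`: for some l.s.o.p. `Θ`, `F[K]` is a free `F[Θ]`-module. -/
def IsCohenMacaulay (F : Type v) [Field F] {V : Type u} [Fintype V]
    (K : PreAbstractSimplicialComplex V) : Prop :=
  ∃ (d : ℕ) (Θ : Fin d → MvPolynomial V F),
    IsLSOP K Θ ∧ Module.Free (thetaSubalgebra K Θ) (FaceRing F K)

/-- The linear form `ω` is an `i`-Lefschetz element of `H(K, Θ)`: multiplication by `ω^{d-2i}` is a
bijection `H(K, Θ)_i → H(K, Θ)_{d-i}`. Used for `i ≤ d/2`. -/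
def IsLefschetzElement {F : Type v} [Field F] {V : Type u} (K : PreAbstractSimplicialComplex V)
    {d : ℕ} (Θ : Fin d → MvPolynomial V F) (ω : MvPolynomial V F) (i : ℕ) : Prop :=
  ω.IsHomogeneous 1 ∧
    Set.BijOn (fun m : ReducedRing K Θ => Ideal.Quotient.mk (thetaIdeal K Θ) ω ^ (d - 2 * i) * m)
      (gradedPiece K Θ i) (gradedPiece K Θ (d - i))

/-- `ω` is an HL element of `H(K, Θ)`: it is `i`-Lefschetz for all `0 ≤ i ≤ d/2`. -/
def IsHLElement {F : Type v} [Field F] {V : Type u} (K : PreAbstractSimplicialComplex V)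
    {d : ℕ} (Θ : Fin d → MvPolynomial V F) (ω : MvPolynomial V F) : Prop :=
  ∀ i : ℕ, 2 * i ≤ d → IsLefschetzElement K Θ ω i

/-- `K` is HL (has the hard-Lefschetz property) over `F`: it is Cohen-Macaulay with symmetric
`h`-vector, and `H(K, Θ)` has an HL element for some l.s.o.p. `Θ`. -/
def IsHL (F : Type v) [Field F] {V : Type u} [Fintype V]
    (K : PreAbstractSimplicialComplex V) : Prop :=
  IsCohenMacaulay F K ∧ HasSymmetricH K ∧
    ∃ (d : ℕ) (Θ : Fin d → MvPolynomial V F) (ω : MvPolynomial V F),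
      IsLSOP K Θ ∧ IsHLElement K Θ ω

/-- `Θ` is a common l.s.o.p. for `K`, `L`, `<σ>` and `K #_σ L`. -/
def IsCommonLSOP {F : Type v} [Field F] {V : Type u} [Fintype V]
    (K L : PreAbstractSimplicialComplex V) (σ : Finset V) {d : ℕ}
    (Θ : Fin d → MvPolynomial V F) : Prop :=
  IsLSOP K Θ ∧ IsLSOP L Θ ∧ IsLSOP (simplex σ) Θ ∧ IsLSOP (connectedSum K L σ) Θ

end SComplex

end

set_option linter.unusedSectionVars false

noncomputable section

namespace SComplex

universe u v w

/-! ### Faces, facets and sizes -/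

section Faces

variable {V : Type u} {K L : PreAbstractSimplicialComplex V} {s t : Finset V}

/-! The proof is a Mayer–Vietoris argument carried out twice, for simplicial chains and for face
rings, plus a genericity argument over infinite fields.

Homology. The simplex on `σ` is acyclic, so every cycle of `K ∪ L` is a cycle of `K` plus a cycle of
`L` (`exists_add_of_mem_cycles_sup`). Removing `σ` leaves, in the top degree, just the combinations
of the two fundamental cycles whose coefficients at `σ` cancel: a line. A link in the connected sum
is a link of one summand or the connected sum of two links, so the same computation covers all
links. The symmetry of the `h`-vector is the Dehn–Sommerville argument from the Euler
characteristics of links.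

Positive degrees. In `0 → F[K ∪ L] → F[K] ⊕ F[L] → F[⟨σ⟩] → 0` the forms `Θ` are coordinates of the
polynomial ring `F[⟨σ⟩]`. Hence the sequence stays exact modulo `Θ`
(`inf_thetaIdeal_le_of_isGenericOn`), and its third term becomes `F` in degree 0. The face ideal of
the connected sum only adds the multiples of the monomial `x_σ`, of degree `d`. So `H(K # L)_n =
H(K)_n ⊕ H(L)_n` for `0 < n < d`, compatibly with multiplication by `ω`; this gives (1).

Degree zero. `H_d` is spanned by any facet monomial, so only `ω ^ d ≠ 0` is needed. Modulo `Θ` one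
has `ω = α + β` with `α` zero on `L` and `β` zero on `K`. Replacing `ω` by `r α + β` rescales the
contribution of `K` by `r ^ d`, and a suitable `r` prevents cancellation
(`exists_isHLElement_connectedSum`).

Cohen–Macaulayness. The fundamental cycle embeds `F[K]` into the sum of the polynomial rings `F[s]`
over facets `s`, and signed restrictions continue this to an exact complex ending in `F`. In the
degree of a monomial `x^a` it computes the homology of the link of the support of `a`. Counting
depth along the complex makes a generic `Θ` a regular sequence, whence freeness, and graded
dimensions of `H(K, Θ)` that do not depend on `Θ`.

A common pair. If `K` and `L` are HL for different pairs `(Θ, ω)`, surjectivity of the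
multiplications persists at almost all points of every line of pairs; over an infinite field two
such conditions hold at once. As the dimensions are independent of `Θ`, surjectivity is bijectivity
(`exists_common_isHLElement`). -/

theorem isFace_empty (K : PreAbstractSimplicialComplex V) : IsFace K ∅ := Or.inl rfl

theorem IsFace.subset (h : IsFace K t) (hst : s ⊆ t) : IsFace K s := by
  rcases s.eq_empty_or_nonempty with rfl | hs
  · exact isFace_empty K
  · rcases h with rfl | h
    · exact absurd (Finset.subset_empty.mp hst) hs.ne_empty
    · exact Or.inr ((K.isRelLowerSet_faces h).2 hst hs)

theorem IsFace.mem_faces (h : IsFace K s) (hs : s.Nonempty) : s ∈ K.faces :=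
  h.resolve_left hs.ne_empty

theorem nonempty_of_mem_faces (h : s ∈ K.faces) : s.Nonempty := (K.isRelLowerSet_faces h).1

theorem ext_isFace (h : ∀ s, IsFace K s ↔ IsFace L s) : K = L := by
  refine PreAbstractSimplicialComplex.ext (Set.ext fun s => ⟨fun hs => ?_, fun hs => ?_⟩)
  · exact ((h s).mp (Or.inr hs)).mem_faces (nonempty_of_mem_faces hs)
  · exact ((h s).mpr (Or.inr hs)).mem_faces (nonempty_of_mem_faces hs)

theorem isFace_simplex {σ : Finset V} : IsFace (simplex σ) s ↔ s ⊆ σ := by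
  constructor
  · rintro (rfl | h)
    · exact Finset.empty_subset _
    · exact h.2
  · intro h
    rcases s.eq_empty_or_nonempty with rfl | hs
    · exact isFace_empty _
    · exact Or.inr ⟨hs, h⟩

theorem isFace_inf : IsFace (K ⊓ L) s ↔ IsFace K s ∧ IsFace L s := by
  constructor
  · rintro (rfl | h)
    · exact ⟨isFace_empty _, isFace_empty _⟩
    · exact ⟨Or.inr h.1, Or.inr h.2⟩
  · rintro ⟨h1, h2⟩
    rcases s.eq_empty_or_nonempty with rfl | hs
    · exact isFace_empty _
    · exact Or.inr ⟨h1.mem_faces hs, h2.mem_faces hs⟩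

theorem isFace_sup : IsFace (K ⊔ L) s ↔ IsFace K s ∨ IsFace L s := by
  constructor
  · rintro (rfl | h | h)
    · exact Or.inl (isFace_empty _)
    · exact Or.inl (Or.inr h)
    · exact Or.inr (Or.inr h)
  · rintro ((rfl | h) | (rfl | h))
    · exact isFace_empty _
    · exact Or.inr (Or.inl h)
    · exact isFace_empty _
    · exact Or.inr (Or.inr h)

theorem isFace_connectedSum {σ : Finset V} (hσ : σ.Nonempty) :
    IsFace (connectedSum K L σ) s ↔ (IsFace K s ∨ IsFace L s) ∧ ¬ σ ⊆ s := by
  constructor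
  · rintro (rfl | h)
    · exact ⟨Or.inl (isFace_empty _), fun h => hσ.ne_empty (Finset.subset_empty.mp h)⟩
    · exact ⟨h.1.imp Or.inr Or.inr, h.2⟩
  · rintro ⟨h, h'⟩
    rcases s.eq_empty_or_nonempty with rfl | hs
    · exact isFace_empty _
    · exact Or.inr ⟨h.imp (·.mem_faces hs) (·.mem_faces hs), h'⟩

variable [Fintype V]

theorem IsFace.card_le_size (h : IsFace K s) : s.card ≤ size K := by
  classical
  exact Finset.le_sup (f := Finset.card) (by simpa using h)

theorem exists_isFace_card_eq_size (K : PreAbstractSimplicialComplex V) :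
    ∃ s, IsFace K s ∧ s.card = size K := by
  classical
  obtain ⟨s, hs, h⟩ := Finset.exists_mem_eq_sup (Finset.univ.filter fun s : Finset V => IsFace K s)
    ⟨∅, by simpa using isFace_empty K⟩ Finset.card
  exact ⟨s, by simpa using hs, by rw [size]; convert h.symm⟩

theorem isFacet_of_card_eq_size (h : IsFace K s) (hs : s.card = size K) : IsFacet K s :=
  ⟨h, fun _ ht hst => Finset.eq_of_subset_of_card_le hst (hs ▸ ht.card_le_size)⟩

theorem IsFace.exists_isFacet (h : IsFace K s) : ∃ t, s ⊆ t ∧ IsFacet K t := by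
  classical
  obtain ⟨t, ht, hmax⟩ := Finset.exists_max_image
    (Finset.univ.filter fun t : Finset V => IsFace K t ∧ s ⊆ t) Finset.card ⟨s, by simp [h]⟩
  simp only [Finset.mem_filter, Finset.mem_univ, true_and] at ht hmax
  exact ⟨t, ht.2, ht.1, fun r hr htr =>
    Finset.eq_of_subset_of_card_le htr (hmax r ⟨hr, ht.2.trans htr⟩)⟩

theorem IsPure.isFacet_iff (hK : IsPure K) : IsFacet K s ↔ IsFace K s ∧ s.card = size K :=
  ⟨fun h => ⟨h.1, hK s h⟩, fun h => isFacet_of_card_eq_size h.1 h.2⟩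

theorem IsPure.exists_superset (hK : IsPure K) (h : IsFace K s) :
    ∃ t, s ⊆ t ∧ IsFace K t ∧ t.card = size K := by
  obtain ⟨t, hst, ht⟩ := h.exists_isFacet
  exact ⟨t, hst, ht.1, hK t ht⟩

theorem size_simplex (σ : Finset V) : size (simplex σ) = σ.card := by
  refine le_antisymm ?_ (isFace_simplex.mpr subset_rfl).card_le_size
  obtain ⟨s, hs, h⟩ := exists_isFace_card_eq_size (simplex σ)
  exact h ▸ Finset.card_le_card (isFace_simplex.mp hs)

end Faces

/-! ### Links -/

section Link

variable {V : Type u} [DecidableEq V] {K : PreAbstractSimplicialComplex V} {s t : Finset V}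

theorem isFace_link (hs : IsFace K s) : IsFace (link K s) t ↔ Disjoint t s ∧ IsFace K (t ∪ s) := by
  constructor
  · rintro (rfl | h)
    · simpa using hs
    · exact ⟨h.2.1, Or.inr h.2.2⟩
  · rintro ⟨h1, h2⟩
    rcases t.eq_empty_or_nonempty with rfl | ht
    · exact isFace_empty _
    · exact Or.inr ⟨ht, h1, h2.mem_faces (ht.mono Finset.subset_union_left)⟩

theorem link_empty (K : PreAbstractSimplicialComplex V) : link K ∅ = K :=
  ext_isFace fun s => by simp [isFace_link (isFace_empty K)]

theorem link_link (hs : IsFace K s) (ht : IsFace (link K s) t) :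
    link (link K s) t = link K (t ∪ s) := by
  have h := (isFace_link hs).mp ht
  refine ext_isFace fun r => ?_
  rw [isFace_link ht, isFace_link hs, isFace_link h.2, Finset.disjoint_union_left,
    Finset.disjoint_union_right, Finset.union_assoc]
  have := h.1
  tauto

theorem isFacet_link (hs : IsFace K s) :
    IsFacet (link K s) t ↔ Disjoint t s ∧ IsFacet K (t ∪ s) := by
  simp only [IsFacet, isFace_link hs]
  constructor
  · rintro ⟨⟨h1, h2⟩, h3⟩
    refine ⟨h1, h2, fun r hr htr => ?_⟩
    have hsr : s ⊆ r := Finset.subset_union_right.trans htr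
    rw [h3 (r \ s) ⟨Finset.sdiff_disjoint, by rwa [Finset.sdiff_union_of_subset hsr]⟩ ?_,
      Finset.sdiff_union_of_subset hsr]
    rw [Finset.subset_sdiff]
    exact ⟨Finset.subset_union_left.trans htr, h1⟩
  · rintro ⟨h1, h2, h3⟩
    refine ⟨⟨h1, h2⟩, fun r hr htr => ?_⟩
    have := h3 (r ∪ s) hr.2 (Finset.union_subset_union_left htr)
    refine Finset.Subset.antisymm htr fun x hx => ?_
    have hx' : x ∈ t ∪ s := this ▸ Finset.mem_union_left _ hx
    exact (Finset.mem_union.mp hx').resolve_right (Finset.disjoint_left.mp hr.1 hx)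

variable [Fintype V]

theorem IsPure.size_link (hK : IsPure K) (hs : IsFace K s) :
    size (link K s) + s.card = size K := by
  obtain ⟨t, ht, hc⟩ := exists_isFace_card_eq_size (link K s)
  have h := (isFacet_link hs).mp (isFacet_of_card_eq_size ht hc)
  rw [← hc, ← Finset.card_union_of_disjoint h.1]
  exact hK _ h.2

theorem IsPure.link (hK : IsPure K) (hs : IsFace K s) : IsPure (link K s) := by
  intro t ht
  have h := (isFacet_link hs).mp ht
  have h1 := hK _ h.2
  rw [Finset.card_union_of_disjoint h.1, ← hK.size_link hs] at h1
  omega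

end Link

/-! ### The boundary operator and sphere homology -/

section Boundary

variable {F : Type v} [Field F] {V : Type u} [Fintype V] [LinearOrder V]

/-- The sign of the vertex `v` relative to the face `t`. -/
def vertexSign (F : Type v) [Field F] {V : Type u} [LinearOrder V] (t : Finset V) (v : V) : F :=
  (-1) ^ (t.filter (fun w => w < v)).card

theorem vertexSign_mul_self (t : Finset V) (v : V) : vertexSign F t v * vertexSign F t v = 1 := by
  rw [vertexSign, ← pow_add, ← two_mul, pow_mul]; simp

theorem vertexSign_ne_zero (t : Finset V) (v : V) : vertexSign F t v ≠ 0 :=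
  left_ne_zero_of_mul_eq_one (vertexSign_mul_self t v)

theorem vertexSign_insert_self (t : Finset V) (v : V) :
    vertexSign F (insert v t) v = vertexSign F t v := by
  simp [vertexSign, Finset.filter_insert]

theorem vertexSign_insert_of_lt {t : Finset V} {v w : V} (hv : v ∉ t) (h : v < w) :
    vertexSign F (insert v t) w = - vertexSign F t w := by
  rw [vertexSign, vertexSign, Finset.filter_insert, if_pos h, Finset.card_insert_of_notMem, pow_succ]
  · simp
  · simp [hv]

theorem vertexSign_insert_of_not_lt {t : Finset V} {v w : V} (h : ¬ v < w) :
    vertexSign F (insert v t) w = vertexSign F t w := by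
  rw [vertexSign, vertexSign, Finset.filter_insert, if_neg h]

theorem vertexSign_union {s t : Finset V} (h : Disjoint s t) (v : V) :
    vertexSign F (s ∪ t) v = vertexSign F s v * vertexSign F t v := by
  rw [vertexSign, Finset.filter_union, Finset.card_union_of_disjoint, pow_add]
  · rfl
  · exact Finset.disjoint_filter_filter h

theorem boundary_apply (c : Finset V → F) (t : Finset V) :
    boundary F V c t = ∑ v ∈ tᶜ, vertexSign F t v * c (insert v t) := by
  have h1 : ∀ s : Finset V, (c s • ∑ v ∈ s, Pi.single (s.erase v)
      ((-1 : F) ^ (s.filter (fun w => w < v)).card)) t =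
      ∑ v ∈ tᶜ, if insert v t = s then vertexSign F t v * c s else 0 := by
    intro s
    rw [Pi.smul_apply, Finset.sum_apply, smul_eq_mul, Finset.mul_sum, ← Finset.sum_filter]
    simp only [Pi.single_apply, mul_ite, mul_zero]
    rw [← Finset.sum_filter]
    have h2 : s.filter (fun v => t = s.erase v) = tᶜ.filter (fun v => insert v t = s) := by
      ext v
      simp only [Finset.mem_filter, Finset.mem_compl]
      constructor
      · rintro ⟨hv, rfl⟩
        exact ⟨by simp, Finset.insert_erase hv⟩
      · rintro ⟨hv, rfl⟩
        exact ⟨by simp, (Finset.erase_insert hv).symm⟩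
    rw [h2]
    refine Finset.sum_congr rfl fun v hv => ?_
    rw [Finset.mem_filter] at hv
    rw [mul_comm, ← hv.2, ← vertexSign_insert_self t v]
    rfl
  rw [boundary, Fintype.linearCombination_apply, Finset.sum_apply, Finset.sum_congr rfl
    (fun s _ => h1 s), Finset.sum_comm]
  simp

theorem boundary_boundary (c : Finset V → F) : boundary F V (boundary F V c) = 0 := by
  ext t
  rw [boundary_apply]
  simp only [boundary_apply, Finset.mul_sum, Pi.zero_apply]
  rw [Finset.sum_sigma']
  -- The terms `(v, w)` and `(w, v)` cancel: inserting the smaller vertex flips the sign of the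
  -- larger one, while inserting the larger leaves the other sign unchanged.
  refine Finset.sum_involution (fun p _ => ⟨p.2, p.1⟩) ?_ ?_ ?_ ?_
  · rintro ⟨v, w⟩ h
    simp only [Finset.mem_sigma, Finset.mem_compl, Finset.mem_insert, not_or] at h
    obtain ⟨hv, hwv, hw⟩ := h
    simp only [Finset.insert_comm w v]
    rcases lt_or_gt_of_ne hwv with h | h
    · rw [vertexSign_insert_of_lt hw h, vertexSign_insert_of_not_lt (not_lt.mpr h.le)]
      ring
    · rw [vertexSign_insert_of_lt hv h, vertexSign_insert_of_not_lt (not_lt.mpr h.le)]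
      ring
  · rintro ⟨v, w⟩ h _ h'
    simp only [Finset.mem_sigma, Finset.mem_compl, Finset.mem_insert, not_or] at h
    simp only [Sigma.mk.injEq, heq_eq_eq] at h'
    exact h.2.1 h'.1
  · rintro ⟨v, w⟩ h
    simp only [Finset.mem_sigma, Finset.mem_compl, Finset.mem_insert, not_or] at h ⊢
    tauto
  · rintro ⟨v, w⟩ h
    rfl

variable {K L : PreAbstractSimplicialComplex V} {k : ℕ} {c : Finset V → F}

theorem mem_chains : c ∈ chains F K k ↔ ∀ s, c s ≠ 0 → IsFace K s ∧ s.card = k :=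
  forall_congr' fun _ => not_imp_comm

theorem chains_mono (h : ∀ s, IsFace K s → IsFace L s) : chains F K k ≤ chains F L k :=
  fun _ hc => mem_chains.mpr fun s hs => ⟨h s (mem_chains.mp hc s hs).1, (mem_chains.mp hc s hs).2⟩

theorem boundary_mem_chains (hc : c ∈ chains F K (k + 1)) : boundary F V c ∈ chains F K k := by
  refine mem_chains.mpr fun s hs => ?_
  rw [boundary_apply] at hs
  obtain ⟨v, hv, h⟩ := Finset.exists_ne_zero_of_sum_ne_zero hs
  have h1 := mem_chains.mp hc _ (right_ne_zero_of_mul h)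
  rw [Finset.card_insert_of_notMem (Finset.mem_compl.mp hv)] at h1
  exact ⟨h1.1.subset (Finset.subset_insert _ _), by omega⟩

theorem boundary_eq_zero_of_mem_chains_zero (hc : c ∈ chains F K 0) : boundary F V c = 0 := by
  ext s
  rw [boundary_apply]
  refine Finset.sum_eq_zero fun v _ => ?_
  rw [hc (insert v s) (by simp), mul_zero]

theorem boundaries_le_cycles : boundaries F K k ≤ cycles F K k := by
  rintro _ ⟨c, hc, rfl⟩
  exact ⟨boundary_mem_chains hc, boundary_boundary c⟩

theorem eq_zero_of_mem_chains_of_size_lt (hc : c ∈ chains F K k) (hk : size K < k) : c = 0 := by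
  ext s
  by_contra h
  have h1 := mem_chains.mp hc s h
  have := h1.1.card_le_size
  omega

theorem boundaries_size_eq_bot : boundaries F K (size K) = ⊥ := by
  rw [eq_bot_iff]
  rintro _ ⟨c, hc, rfl⟩
  rw [eq_zero_of_mem_chains_of_size_lt hc (Nat.lt_succ_self _), map_zero]
  exact Submodule.zero_mem _

theorem finrank_reducedHomology :
    Module.finrank F (ReducedHomology F K k) + Module.finrank F (boundaries F K k) =
      Module.finrank F (cycles F K k) := by
  rw [← Submodule.finrank_quotient_add_finrank
    ((boundaries F K k).comap (cycles F K k).subtype)]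
  congr 1
  exact (Submodule.comapSubtypeEquivOfLe boundaries_le_cycles).finrank_eq.symm

theorem HasSphereHomology.exists_boundary_eq (hK : HasSphereHomology F K) (hk : k ≠ size K)
    (hc : c ∈ cycles F K k) : ∃ b ∈ chains F K (k + 1), boundary F V b = c := by
  have h := finrank_reducedHomology (F := F) (K := K) (k := k)
  rw [hK k, if_neg hk, zero_add] at h
  have := Submodule.eq_of_le_of_finrank_eq boundaries_le_cycles h
  rw [← this] at hc
  exact hc

theorem HasSphereHomology.finrank_cycles (hK : HasSphereHomology F K) :
    Module.finrank F (cycles F K (size K)) = 1 := by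
  have h := finrank_reducedHomology (F := F) (K := K) (k := size K)
  rw [hK, if_pos rfl, boundaries_size_eq_bot, finrank_bot] at h
  exact h.symm

theorem HasSphereHomology.exists_fundamental_cycle (hK : HasSphereHomology F K) :
    ∃ z ∈ cycles F K (size K), z ≠ 0 ∧ ∀ c ∈ cycles F K (size K), ∃ a : F, c = a • z := by
  obtain ⟨z, hz, h⟩ := finrank_eq_one_iff'.mp hK.finrank_cycles
  refine ⟨z, z.2, fun h' => hz (Subtype.ext h'), fun c hc => ?_⟩
  obtain ⟨a, ha⟩ := h ⟨c, hc⟩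
  exact ⟨a, (congrArg Subtype.val ha).symm⟩

theorem HasSphereHomology.exists_eq_smul (hK : HasSphereHomology F K) {z : Finset V → F}
    (hz : z ∈ cycles F K (size K)) (hz0 : z ≠ 0) (hc : c ∈ cycles F K (size K)) :
    ∃ a : F, c = a • z := by
  obtain ⟨y, hy, hy0, h⟩ := hK.exists_fundamental_cycle
  obtain ⟨a, rfl⟩ := h z hz
  obtain ⟨b, rfl⟩ := h c hc
  have ha : a ≠ 0 := by rintro rfl; simp at hz0
  exact ⟨b / a, by rw [smul_smul, div_mul_cancel₀ _ ha]⟩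

/-- There are no chains above `size K` and no boundaries in degree `size K`, so exactness below and
a spanning top cycle suffice. -/
theorem hasSphereHomology_of_exact
    (h1 : ∀ k < size K, ∀ c ∈ cycles F K k, ∃ b ∈ chains F K (k + 1), boundary F V b = c)
    {z : Finset V → F} (hz : z ∈ cycles F K (size K)) (hz0 : z ≠ 0)
    (h2 : ∀ c ∈ cycles F K (size K), ∃ a : F, c = a • z) : HasSphereHomology F K := by
  intro k
  have h := finrank_reducedHomology (F := F) (K := K) (k := k)
  split_ifs with hk
  · subst hk
    have h0 : Module.finrank F (boundaries F K (size K)) = 0 := by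
      rw [boundaries_size_eq_bot, finrank_bot]
    rw [h0, add_zero] at h
    rw [h]
    refine finrank_eq_one_iff'.mpr ⟨⟨z, hz⟩, fun h => hz0 (congrArg Subtype.val h), fun c => ?_⟩
    obtain ⟨a, ha⟩ := h2 c c.2
    exact ⟨a, Subtype.ext ha.symm⟩
  · have : boundaries F K k = cycles F K k := by
      refine le_antisymm boundaries_le_cycles fun c hc => ?_
      rcases lt_or_gt_of_ne hk with hk | hk
      · exact h1 k hk c hc
      · rw [eq_zero_of_mem_chains_of_size_lt hc.1 hk]
        exact Submodule.zero_mem _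
    have h0 : Module.finrank F (boundaries F K k) = Module.finrank F (cycles F K k) := by rw [this]
    omega

theorem IsGorensteinStar.hasSphereHomology (hK : IsGorensteinStar F K) : HasSphereHomology F K := by
  have := hK.2 ∅ (isFace_empty K)
  rwa [link_empty] at this

theorem IsGorensteinStar.link {s : Finset V} (hK : IsGorensteinStar F K) (hs : IsFace K s) :
    IsGorensteinStar F (link K s) :=
  ⟨hK.1.link hs, fun t ht => by
    rw [link_link hs ht]; exact hK.2 _ ((isFace_link hs).mp ht).2⟩

end Boundary

/-! ### Ridges, strong connectedness, support of the fundamental cycle -/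

section Pseudomanifold

variable {F : Type v} [Field F] {V : Type u} [Fintype V] [LinearOrder V]
variable {K : PreAbstractSimplicialComplex V} {z : Finset V → F}

theorem boundary_apply_empty (c : Finset V → F) : boundary F V c ∅ = ∑ v, c {v} := by
  simp [boundary_apply, vertexSign]

theorem boundary_eq_zero_of_mem_chains_one {c : Finset V → F} (hc : c ∈ chains F K 1)
    (h : ∑ v, c {v} = 0) : boundary F V c = 0 := by
  ext s
  by_contra hs
  have := (mem_chains.mp (boundary_mem_chains hc) s hs).2
  rw [Finset.card_eq_zero] at this
  subst this
  rw [boundary_apply_empty] at hs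
  exact hs h

/-- The difference of two vertices. -/
theorem single_sub_single_mem_cycles {a b : V} (ha : IsFace K {a}) (hb : IsFace K {b}) :
    (Pi.single {a} 1 - Pi.single {b} 1 : Finset V → F) ∈ cycles F K 1 := by
  have h : (Pi.single {a} 1 - Pi.single {b} 1 : Finset V → F) ∈ chains F K 1 := by
    refine mem_chains.mpr fun s hs => ?_
    by_cases h1 : s = {a}
    · subst h1; exact ⟨ha, by simp⟩
    · by_cases h2 : s = {b}
      · subst h2; exact ⟨hb, by simp⟩
      · simp [h1, h2] at hs
  refine ⟨h, boundary_eq_zero_of_mem_chains_one h ?_⟩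
  simp [Pi.single_apply]

/-- A cycle supported at `a` alone has its coefficient there as augmentation, hence is zero; so the
fundamental cycle meets another vertex. -/
theorem HasSphereHomology.exists_ne_of_size_eq_one (hK : HasSphereHomology F K) (h1 : size K = 1)
    (a : V) : ∃ b, b ≠ a ∧ IsFace K {b} := by
  obtain ⟨z, hz, hz0, -⟩ := hK.exists_fundamental_cycle
  rw [h1] at hz
  by_contra! h
  have hs : ∀ s, s ≠ {a} → z s = 0 := by
    intro s hs
    by_contra hzs
    obtain ⟨hf, hc⟩ := mem_chains.mp hz.1 s hzs
    obtain ⟨b, rfl⟩ := Finset.card_eq_one.mp hc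
    exact h b (fun hb => hs (by rw [hb])) hf
  have h2 : boundary F V z ∅ = 0 := by rw [hz.2]; rfl
  rw [boundary_apply_empty, Finset.sum_eq_single a (fun b _ hb => hs _ (by simpa using hb))
    (by simp)] at h2
  refine hz0 (funext fun s => ?_)
  by_cases hsa : s = {a}
  · rw [hsa, h2]; rfl
  · exact hs s hsa

/-- With a third vertex, `{a} - {b}` and `{a} - {c}` would be independent cycles in a
one-dimensional space. -/
theorem HasSphereHomology.eq_or_eq_of_size_eq_one (hK : HasSphereHomology F K) (h1 : size K = 1)
    {a b c : V} (ha : IsFace K {a}) (hb : IsFace K {b}) (hc : IsFace K {c}) (hab : a ≠ b) :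
    c = a ∨ c = b := by
  by_contra! h
  obtain ⟨z, -, -, hz⟩ := hK.exists_fundamental_cycle
  rw [h1] at hz
  obtain ⟨r, hr⟩ := hz _ (single_sub_single_mem_cycles ha hb)
  obtain ⟨s, hs⟩ := hz _ (single_sub_single_mem_cycles ha hc)
  have e1 := congrFun hr {b}
  have e2 := congrFun hr {c}
  have e3 := congrFun hs {c}
  simp [h.1, h.2, hab.symm] at e1 e2 e3
  rcases e2 with e2 | e2 <;> simp [e2] at e1 e3

/-- The link of a ridge is a 0-sphere, i.e. two points. This lemma and the next say that a ridge
lies in exactly two facets. -/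
theorem IsGorensteinStar.exists_ne_ridge (hK : IsGorensteinStar F K) {τ : Finset V} {a : V}
    (hτ : τ.card + 1 = size K) (hf : IsFace K (insert a τ)) :
    ∃ b, b ≠ a ∧ b ∉ τ ∧ IsFace K (insert b τ) := by
  have hτf : IsFace K τ := hf.subset (Finset.subset_insert _ _)
  have h1 := hK.1.size_link hτf
  obtain ⟨b, hb, hbf⟩ := (hK.2 τ hτf).exists_ne_of_size_eq_one (by omega) a
  have := (isFace_link hτf).mp hbf
  exact ⟨b, hb, by simpa using this.1, by simpa using this.2⟩

theorem IsGorensteinStar.eq_or_eq_ridge (hK : IsGorensteinStar F K) {τ : Finset V} {a b c : V}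
    (hτ : τ.card + 1 = size K) (ha : a ∉ τ) (haf : IsFace K (insert a τ))
    (hb : b ∉ τ) (hbf : IsFace K (insert b τ)) (hc : c ∉ τ) (hcf : IsFace K (insert c τ))
    (hab : a ≠ b) : c = a ∨ c = b := by
  have hτf : IsFace K τ := haf.subset (Finset.subset_insert _ _)
  have h1 := hK.1.size_link hτf
  exact (hK.2 τ hτf).eq_or_eq_of_size_eq_one (by omega)
    ((isFace_link hτf).mpr ⟨by simpa using ha, by simpa using haf⟩)
    ((isFace_link hτf).mpr ⟨by simpa using hb, by simpa using hbf⟩)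
    ((isFace_link hτf).mpr ⟨by simpa using hc, by simpa using hcf⟩) hab

/-- Connectedness of the 1-skeleton: outside size 1 the difference of two vertices is the boundary
of a chain of edges. -/
theorem HasSphereHomology.vertex_induction (hK : HasSphereHomology F K) (h1 : size K ≠ 1)
    {P : V → Prop} (hP : ∀ a b, a ≠ b → IsFace K {a, b} → P a → P b) {a b : V}
    (ha : IsFace K {a}) (hb : IsFace K {b}) (hPa : P a) : P b := by
  classical
  obtain ⟨c, hc, hcb⟩ := hK.exists_boundary_eq h1.symm (single_sub_single_mem_cycles ha hb)
  by_contra hPb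
  -- The total coefficient on vertices satisfying `P`. It kills the boundary of every edge, as `P`
  -- agrees at both ends, but it is 1 on `{a} - {b}` if `P b` fails.
  let φ : (Finset V → F) →ₗ[F] F :=
    ∑ v ∈ Finset.univ.filter P, LinearMap.proj (R := F) (φ := fun _ : Finset V => F) {v}
  have h2 : φ (boundary F V c) = 1 := by
    rw [hcb]
    simp [φ, Pi.single_apply, hPa, hPb]
  have h3 : c = ∑ s, c s • Pi.single s 1 := by
    ext t; simp [Finset.sum_apply, Pi.single_apply]
  rw [h3, map_sum, map_sum, Finset.sum_eq_zero] at h2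
  · exact zero_ne_one h2
  intro s _
  by_cases hs : c s = 0
  · simp [hs]
  obtain ⟨hf, hcard⟩ := mem_chains.mp hc s hs
  obtain ⟨x, y, hxy, rfl⟩ := Finset.card_eq_two.mp hcard
  have hPxy : P x ↔ P y :=
    ⟨hP x y hxy hf, hP y x hxy.symm (by rwa [Finset.pair_comm])⟩
  rw [map_smul, map_smul, boundary, Fintype.linearCombination_apply_single, one_smul,
    Finset.sum_pair hxy, Finset.erase_insert (by simpa using hxy), Finset.pair_comm,
    Finset.erase_insert (by simpa using hxy.symm), Finset.pair_comm]
  have h4 : ∀ w : V, ∀ r : F, φ (Pi.single {w} r) = if P w then r else 0 := by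
    intro w r
    simp [φ, Pi.single_apply]
  rw [map_add, h4, h4]
  rcases lt_or_gt_of_ne hxy with h | h
  · simp [Finset.filter_insert, Finset.filter_singleton, h, hPxy, not_lt.mpr h.le]
    split_ifs <;> simp
  · simp [Finset.filter_insert, Finset.filter_singleton, h, hPxy, not_lt.mpr h.le]
    split_ifs <;> simp

/-- Strong connectedness, by induction on the size: facets with a common vertex are joined inside
its link, and vertices are joined along edges. -/
theorem IsGorensteinStar.facet_induction (hK : IsGorensteinStar F K) {P : Finset V → Prop}
    (hP : ∀ τ a b, τ.card + 1 = size K → a ∉ τ → b ∉ τ → a ≠ b → IsFace K (insert a τ) →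
      IsFace K (insert b τ) → P (insert a τ) → P (insert b τ))
    {s t : Finset V} (hs : IsFacet K s) (ht : IsFacet K t) (hPs : P s) : P t := by
  induction hn : size K generalizing K P s t with
  | zero =>
    rw [hK.1.isFacet_iff, hn, Finset.card_eq_zero] at hs ht
    rwa [ht.2, ← hs.2]
  | succ n ih =>
    rw [hK.1.isFacet_iff] at hs ht
    rcases Nat.eq_zero_or_pos n with rfl | hn0
    · rw [hn] at hs ht
      obtain ⟨a, rfl⟩ := Finset.card_eq_one.mp hs.2
      obtain ⟨b, rfl⟩ := Finset.card_eq_one.mp ht.2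
      by_cases hab : a = b
      · rwa [← hab]
      · simpa using hP ∅ a b (by simp [hn]) (by simp) (by simp) hab (by simpa using hs.1)
          (by simpa using ht.1) (by simpa using hPs)
    have key : ∀ (v : V) (s t : Finset V), v ∈ s → v ∈ t → IsFace K s ∧ s.card = size K →
        IsFace K t ∧ t.card = size K → P s → P t := by
      intro v s t hvs hvt hs ht hPs
      have hv : IsFace K {v} := hs.1.subset (by simpa using hvs)
      have hsz := hK.1.size_link hv
      rw [Finset.card_singleton] at hsz
      have hfac : ∀ r, v ∈ r → IsFace K r ∧ r.card = size K → IsFacet (SComplex.link K {v}) (r.erase v) := by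
        intro r hvr hr
        rw [isFacet_link hv, hK.1.isFacet_iff]
        rw [Finset.union_comm, ← Finset.insert_eq, Finset.insert_erase hvr]
        exact ⟨by simp, hr⟩
      have := ih (hK.link hv) (P := fun r => P (insert v r)) (s := s.erase v) (t := t.erase v)
        ?_ (hfac s hvs hs) (hfac t hvt ht) (by rwa [Finset.insert_erase hvs]) (by omega)
      · rwa [Finset.insert_erase hvt] at this
      · intro τ a b hτ ha hb hab haf hbf h
        rw [isFace_link hv, Finset.union_comm, ← Finset.insert_eq] at haf hbf
        simp only [Finset.disjoint_singleton_right, Finset.mem_insert, not_or] at haf hbf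
        rw [Finset.insert_comm] at h haf hbf ⊢

        refine hP _ a b ?_ ?_ ?_ hab haf.2 hbf.2 h
        · rw [Finset.card_insert_of_notMem haf.1.2]; omega
        · simp only [Finset.mem_insert, not_or]; exact ⟨Ne.symm haf.1.1, ha⟩
        · simp only [Finset.mem_insert, not_or]; exact ⟨Ne.symm hbf.1.1, hb⟩
    obtain ⟨a, ha⟩ : s.Nonempty := Finset.card_pos.mp (by omega)
    obtain ⟨b, hb⟩ : t.Nonempty := Finset.card_pos.mp (by omega)
    -- The property carried along edges is that `P` holds on all facets through the vertex; a facet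
    -- containing the edge passes it to the other end.
    have hQ := hK.hasSphereHomology.vertex_induction (by omega) (a := a) (b := b)
      (P := fun v => ∀ r, v ∈ r → IsFace K r ∧ r.card = size K → P r) ?_
      (hs.1.subset (by simpa using ha)) (ht.1.subset (by simpa using hb))
      (fun r har hr => key a s r ha har hs hr hPs)
    · exact hQ t hb ht
    · intro x y _ hxy h r hyr hr
      obtain ⟨q, hq, hqf⟩ := hK.1.exists_superset hxy
      exact key y q r (hq (by simp)) hyr hqf hr (h q (hq (by simp)) hqf)

/-- At a ridge only two coefficients enter the boundary, so if one is nonzero the other is too;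
nonvanishing spreads over all facets by strong connectedness. -/
theorem IsGorensteinStar.fundamental_cycle_ne_zero (hK : IsGorensteinStar F K)
    (hz : z ∈ cycles F K (size K)) (hz0 : z ≠ 0) {t : Finset V} (ht : IsFacet K t) : z t ≠ 0 := by
  obtain ⟨s, hs⟩ := Function.ne_iff.mp hz0
  obtain ⟨hsf, hsc⟩ := mem_chains.mp hz.1 s hs
  refine hK.facet_induction (P := fun r => z r ≠ 0) ?_ (isFacet_of_card_eq_size hsf hsc) ht hs
  intro τ a b hτ ha hb hab haf hbf hza hzb
  have h : boundary F V z τ = 0 := by rw [hz.2]; rfl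
  rw [boundary_apply, Finset.sum_eq_single a] at h
  · exact (mul_ne_zero (vertexSign_ne_zero _ _) hza) h
  · intro c hc hca
    by_contra hne
    have hzc := right_ne_zero_of_mul hne
    rw [Finset.mem_compl] at hc
    rcases hK.eq_or_eq_ridge hτ ha haf hb hbf hc (mem_chains.mp hz.1 _ hzc).1 hab with rfl | rfl
    · exact hca rfl
    · exact hzc hzb
  · simp [ha]

end Pseudomanifold

/-! ### Homology and links of the connected sum -/

section ConnectedSum

variable {F : Type v} [Field F] {V : Type u} [Fintype V] [LinearOrder V]
variable {K L : PreAbstractSimplicialComplex V} {σ : Finset V}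

theorem exists_boundary_eq_of_simplex (hσ : σ.Nonempty) {k : ℕ} {c : Finset V → F}
    (hc : c ∈ cycles F (simplex σ) k) :
    ∃ b ∈ chains F (simplex σ) (k + 1), boundary F V b = c := by
  obtain ⟨v, hv⟩ := hσ
  -- The signed cone over `c` with apex `v`.
  refine ⟨fun s => if v ∈ s then vertexSign F s v * c (s.erase v) else 0, ?_, ?_⟩
  · refine mem_chains.mpr fun s hs => ?_
    simp only [ne_eq, ite_eq_right_iff, Classical.not_imp] at hs
    obtain ⟨h1, h2⟩ := mem_chains.mp hc.1 _ (right_ne_zero_of_mul hs.2)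
    rw [Finset.card_erase_of_mem hs.1] at h2
    rw [isFace_simplex] at h1 ⊢
    have := Finset.card_pos.mpr ⟨v, hs.1⟩
    exact ⟨by rw [← Finset.insert_erase hs.1]; exact Finset.insert_subset hv h1, by omega⟩
  · ext t
    rw [boundary_apply]
    by_cases hvt : v ∈ t
    -- On faces through the apex the cycle condition at `t.erase v` expresses `c t` by the other
    -- cofaces, which are the terms of the boundary of the cone.
    · have h : boundary F V c (t.erase v) = 0 := by rw [hc.2]; rfl
      rw [boundary_apply, Finset.compl_erase, Finset.sum_insert (by simpa using hvt),
        Finset.insert_erase hvt] at h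
      have h2 : ∀ w ∈ tᶜ, vertexSign F t w * (if v ∈ insert w t then
          vertexSign F (insert w t) v * c ((insert w t).erase v) else 0) =
          - (vertexSign F t v * (vertexSign F (t.erase v) w * c (insert w (t.erase v)))) := by
        intro w hw
        rw [Finset.mem_compl] at hw
        have hwv : w ≠ v := by rintro rfl; exact hw hvt
        rw [if_pos (Finset.mem_insert_of_mem hvt), Finset.erase_insert_of_ne hwv]
        have e := Finset.insert_erase hvt
        have hv' : v ∉ t.erase v := Finset.notMem_erase _ _
        rcases lt_or_gt_of_ne hwv with hlt | hlt
        · rw [vertexSign_insert_of_lt hw hlt]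
          have : vertexSign F t w = vertexSign F (t.erase v) w := by
            conv_lhs => rw [← e]
            exact vertexSign_insert_of_not_lt (not_lt.mpr hlt.le)
          rw [this]; ring
        · rw [vertexSign_insert_of_not_lt (not_lt.mpr hlt.le)]
          have : vertexSign F t w = - vertexSign F (t.erase v) w := by
            conv_lhs => rw [← e]
            exact vertexSign_insert_of_lt hv' hlt
          rw [this]; ring
      rw [Finset.sum_congr rfl h2, Finset.sum_neg_distrib, ← Finset.mul_sum,
        eq_neg_of_add_eq_zero_right h, mul_neg, neg_neg]
      have h3 : vertexSign F (t.erase v) v = vertexSign F t v := by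
        conv_rhs => rw [← Finset.insert_erase hvt]
        rw [vertexSign_insert_self]
      rw [h3, ← mul_assoc, vertexSign_mul_self, one_mul]
    · rw [Finset.sum_eq_single v]
      · rw [if_pos (Finset.mem_insert_self _ _), Finset.erase_insert hvt, vertexSign_insert_self,
          ← mul_assoc, vertexSign_mul_self, one_mul]
      · intro w hw hwv
        rw [if_neg, mul_zero]
        simp [hvt, hwv.symm]
      · simp [hvt]

/-- A chain of `K ∪ L` is the sum of a chain of `K` and a chain of `L`. -/
theorem exists_add_of_mem_chains_sup {k : ℕ} {c : Finset V → F} (hc : c ∈ chains F (K ⊔ L) k) :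
    ∃ a ∈ chains F K k, ∃ b ∈ chains F L k, c = a + b := by
  classical
  refine ⟨fun s => if IsFace K s then c s else 0, ?_, fun s => if IsFace K s then 0 else c s, ?_, ?_⟩
  · refine mem_chains.mpr fun s hs => ?_
    simp only [ne_eq, ite_eq_right_iff, Classical.not_imp] at hs
    exact ⟨hs.1, (mem_chains.mp hc s hs.2).2⟩
  · refine mem_chains.mpr fun s hs => ?_
    simp only [ne_eq, ite_eq_left_iff, Classical.not_imp] at hs
    have := mem_chains.mp hc s hs.2
    exact ⟨(isFace_sup.mp this.1).resolve_left hs.1, this.2⟩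
  · ext s
    by_cases h : IsFace K s <;> simp [h]

/-- A cycle of `K ∪ L` is the sum of a cycle of `K` and a cycle of `L`, if `K ∩ L` is a simplex. -/
theorem exists_add_of_mem_cycles_sup (hσ : σ.Nonempty) (hKL : K ⊓ L = simplex σ) {k : ℕ}
    {c : Finset V → F} (hc : c ∈ cycles F (K ⊔ L) k) :
    ∃ a ∈ cycles F K k, ∃ b ∈ cycles F L k, c = a + b := by
  obtain ⟨a, ha, b, hb, rfl⟩ := exists_add_of_mem_chains_sup hc.1
  rcases k with _ | k
  · exact ⟨a, ⟨ha, boundary_eq_zero_of_mem_chains_zero ha⟩, b,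
      ⟨hb, boundary_eq_zero_of_mem_chains_zero hb⟩, rfl⟩
  have h0 : boundary F V a = - boundary F V b := by
    rw [eq_neg_iff_add_eq_zero, ← map_add]; exact hc.2
  -- The boundary of `a` is minus that of `b`, so it lives on common faces, that is, on the simplex.
  -- A filling there is moved from one summand to the other.
  have h1 : boundary F V a ∈ cycles F (simplex σ) k := by
    refine ⟨mem_chains.mpr fun s hs => ?_, boundary_boundary a⟩
    have h2 := mem_chains.mp (boundary_mem_chains ha) s hs
    have h3 := mem_chains.mp (boundary_mem_chains hb) s (by simpa [h0] using hs)
    rw [← hKL, isFace_inf]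
    exact ⟨⟨h2.1, h3.1⟩, h2.2⟩
  obtain ⟨e, he, hea⟩ := exists_boundary_eq_of_simplex hσ h1
  have heK : e ∈ chains F K (k + 1) :=
    chains_mono (fun s hs => (isFace_inf.mp (hKL ▸ hs)).1) he
  have heL : e ∈ chains F L (k + 1) :=
    chains_mono (fun s hs => (isFace_inf.mp (hKL ▸ hs)).2) he
  refine ⟨a - e, ⟨Submodule.sub_mem _ ha heK, ?_⟩, b + e, ⟨Submodule.add_mem _ hb heL, ?_⟩, by abel⟩
  · change boundary F V (a - e) = 0
    rw [map_sub, hea, sub_self]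
  · change boundary F V (b + e) = 0
    rw [map_add, hea, h0]; simp

theorem isFace_of_inf_eq_simplex (hKL : K ⊓ L = simplex σ) {s : Finset V} :
    s ⊆ σ ↔ IsFace K s ∧ IsFace L s := by
  rw [← isFace_simplex, ← hKL, isFace_inf]

theorem isFace_connectedSum_of_facet (hσ : σ.Nonempty) (hσK : IsFacet K σ) (hσL : IsFacet L σ)
    {s : Finset V} : IsFace (connectedSum K L σ) s ↔ (IsFace K s ∨ IsFace L s) ∧ s ≠ σ := by
  rw [isFace_connectedSum hσ, and_congr_right_iff]
  intro h
  refine not_congr ⟨fun h' => ?_, fun h' => h' ▸ subset_rfl⟩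
  exact (h.elim (fun h => hσK.2 s h h') (fun h => hσL.2 s h h')).symm

/-- If the facet found above `s` is `σ`, drop a vertex of `σ` outside `s` and cross the resulting
ridge into its other facet. -/
theorem IsGorensteinStar.exists_isFace_connectedSum (hK : IsGorensteinStar F K)
    (hσ : σ.Nonempty) (hσK : IsFacet K σ) (hσL : IsFacet L σ) {s : Finset V}
    (hs : IsFace K s) (hsσ : s ≠ σ) :
    ∃ t, s ⊆ t ∧ IsFace (connectedSum K L σ) t ∧ t.card = size K := by
  obtain ⟨t, hst, htf, htc⟩ := hK.1.exists_superset hs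
  by_cases ht : t = σ
  · subst ht
    obtain ⟨v, hv, hvs⟩ : ∃ v ∈ t, v ∉ s := by
      by_contra! h
      exact hsσ (Finset.Subset.antisymm hst h)
    have hc := Finset.card_erase_add_one hv
    obtain ⟨w, hwv, hw, hwf⟩ := hK.exists_ne_ridge (τ := t.erase v) (by omega)
      (a := v) (by rwa [Finset.insert_erase hv])
    refine ⟨insert w (t.erase v), ?_, ?_, ?_⟩
    · exact (Finset.subset_erase.mpr ⟨hst, hvs⟩).trans (Finset.subset_insert _ _)
    · rw [isFace_connectedSum_of_facet hσ hσK hσL]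
      refine ⟨Or.inl hwf, fun h => ?_⟩
      have : v ∈ insert w (t.erase v) := by rwa [h]
      simp [hwv.symm] at this
    · rw [Finset.card_insert_of_notMem hw]; omega
  · exact ⟨t, hst, (isFace_connectedSum_of_facet hσ hσK hσL).mpr ⟨Or.inl htf, ht⟩, htc⟩

theorem connectedSum_comm : connectedSum K L σ = connectedSum L K σ := by
  refine PreAbstractSimplicialComplex.ext (Set.ext fun s => ?_)
  change _ ∧ _ ↔ _ ∧ _
  rw [Set.union_comm]

theorem IsGorensteinStar.exists_isFace_connectedSum_of_isFace (hK : IsGorensteinStar F K)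
    (hL : IsGorensteinStar F L) (hσ : σ.Nonempty) (hσK : IsFacet K σ) (hσL : IsFacet L σ)
    {s : Finset V} (hs : IsFace (connectedSum K L σ) s) :
    ∃ t, s ⊆ t ∧ IsFace (connectedSum K L σ) t ∧ t.card = σ.card := by
  obtain ⟨hs, hsσ⟩ := (isFace_connectedSum_of_facet hσ hσK hσL).mp hs
  rcases hs with hs | hs
  · rw [hK.1 σ hσK]
    exact hK.exists_isFace_connectedSum hσ hσK hσL hs hsσ
  · rw [hL.1 σ hσL, connectedSum_comm]
    exact hL.exists_isFace_connectedSum hσ hσL hσK hs hsσ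

theorem IsGorensteinStar.size_connectedSum (hK : IsGorensteinStar F K)
    (hL : IsGorensteinStar F L) (hσ : σ.Nonempty) (hσK : IsFacet K σ) (hσL : IsFacet L σ) :
    size (connectedSum K L σ) = σ.card := by
  refine le_antisymm ?_ ?_
  · obtain ⟨s, hs, hc⟩ := exists_isFace_card_eq_size (connectedSum K L σ)
    rw [← hc]
    rcases ((isFace_connectedSum_of_facet hσ hσK hσL).mp hs).1 with h | h
    · exact hK.1 σ hσK ▸ h.card_le_size
    · exact hL.1 σ hσL ▸ h.card_le_size
  · obtain ⟨t, -, ht, hc⟩ :=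
      hK.exists_isFace_connectedSum_of_isFace hL hσ hσK hσL (isFace_empty (connectedSum K L σ))
    exact hc ▸ ht.card_le_size

theorem IsGorensteinStar.isPure_connectedSum (hK : IsGorensteinStar F K)
    (hL : IsGorensteinStar F L) (hσ : σ.Nonempty) (hσK : IsFacet K σ) (hσL : IsFacet L σ) :
    IsPure (connectedSum K L σ) := by
  intro s hs
  obtain ⟨t, hst, ht, hc⟩ := hK.exists_isFace_connectedSum_of_isFace hL hσ hσK hσL hs.1
  rw [hs.2 t ht hst, hc, hK.size_connectedSum hL hσ hσK hσL]

/-- Chains of the connected sum are chains of `K ∪ L` with coefficient 0 at `σ`. Cycles split over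
`K` and `L`; the fundamental cycles, nonzero at `σ`, serve to correct that coefficient. -/
theorem IsGorensteinStar.hasSphereHomology_connectedSum (hK : IsGorensteinStar F K)
    (hL : IsGorensteinStar F L) (hσ : σ.Nonempty) (hσK : IsFacet K σ) (hσL : IsFacet L σ)
    (hKL : K ⊓ L = simplex σ) : HasSphereHomology F (connectedSum K L σ) := by
  have hsz := hK.size_connectedSum hL hσ hσK hσL
  have hKs := hK.1 σ hσK
  have hLs := hL.1 σ hσL
  obtain ⟨y, hy, hy0, hy1⟩ := hK.hasSphereHomology.exists_fundamental_cycle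
  obtain ⟨z, hz, hz0, hz1⟩ := hL.hasSphereHomology.exists_fundamental_cycle
  have hyσ := hK.fundamental_cycle_ne_zero hy hy0 hσK
  have hzσ := hL.fundamental_cycle_ne_zero hz hz0 hσL
  rw [← hKs] at hy hy1
  rw [← hLs] at hz hz1
  have hup : ∀ {k : ℕ} {c : Finset V → F}, c ∈ cycles F (connectedSum K L σ) k →
      c ∈ cycles F (K ⊔ L) k ∧ c σ = 0 := by
    intro k c hc
    refine ⟨⟨chains_mono (fun s hs => ?_) hc.1, hc.2⟩, ?_⟩
    · exact isFace_sup.mpr ((isFace_connectedSum hσ).mp hs).1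
    · by_contra h
      exact ((isFace_connectedSum hσ).mp (mem_chains.mp hc.1 σ h).1).2 subset_rfl
  have hdown : ∀ {k : ℕ} {a b : Finset V → F}, a ∈ chains F K k → b ∈ chains F L k →
      (a + b) σ = 0 → a + b ∈ chains F (connectedSum K L σ) k := by
    intro k a b ha hb hab
    refine mem_chains.mpr fun s hs => ?_
    rw [isFace_connectedSum_of_facet hσ hσK hσL]
    have hsσ : s ≠ σ := by rintro rfl; exact hs hab
    by_cases has : a s = 0
    · have := mem_chains.mp hb s (fun hbs => hs (by simp [has, hbs]))
      exact ⟨⟨Or.inr this.1, hsσ⟩, this.2⟩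
    · have := mem_chains.mp ha s has
      exact ⟨⟨Or.inl this.1, hsσ⟩, this.2⟩
  -- A multiple of `σ` alone has nonzero boundary. The face found here shows below that the new top
  -- cycle is not zero.
  have hne : ∃ s, s ≠ σ ∧ y s ≠ 0 := by
    by_contra! h
    obtain ⟨v, hv⟩ := hσ
    have h1 : boundary F V y (σ.erase v) = 0 := by rw [hy.2]; rfl
    rw [boundary_apply, Finset.sum_eq_single v] at h1
    · rw [Finset.insert_erase hv] at h1
      exact mul_ne_zero (vertexSign_ne_zero _ _) hyσ h1
    · intro w _ hwv
      rw [h _ (fun h' => ?_), mul_zero]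
      have : v ∈ insert w (σ.erase v) := by rwa [h']
      simp [hwv.symm] at this
    · simp
  obtain ⟨s, hsσ, hys⟩ := hne
  -- The combination of the two fundamental cycles whose coefficient at `σ` cancels.
  refine hasSphereHomology_of_exact (z := z σ • y + (-(y σ)) • z) ?_ ?_ ?_ ?_
  · intro k hk c hc
    rw [hsz] at hk
    obtain ⟨a, ha, b, hb, rfl⟩ := exists_add_of_mem_cycles_sup hσ hKL (hup hc).1
    obtain ⟨a', ha', rfl⟩ := hK.hasSphereHomology.exists_boundary_eq (by omega) ha
    obtain ⟨b', hb', rfl⟩ := hL.hasSphereHomology.exists_boundary_eq (by omega) hb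
    by_cases hab : (a' + b') σ = 0
    · exact ⟨a' + b', hdown ha' hb' hab, map_add _ _ _⟩
    -- A filling can involve `σ` only if it is top-dimensional; then a multiple of `y` removes `σ`
    -- without changing the boundary.
    · have hk1 : k + 1 = σ.card := by
        by_cases haσ : a' σ = 0
        · exact (mem_chains.mp hb' σ (fun hbσ => hab (by simp [haσ, hbσ]))).2.symm
        · exact (mem_chains.mp ha' σ haσ).2.symm
      have hy' := hy.1
      rw [← hk1] at hy'
      refine ⟨(a' - ((a' + b') σ / y σ) • y) + b', hdown (Submodule.sub_mem _ ha'
        (Submodule.smul_mem _ _ hy')) hb' ?_, ?_⟩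
      · simp only [Pi.add_apply, Pi.sub_apply, Pi.smul_apply, smul_eq_mul]
        field_simp
        ring
      · rw [map_add, map_sub, map_smul, show boundary F V y = 0 from hy.2, smul_zero, sub_zero]
  · rw [hsz]
    refine ⟨hdown (Submodule.smul_mem _ _ hy.1) (Submodule.smul_mem _ _ hz.1) ?_, ?_⟩
    · simp only [Pi.add_apply, Pi.smul_apply, smul_eq_mul]; ring
    · exact Submodule.add_mem _ (Submodule.smul_mem _ _ hy.2) (Submodule.smul_mem _ _ hz.2)
  · intro h
    have h1 := congrFun h s
    simp only [Pi.add_apply, Pi.smul_apply, smul_eq_mul, Pi.zero_apply] at h1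
    by_cases hzs : z s = 0
    · rw [hzs, mul_zero, add_zero] at h1
      exact mul_ne_zero hzσ hys h1
    -- A face in the supports of both `y` and `z` is a subset of `σ` of full size, hence `σ`.
    · have h2 := (isFace_of_inf_eq_simplex hKL).mpr
        ⟨(mem_chains.mp hy.1 s hys).1, (mem_chains.mp hz.1 s hzs).1⟩
      exact hsσ (Finset.eq_of_subset_of_card_le h2 (mem_chains.mp hy.1 s hys).2.ge)
  · intro c hc
    rw [hsz] at hc
    obtain ⟨hc1, hcσ⟩ := hup hc
    obtain ⟨a, ha, b, hb, rfl⟩ := exists_add_of_mem_cycles_sup hσ hKL hc1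
    obtain ⟨p, rfl⟩ := hy1 a ha
    obtain ⟨q, rfl⟩ := hz1 b hb
    simp only [Pi.add_apply, Pi.smul_apply, smul_eq_mul] at hcσ
    refine ⟨p / z σ, ?_⟩
    rw [smul_add, smul_smul, smul_smul, div_mul_cancel₀ _ hzσ]
    congr 2
    field_simp
    linear_combination hcσ

/-- A face of `K` not inside `σ` is not in `L`, and neither is any face above it; nor is `σ` above
it. -/
theorem link_connectedSum_of_not_subset (hσ : σ.Nonempty) (hσK : IsFacet K σ) (hσL : IsFacet L σ)
    (hKL : K ⊓ L = simplex σ) {s : Finset V} (hs : IsFace K s) (hsσ : ¬ s ⊆ σ) :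
    link (connectedSum K L σ) s = link K s := by
  have hs' : IsFace (connectedSum K L σ) s :=
    (isFace_connectedSum_of_facet hσ hσK hσL).mpr ⟨Or.inl hs, fun h => hsσ h.subset⟩
  refine ext_isFace fun t => ?_
  rw [isFace_link hs, isFace_link hs', isFace_connectedSum_of_facet hσ hσK hσL]
  refine and_congr_right fun _ => ⟨fun h => h.1.resolve_right fun h' => hsσ ?_, fun h => ⟨Or.inl h, ?_⟩⟩
  · exact (isFace_of_inf_eq_simplex hKL).mpr ⟨hs, h'.subset Finset.subset_union_right⟩
  · rintro rfl
    exact hsσ Finset.subset_union_right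

theorem link_connectedSum_of_ssubset (hσ : σ.Nonempty) (hσK : IsFacet K σ) (hσL : IsFacet L σ)
    {s : Finset V} (hsσ : s ⊆ σ) (hne : s ≠ σ) :
    link (connectedSum K L σ) s = connectedSum (link K s) (link L s) (σ \ s) := by
  have hsK : IsFace K s := hσK.1.subset hsσ
  have hsL : IsFace L s := hσL.1.subset hsσ
  have hs' : IsFace (connectedSum K L σ) s :=
    (isFace_connectedSum_of_facet hσ hσK hσL).mpr ⟨Or.inl hsK, hne⟩
  have hne' : (σ \ s).Nonempty :=
    Finset.sdiff_nonempty.mpr fun h => hne (Finset.Subset.antisymm hsσ h)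
  refine ext_isFace fun t => ?_
  rw [isFace_link hs', isFace_connectedSum hσ, isFace_connectedSum hne', isFace_link hsK,
    isFace_link hsL, show σ \ s ⊆ t ↔ σ ⊆ t ∪ s by rw [sdiff_le_iff, sup_comm]; rfl]
  tauto

theorem isFacet_link_sdiff (hσK : IsFacet K σ) {s : Finset V} (hsσ : s ⊆ σ) :
    IsFacet (link K s) (σ \ s) := by
  rw [isFacet_link (hσK.1.subset hsσ), Finset.sdiff_union_of_subset hsσ]
  exact ⟨Finset.sdiff_disjoint, hσK⟩

theorem link_inf_link (hKL : K ⊓ L = simplex σ) {s : Finset V} (hsσ : s ⊆ σ) :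
    link K s ⊓ link L s = simplex (σ \ s) := by
  obtain ⟨hsK, hsL⟩ := (isFace_of_inf_eq_simplex hKL).mp hsσ
  refine ext_isFace fun t => ?_
  rw [isFace_inf, isFace_link hsK, isFace_link hsL, isFace_simplex, Finset.subset_sdiff]
  have h := isFace_of_inf_eq_simplex hKL (s := t ∪ s)
  rw [Finset.union_subset_iff] at h
  tauto

/-- For a proper face `s` of `σ` the two links again meet in one common facet, the nonempty `σ \ s`,
so the homology computation applies to them. -/
theorem IsGorensteinStar.connectedSum (hK : IsGorensteinStar F K)
    (hL : IsGorensteinStar F L) (hσ : σ.Nonempty) (hσK : IsFacet K σ) (hσL : IsFacet L σ)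
    (hKL : K ⊓ L = simplex σ) : IsGorensteinStar F (connectedSum K L σ) := by
  refine ⟨hK.isPure_connectedSum hL hσ hσK hσL, fun s hs => ?_⟩
  obtain ⟨hs1, hne⟩ := (isFace_connectedSum_of_facet hσ hσK hσL).mp hs
  by_cases hsσ : s ⊆ σ
  · rw [link_connectedSum_of_ssubset hσ hσK hσL hsσ hne]
    exact (hK.link (hσK.1.subset hsσ)).hasSphereHomology_connectedSum
      (hL.link (hσL.1.subset hsσ))
      (Finset.sdiff_nonempty.mpr fun h => hne (Finset.Subset.antisymm hsσ h))
      (isFacet_link_sdiff hσK hsσ) (isFacet_link_sdiff hσL hsσ) (link_inf_link hKL hsσ)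
  · rcases hs1 with h | h
    · rw [link_connectedSum_of_not_subset hσ hσK hσL hKL h hsσ]
      exact hK.2 s h
    · rw [connectedSum_comm, link_connectedSum_of_not_subset hσ hσL hσK (by rwa [inf_comm]) h hsσ]
      exact hL.2 s h

end ConnectedSum

/-! ### Euler characteristic and Dehn–Sommerville relations -/

section DehnSommerville

variable {F : Type v} [Field F] {V : Type u} [Fintype V] [LinearOrder V]
variable {K : PreAbstractSimplicialComplex V}

theorem finrank_chains (K : PreAbstractSimplicialComplex V) (k : ℕ) :
    Module.finrank F (chains F K k) = numFaces K k := by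
  classical
  let e : chains F K k ≃ₗ[F] ({s : Finset V // IsFace K s ∧ s.card = k} → F) :=
    { toFun := fun c s => c.1 s.1
      map_add' := fun _ _ => rfl
      map_smul' := fun _ _ => rfl
      invFun := fun g => ⟨fun s => if h : IsFace K s ∧ s.card = k then g ⟨s, h⟩ else 0,
        fun s hs => dif_neg hs⟩
      left_inv := fun c => Subtype.ext <| funext fun s => by
        by_cases h : IsFace K s ∧ s.card = k
        · simp [h]
        · simpa [h] using (c.2 s h).symm
      right_inv := fun g => funext fun s => by simp [s.2] }
  rw [e.finrank_eq, Module.finrank_fintype_fun_eq_card, Fintype.card_subtype, numFaces]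

theorem finrank_cycles_add_finrank_boundaries (k : ℕ) :
    Module.finrank F (cycles F K (k + 1)) + Module.finrank F (boundaries F K k) =
      numFaces K (k + 1) := by
  have h := ((boundary F V).domRestrict (chains F K (k + 1))).finrank_range_add_finrank_ker
  rw [LinearMap.range_domRestrict, LinearMap.ker_domRestrict, finrank_chains,
    ← Submodule.finrank_map_subtype_eq, Submodule.map_comap_subtype] at h
  rw [add_comm]
  exact h

theorem cycles_zero : cycles F K 0 = chains F K 0 :=
  le_antisymm inf_le_left fun _ hc => ⟨hc, boundary_eq_zero_of_mem_chains_zero hc⟩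

theorem HasSphereHomology.sum_numFaces (hK : HasSphereHomology F K) :
    ∑ k ∈ Finset.range (size K + 1), (-1 : ℤ) ^ k * (numFaces K k : ℤ) = (-1) ^ size K := by
  -- Truncated Euler–Poincaré formula: the ranks telescope, leaving only the boundaries in degree
  -- `n`, which vanish for `n = size K`.
  have h : ∀ n, ∑ k ∈ Finset.range (n + 1), (-1 : ℤ) ^ k * (numFaces K k : ℤ) =
      (-1) ^ n * (Module.finrank F (boundaries F K n) : ℤ) +
        ∑ k ∈ Finset.range (n + 1), if k = size K then (-1 : ℤ) ^ k else 0 := by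
    have hz : ∀ k, Module.finrank F (cycles F K k) =
        (if k = size K then 1 else 0) + Module.finrank F (boundaries F K k) := fun k => by
      rw [← finrank_reducedHomology, hK k]
    intro n
    induction n with
    | zero =>
      have h0 := hz 0
      rw [cycles_zero, finrank_chains] at h0
      simp only [zero_add, Finset.sum_range_one, pow_zero, one_mul, h0]
      push_cast
      ring
    | succ n ih =>
      rw [Finset.sum_range_succ, ih, Finset.sum_range_succ _ (n + 1),
        ← finrank_cycles_add_finrank_boundaries (F := F), hz]
      push_cast
      rw [mul_add, mul_add, mul_ite, mul_one, mul_zero]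
      ring
  have h0 : Module.finrank F (boundaries F K (size K)) = 0 := by
    rw [boundaries_size_eq_bot, finrank_bot]
  rw [h, h0]
  simp

open Classical in
/-- The set of all faces, including the empty one. -/
def faceFinset (K : PreAbstractSimplicialComplex V) : Finset (Finset V) :=
  Finset.univ.filter (fun s : Finset V => IsFace K s)

theorem mem_faceFinset {s : Finset V} : s ∈ faceFinset K ↔ IsFace K s := by
  simp [faceFinset]

theorem numFaces_eq_sum (K : PreAbstractSimplicialComplex V) (k : ℕ) :
    (numFaces K k : ℤ) = ∑ s ∈ faceFinset K, if s.card = k then 1 else 0 := by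
  classical
  rw [Finset.sum_boole, numFaces, faceFinset, Finset.filter_filter]

theorem sum_numFaces_mul (K : PreAbstractSimplicialComplex V) {n : ℕ} (g : ℕ → ℤ)
    (hg : ∀ k, n ≤ k → k ≤ size K → g k = 0) :
    ∑ k ∈ Finset.range n, g k * (numFaces K k : ℤ) = ∑ s ∈ faceFinset K, g s.card := by
  simp_rw [numFaces_eq_sum, Finset.mul_sum]
  rw [Finset.sum_comm]
  refine Finset.sum_congr rfl fun s hs => ?_
  by_cases h : s.card < n
  · rw [Finset.sum_eq_single s.card] <;> simp +contextual [h, eq_comm]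
  · rw [hg _ (not_lt.mp h) (mem_faceFinset.mp hs).card_le_size]
    refine Finset.sum_eq_zero fun k hk => ?_
    rw [if_neg, mul_zero]
    rintro rfl
    exact h (Finset.mem_range.mp hk)

/-- This is the reduced Euler characteristic of the link of `s`, written over the faces `t ⊇ s`
through `t ↦ t \ s`. -/
theorem IsGorensteinStar.sum_superset (hK : IsGorensteinStar F K) {s : Finset V}
    (hs : IsFace K s) :
    ∑ t ∈ (faceFinset K).filter (fun t => s ⊆ t), (-1 : ℤ) ^ (size K - t.card) = 1 := by
  have h := (hK.2 s hs).sum_numFaces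
  rw [sum_numFaces_mul _ (fun k => (-1 : ℤ) ^ k) (fun k h1 h2 => by omega)] at h
  have hsz := hK.1.size_link hs
  have h2 : ∑ t ∈ (faceFinset K).filter (fun t => s ⊆ t), (-1 : ℤ) ^ (size K - t.card) =
      ∑ t ∈ faceFinset (SComplex.link K s), (-1 : ℤ) ^ (size (SComplex.link K s) + t.card) := by
    refine Finset.sum_bij' (fun t _ => t \ s) (fun t _ => t ∪ s) ?_ ?_ ?_ ?_ ?_
    · intro t ht
      rw [Finset.mem_filter, mem_faceFinset] at ht
      rw [mem_faceFinset, isFace_link hs, Finset.sdiff_union_of_subset ht.2]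
      exact ⟨Finset.sdiff_disjoint, ht.1⟩
    · intro t ht
      rw [mem_faceFinset, isFace_link hs] at ht
      rw [Finset.mem_filter, mem_faceFinset]
      exact ⟨ht.2, Finset.subset_union_right⟩
    · intro t ht
      exact Finset.sdiff_union_of_subset (Finset.mem_filter.mp ht).2
    · intro t ht
      rw [mem_faceFinset, isFace_link hs] at ht
      rw [Finset.union_sdiff_right, Finset.sdiff_eq_self_of_disjoint ht.1]
    · intro t ht
      rw [Finset.mem_filter, mem_faceFinset] at ht
      have h3 := ht.1.card_le_size
      have h4 := Finset.card_sdiff_add_card_eq_card ht.2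
      have h5 : size (SComplex.link K s) + (t \ s).card = (size K - t.card) + 2 * (t \ s).card := by
        omega
      rw [h5, pow_add, pow_mul]; simp
  rw [h2]
  simp_rw [pow_add]
  rw [← Finset.mul_sum, h, ← pow_add, ← two_mul, pow_mul]
  simp

theorem coeff_one_sub_X_pow (m j : ℕ) :
    ((1 - Polynomial.X : Polynomial ℤ) ^ m).coeff j = (-1) ^ j * (m.choose j : ℤ) := by
  have h : (1 - Polynomial.X : Polynomial ℤ) ^ m =
      Polynomial.C ((-1) ^ m) * (Polynomial.X + Polynomial.C (-1)) ^ m := by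
    rw [map_pow, ← mul_pow]; congr 1; simp [sub_eq_add_neg]
  rw [h, Polynomial.coeff_C_mul, Polynomial.coeff_X_add_C_pow]
  rcases le_or_gt j m with hj | hj
  · obtain ⟨k, rfl⟩ := Nat.exists_eq_add_of_le hj
    rw [Nat.add_sub_cancel_left, ← mul_assoc, ← pow_add, show j + k + k = j + 2 * k by ring,
      pow_add, pow_mul]
    simp
  · simp [Nat.choose_eq_zero_of_lt hj]

/-- The `h`-polynomial. -/
def hPolynomial (K : PreAbstractSimplicialComplex V) : Polynomial ℤ :=
  ∑ s ∈ faceFinset K, Polynomial.X ^ s.card * (1 - Polynomial.X) ^ (size K - s.card)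

theorem coeff_hPolynomial (K : PreAbstractSimplicialComplex V) (k : ℕ) :
    (hPolynomial K).coeff k = hNumber K k := by
  rw [hNumber]
  have h := sum_numFaces_mul K (n := k + 1)
    (fun i => if i ≤ k then (-1 : ℤ) ^ (k - i) * ((size K - i).choose (k - i) : ℤ) else 0)
    (fun i h1 _ => if_neg (by omega))
  have h2 : ∑ i ∈ Finset.range (k + 1),
      (-1 : ℤ) ^ (k - i) * ((size K - i).choose (k - i) : ℤ) * (numFaces K i : ℤ) =
      ∑ i ∈ Finset.range (k + 1), (if i ≤ k then (-1 : ℤ) ^ (k - i) *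
        ((size K - i).choose (k - i) : ℤ) else 0) * (numFaces K i : ℤ) :=
    Finset.sum_congr rfl fun i hi => by rw [if_pos (Finset.mem_range_succ_iff.mp hi)]
  rw [h2, h, hPolynomial, Polynomial.finsetSum_coeff]
  refine Finset.sum_congr rfl fun s _ => ?_
  rw [Polynomial.coeff_X_pow_mul', coeff_one_sub_X_pow]

/-- Multiply the term of `s` by the signed sum over faces `t ⊇ s`, which is 1, and exchange the
sums: over all `s ⊆ t` the binomial theorem gives `(X + (1 - X)) ^ t.card = 1`. -/
theorem IsGorensteinStar.hPolynomial_eq (hK : IsGorensteinStar F K) :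
    hPolynomial K = ∑ s ∈ faceFinset K, (Polynomial.X - 1) ^ (size K - s.card) := by
  have h1 : hPolynomial K = ∑ s ∈ faceFinset K, ∑ t ∈ (faceFinset K).filter (fun t => s ⊆ t),
      Polynomial.C ((-1 : ℤ) ^ (size K - t.card)) * (Polynomial.X ^ s.card * (1 - Polynomial.X) ^ (size K - s.card)) := by
    refine Finset.sum_congr rfl fun s hs => ?_
    rw [← Finset.sum_mul, ← map_sum, hK.sum_superset (mem_faceFinset.mp hs), map_one, one_mul]
  simp_rw [h1, Finset.sum_filter]
  rw [Finset.sum_comm]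
  refine Finset.sum_congr rfl fun t ht => ?_
  rw [← Finset.sum_filter]
  have h2 : (faceFinset K).filter (fun s => s ⊆ t) = t.powerset := by
    ext s
    rw [Finset.mem_filter, mem_faceFinset, Finset.mem_powerset]
    exact ⟨fun h => h.2, fun h => ⟨(mem_faceFinset.mp ht).subset h, h⟩⟩
  have h3 := (mem_faceFinset.mp ht).card_le_size
  have h4 : ∀ s ∈ t.powerset,
      Polynomial.C ((-1 : ℤ) ^ (size K - t.card)) * (Polynomial.X ^ s.card * (1 - Polynomial.X) ^ (size K - s.card)) =
      (Polynomial.X - 1) ^ (size K - t.card) * (Polynomial.X ^ s.card * (1 - Polynomial.X) ^ (t.card - s.card)) := by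
    intro s hs
    have := Finset.card_le_card (Finset.mem_powerset.mp hs)
    rw [show size K - s.card = (size K - t.card) + (t.card - s.card) by omega, pow_add,
      show (Polynomial.X - 1 : Polynomial ℤ) = Polynomial.C (-1) * (1 - Polynomial.X) by simp, mul_pow, map_pow]
    ring
  rw [h2, Finset.sum_congr rfl h4, ← Finset.mul_sum, Finset.sum_pow_mul_eq_add_pow,
    add_sub_cancel, one_pow, mul_one]

/-- The two expressions of the `h`-polynomial are reversals of each other, face by face, by the
symmetry of binomial coefficients. -/
theorem IsGorensteinStar.hasSymmetricH (hK : IsGorensteinStar F K) : HasSymmetricH K := by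
  intro k hk
  rw [← coeff_hPolynomial, hK.hPolynomial_eq, ← coeff_hPolynomial, hPolynomial,
    Polynomial.finsetSum_coeff, Polynomial.finsetSum_coeff]
  refine Finset.sum_congr rfl fun s hs => ?_
  have := (mem_faceFinset.mp hs).card_le_size
  rw [Polynomial.coeff_X_pow_mul', coeff_one_sub_X_pow,
    show (Polynomial.X - 1 : Polynomial ℤ) = Polynomial.X + Polynomial.C (-1) by simp; ring,
    Polynomial.coeff_X_add_C_pow]
  split_ifs with h
  · rw [show size K - k - s.card = size K - s.card - k by omega, Nat.choose_symm (by omega)]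
  · rw [Nat.choose_eq_zero_of_lt (by omega)]; simp

end DehnSommerville

/-! ### Face ideals and the ideals `I_K + (Θ)` -/

section FaceIdeal

variable {F : Type v} [Field F] {V : Type u} {K L : PreAbstractSimplicialComplex V}

/-- Supersets of non-faces are non-faces, so membership is decided monomial by monomial. -/
theorem mem_faceIdeal {p : MvPolynomial V F} :
    p ∈ faceIdeal F K ↔ ∀ a ∈ p.support, ¬ IsFace K a.support := by
  have h : {p : MvPolynomial V F | ∃ a : V →₀ ℕ, ¬ IsFace K a.support ∧ p = monomial a 1} =
      (fun a => monomial a (1 : F)) '' {a : V →₀ ℕ | ¬ IsFace K a.support} := by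
    ext q
    simp only [Set.mem_image]
    exact ⟨fun ⟨a, h1, h2⟩ => ⟨a, h1, h2.symm⟩, fun ⟨a, h1, h2⟩ => ⟨a, h1, h2.symm⟩⟩
  rw [faceIdeal, h, mem_ideal_span_monomial_image]
  refine forall₂_congr fun a _ => ⟨?_, fun h => ⟨a, h, le_rfl⟩⟩
  rintro ⟨b, hb, hba⟩ ha
  exact hb (ha.subset (Finsupp.support_mono hba))

theorem mem_faceIdeal_iff_coeff {p : MvPolynomial V F} :
    p ∈ faceIdeal F K ↔ ∀ a, IsFace K a.support → coeff a p = 0 := by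
  rw [mem_faceIdeal]
  refine forall_congr' fun a => ?_
  rw [mem_support_iff]
  tauto

theorem monomial_mem_faceIdeal {a : V →₀ ℕ} {r : F} (ha : ¬ IsFace K a.support) :
    monomial a r ∈ faceIdeal F K := by
  classical
  refine mem_faceIdeal_iff_coeff.mpr fun b hb => ?_
  rw [coeff_monomial, if_neg]
  rintro rfl
  exact ha hb

theorem X_mem_faceIdeal {v : V} (hv : ¬ IsFace K {v}) : (X v : MvPolynomial V F) ∈ faceIdeal F K :=
  monomial_mem_faceIdeal (by rwa [Finsupp.support_single _ one_ne_zero])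

theorem faceIdeal_mono (h : ∀ s, IsFace L s → IsFace K s) : faceIdeal F K ≤ faceIdeal F L :=
  fun _ hp => mem_faceIdeal.mpr fun a ha hL => mem_faceIdeal.mp hp a ha (h _ hL)

theorem faceIdeal_sup : faceIdeal F (K ⊔ L) = faceIdeal F K ⊓ faceIdeal F L := by
  refine le_antisymm (le_inf (faceIdeal_mono fun s h => isFace_sup.mpr (Or.inl h))
    (faceIdeal_mono fun s h => isFace_sup.mpr (Or.inr h))) fun p hp => ?_
  refine mem_faceIdeal.mpr fun a ha h => ?_
  rcases isFace_sup.mp h with h | h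
  · exact mem_faceIdeal.mp hp.1 a ha h
  · exact mem_faceIdeal.mp hp.2 a ha h

theorem faceIdeal_inf : faceIdeal F (K ⊓ L) = faceIdeal F K ⊔ faceIdeal F L := by
  refine le_antisymm (Ideal.span_le.mpr ?_) (sup_le (faceIdeal_mono fun s h => (isFace_inf.mp h).1)
    (faceIdeal_mono fun s h => (isFace_inf.mp h).2))
  rintro _ ⟨a, ha, rfl⟩
  rw [isFace_inf, not_and_or] at ha
  rcases ha with ha | ha
  · exact Ideal.mem_sup_left (monomial_mem_faceIdeal ha)
  · exact Ideal.mem_sup_right (monomial_mem_faceIdeal ha)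

/-- The squarefree monomial with support `s`. -/
def faceMonomial (F : Type v) [Field F] {V : Type u} (s : Finset V) : MvPolynomial V F :=
  ∏ v ∈ s, X v

theorem faceMonomial_eq_monomial (s : Finset V) :
    faceMonomial F s = monomial (∑ v ∈ s, Finsupp.single v 1) 1 := by
  rw [faceMonomial, monomial_sum_one]; rfl

theorem support_sum_single [DecidableEq V] (s : Finset V) :
    (∑ v ∈ s, Finsupp.single v 1 : V →₀ ℕ).support = s := by
  ext v
  rw [Finsupp.mem_support_iff, Finsupp.finsetSum_apply]
  simp [Finsupp.single_apply]

theorem faceMonomial_mem_faceIdeal [DecidableEq V] {s : Finset V} (hs : ¬ IsFace K s) :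
    faceMonomial F s ∈ faceIdeal F K := by
  rw [faceMonomial_eq_monomial]
  exact monomial_mem_faceIdeal (by rwa [support_sum_single])

theorem homogeneousComponent_mem_faceIdeal {p : MvPolynomial V F} (hp : p ∈ faceIdeal F K) (n : ℕ) :
    homogeneousComponent n p ∈ faceIdeal F K := by
  classical
  refine mem_faceIdeal_iff_coeff.mpr fun a ha => ?_
  rw [coeff_homogeneousComponent, mem_faceIdeal_iff_coeff.mp hp a ha, ite_self]

theorem homogeneousComponent_mul_of_isHomogeneous {θ : MvPolynomial V F} {k : ℕ}
    (hθ : θ.IsHomogeneous k) (q : MvPolynomial V F) (n : ℕ) :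
    homogeneousComponent (k + n) (θ * q) = θ * homogeneousComponent n q := by
  conv_lhs => rw [← sum_homogeneousComponent q, Finset.mul_sum, map_sum]
  have h : ∀ i, homogeneousComponent (k + n) (θ * homogeneousComponent i q) =
      if n = i then θ * homogeneousComponent i q else 0 := fun i => by
    rw [homogeneousComponent_of_mem (hθ.mul (homogeneousComponent_isHomogeneous i q))]
    simp
  simp_rw [h]
  rw [Finset.sum_ite_eq]
  split_ifs with hn
  · rfl
  · rw [homogeneousComponent_eq_zero, mul_zero]
    simpa using hn

theorem homogeneousComponent_zero_mul_of_isHomogeneous_one {θ : MvPolynomial V F}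
    (hθ : θ.IsHomogeneous 1) (q : MvPolynomial V F) :
    homogeneousComponent 0 (θ * q) = 0 := by
  have h : coeff 0 θ = 0 := hθ.coeff_eq_zero (by simp)
  rw [homogeneousComponent_zero, ← constantCoeff_eq, map_mul, constantCoeff_eq, h, zero_mul,
    map_zero]

theorem exists_eq_single_of_degree_eq_one {a : V →₀ ℕ} (ha : a.degree = 1) :
    ∃ v, a = Finsupp.single v 1 := by
  classical
  have h0 : a ≠ 0 := by rintro rfl; simp at ha
  obtain ⟨v, hv⟩ := Finsupp.ne_iff.mp h0
  have h1 : Finsupp.single v 1 ≤ a := Finsupp.single_le_iff.mpr (Nat.one_le_iff_ne_zero.mpr hv)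
  refine ⟨v, ?_⟩
  have h2 : a - Finsupp.single v 1 + Finsupp.single v 1 = a := tsub_add_cancel_of_le h1
  have h3 := congrArg Finsupp.degree h2
  rw [map_add, Finsupp.degree_single, ha] at h3
  have h4 : a - Finsupp.single v 1 = 0 := (Finsupp.degree_eq_zero_iff _).mp (by omega)
  rw [← h2, h4, zero_add]

theorem IsHomogeneous.eq_sum_X [Fintype V] {θ : MvPolynomial V F} (hθ : θ.IsHomogeneous 1) :
    θ = ∑ v, C (coeff (Finsupp.single v 1) θ) * X v := by
  classical
  ext a
  rw [coeff_sum]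
  simp only [coeff_C_mul, coeff_X]
  by_cases ha : a.degree = 1
  · obtain ⟨v, rfl⟩ := exists_eq_single_of_degree_eq_one ha
    rw [Finset.sum_eq_single v]
    · simp
    · intro w _ hw
      rw [if_neg, mul_zero]
      intro h
      exact hw (Finsupp.single_left_injective one_ne_zero h)
    · simp
  · rw [hθ.coeff_eq_zero ha, Finset.sum_eq_zero]
    intro w _
    rw [if_neg, mul_zero]
    rintro rfl
    simp at ha

variable {d : ℕ} {Θ : Fin d → MvPolynomial V F}

theorem mem_thetaIdeal {p : MvPolynomial V F} :
    p ∈ thetaIdeal K Θ ↔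
      ∃ i ∈ faceIdeal F K, ∃ q : Fin d → MvPolynomial V F, p = i + ∑ j, Θ j * q j := by
  rw [thetaIdeal, Submodule.mem_sup]
  refine exists_congr fun i => and_congr_right fun _ => ?_
  constructor
  · rintro ⟨z, hz, rfl⟩
    obtain ⟨q, rfl⟩ := Ideal.mem_span_range_iff_exists_fun.mp hz
    exact ⟨q, by simp_rw [mul_comm]⟩
  · rintro ⟨q, rfl⟩
    exact ⟨_, Ideal.mem_span_range_iff_exists_fun.mpr ⟨q, rfl⟩, by simp_rw [mul_comm]⟩

theorem faceIdeal_le_thetaIdeal : faceIdeal F K ≤ thetaIdeal K Θ := le_sup_left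

theorem theta_mem_thetaIdeal (j : Fin d) : Θ j ∈ thetaIdeal K Θ :=
  Ideal.mem_sup_right (Ideal.subset_span ⟨j, rfl⟩)

theorem thetaIdeal_mono (h : ∀ s, IsFace L s → IsFace K s) : thetaIdeal K Θ ≤ thetaIdeal L Θ :=
  sup_le_sup_right (faceIdeal_mono h) _

/-- All generators are homogeneous, so one may pass to homogeneous parts; linear `Θ` get cofactors
of degree one less, as inductions on the degree require. -/
theorem exists_of_mem_thetaIdeal_of_isHomogeneous (hΘ : ∀ j, (Θ j).IsHomogeneous 1)
    {p : MvPolynomial V F} {n : ℕ} (hp : p ∈ thetaIdeal K Θ) (hpn : p.IsHomogeneous (n + 1)) :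
    ∃ i ∈ faceIdeal F K, i.IsHomogeneous (n + 1) ∧ ∃ q : Fin d → MvPolynomial V F,
      (∀ j, (q j).IsHomogeneous n) ∧ p = i + ∑ j, Θ j * q j := by
  obtain ⟨i, hi, q, h⟩ := mem_thetaIdeal.mp hp
  refine ⟨homogeneousComponent (n + 1) i, homogeneousComponent_mem_faceIdeal hi _,
    homogeneousComponent_isHomogeneous _ _, fun j => homogeneousComponent n (q j),
    fun j => homogeneousComponent_isHomogeneous _ _, ?_⟩
  have h1 := congrArg (homogeneousComponent (n + 1)) h
  rw [homogeneousComponent_of_mem hpn, if_pos rfl, map_add, map_sum] at h1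
  rw [h1]
  congr 1
  refine Finset.sum_congr rfl fun j _ => ?_
  rw [add_comm n 1, homogeneousComponent_mul_of_isHomogeneous (hΘ j)]

theorem homogeneousComponent_mem_thetaIdeal (hΘ : ∀ j, (Θ j).IsHomogeneous 1)
    {p : MvPolynomial V F} (hp : p ∈ thetaIdeal K Θ) (n : ℕ) :
    homogeneousComponent n p ∈ thetaIdeal K Θ := by
  obtain ⟨i, hi, q, rfl⟩ := mem_thetaIdeal.mp hp
  rw [map_add, map_sum]
  refine Ideal.add_mem _ (faceIdeal_le_thetaIdeal (homogeneousComponent_mem_faceIdeal hi n))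
    (Ideal.sum_mem _ fun j _ => ?_)
  rcases n with _ | n
  · rw [homogeneousComponent_zero_mul_of_isHomogeneous_one (hΘ j)]
    exact Ideal.zero_mem _
  · rw [add_comm n 1, homogeneousComponent_mul_of_isHomogeneous (hΘ j)]
    exact Ideal.mul_mem_right _ _ (theta_mem_thetaIdeal j)

theorem coeff_zero_of_mem_thetaIdeal (hΘ : ∀ j, (Θ j).IsHomogeneous 1)
    {p : MvPolynomial V F} (hp : p ∈ thetaIdeal K Θ) : coeff 0 p = 0 := by
  obtain ⟨i, hi, q, rfl⟩ := mem_thetaIdeal.mp hp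
  rw [coeff_add, coeff_sum, mem_faceIdeal_iff_coeff.mp hi 0 (by simpa using isFace_empty K),
    zero_add]
  refine Finset.sum_eq_zero fun j _ => ?_
  have h : coeff 0 (Θ j) = 0 := (hΘ j).coeff_eq_zero (by simp)
  rw [← constantCoeff_eq, map_mul, constantCoeff_eq, h, zero_mul]

theorem mem_gradedPiece {n : ℕ} {x : ReducedRing K Θ} :
    x ∈ gradedPiece K Θ n ↔
      ∃ p : MvPolynomial V F, p.IsHomogeneous n ∧ Ideal.Quotient.mk (thetaIdeal K Θ) p = x :=
  Iff.rfl

end FaceIdeal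

/-! ### Reduction to squarefree monomials -/

section Spans

variable {F : Type v} [Field F] {V : Type u} [Fintype V] [LinearOrder V]
variable {K L : PreAbstractSimplicialComplex V} {d : ℕ} {Θ : Fin d → MvPolynomial V F}

/-- The restrictions of the linear forms `Θ` to the variables in `s` span all linear forms in these
variables. -/
def SpansOn (Θ : Fin d → MvPolynomial V F) (s : Finset V) : Prop :=
  ∀ v ∈ s, ∃ c : Fin d → F, ∀ u ∈ s,
    ∑ j, c j * coeff (Finsupp.single u 1) (Θ j) = if u = v then 1 else 0

/-- A linear form in the ideal that agrees with `X v` on `s`. -/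
theorem SpansOn.exists_sum_mem (hΘ : ∀ j, (Θ j).IsHomogeneous 1) {s : Finset V}
    (hs : SpansOn Θ s) {v : V} (hv : v ∈ s) :
    ∃ e : V → F, X v + ∑ u ∈ sᶜ, C (e u) * X u ∈ thetaIdeal K Θ := by
  obtain ⟨c, hc⟩ := hs v hv
  refine ⟨fun u => ∑ j, c j * coeff (Finsupp.single u 1) (Θ j), ?_⟩
  have h : X v + ∑ u ∈ sᶜ, C (∑ j, c j * coeff (Finsupp.single u 1) (Θ j)) * X u =
      ∑ j, C (c j) * Θ j := by
    have h1 : ∑ j, C (c j) * Θ j =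
        ∑ u, C (∑ j, c j * coeff (Finsupp.single u 1) (Θ j)) * (X u : MvPolynomial V F) := by
      conv_lhs => enter [2, j]; rw [IsHomogeneous.eq_sum_X (hΘ j), Finset.mul_sum]
      rw [Finset.sum_comm]
      refine Finset.sum_congr rfl fun u _ => ?_
      rw [map_sum, Finset.sum_mul]
      refine Finset.sum_congr rfl fun j _ => ?_
      rw [map_mul, mul_assoc]
    rw [h1, ← Finset.sum_add_sum_compl s]
    congr 1
    rw [Finset.sum_congr rfl (fun u hu => by rw [hc u hu])]
    rw [Finset.sum_eq_single v]
    · simp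
    · intro u _ huv; simp [huv]
    · exact fun h => absurd hv h
  rw [h]
  exact Ideal.sum_mem _ fun j _ => Ideal.mul_mem_left _ _ (theta_mem_thetaIdeal j)

/-- A repeated variable can be traded, modulo `Θ`, for variables outside the support. The degree
stays and the support grows, so the process ends with squarefree monomials or non-faces. -/
theorem monomial_mem_span_faceMonomial (hΘ : ∀ j, (Θ j).IsHomogeneous 1)
    (hs : ∀ s, IsFace K s → SpansOn Θ s) (a : V →₀ ℕ) :
    monomial a (1 : F) ∈ Submodule.span F
      {p | ∃ s, IsFace K s ∧ s.card = a.degree ∧ p = faceMonomial F s} ⊔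
        (thetaIdeal K Θ).restrictScalars F := by
  induction hn : Fintype.card V - a.support.card using Nat.strong_induction_on generalizing a with
  | _ n ih =>
  by_cases ha : IsFace K a.support
  swap
  · exact Submodule.mem_sup_right (faceIdeal_le_thetaIdeal (monomial_mem_faceIdeal ha))
  by_cases h1 : ∀ v ∈ a.support, a v = 1
  · have h2 : a = ∑ v ∈ a.support, Finsupp.single v 1 := by
      conv_lhs => rw [← Finsupp.sum_single a]
      exact Finset.sum_congr rfl fun v hv => by rw [h1 v hv]
    refine Submodule.mem_sup_left (Submodule.subset_span ⟨a.support, ha, ?_, ?_⟩)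
    · rw [Finsupp.degree_apply, Finset.sum_congr rfl h1]; simp
    · rw [faceMonomial_eq_monomial, ← h2]
  · push Not at h1
    obtain ⟨v, hv, hav⟩ := h1
    have hav0 : a v ≠ 0 := Finsupp.mem_support_iff.mp hv
    obtain ⟨b, rfl⟩ : ∃ b, a = b + Finsupp.single v 1 := by
      refine ⟨a - Finsupp.single v 1, (tsub_add_cancel_of_le ?_).symm⟩
      rw [Finsupp.single_le_iff]; omega
    have hbs : (b + Finsupp.single v 1).support = b.support := by
      ext w
      by_cases hw : w = v
      · subst hw
        simp at hav
        simpa using hav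
      · simp [Ne.symm hw]
    rw [hbs] at ha hv hn
    -- `b` still has the full support, so replacing the removed `X v` by `X u` with `u` outside
    -- enlarges it.
    obtain ⟨e, he⟩ := (hs _ ha).exists_sum_mem (K := K) hΘ hv
    have h2 := Ideal.mul_mem_left _ (monomial b (1 : F)) he
    have h3 : monomial (b + Finsupp.single v 1) (1 : F) =
        monomial b 1 * (X v + ∑ u ∈ b.supportᶜ, C (e u) * X u) -
          ∑ u ∈ b.supportᶜ, e u • monomial (b + Finsupp.single u 1) (1 : F) := by
      rw [mul_add, Finset.mul_sum, eq_sub_iff_add_eq]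
      congr 1
      · rw [X, monomial_mul, one_mul]
      · refine Finset.sum_congr rfl fun u _ => ?_
        rw [smul_monomial, X, C_mul_monomial, monomial_mul, one_mul, smul_eq_mul]
    rw [h3]
    refine Submodule.sub_mem _ (Submodule.mem_sup_right h2) (Submodule.sum_mem _ fun u hu =>
      Submodule.smul_mem _ _ ?_)
    have h4 : (b + Finsupp.single u 1).support = insert u b.support := by
      ext w
      by_cases hw : w = u
      · simp [hw]
      · simp [hw]
    have h5 : u ∉ b.support := Finset.mem_compl.mp hu
    have h6 := Finset.card_le_univ (insert u b.support)
    have := ih _ ?_ (b + Finsupp.single u 1) rfl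
    · simpa using this
    · rw [h4]
      rw [Finset.card_insert_of_notMem h5] at h6 ⊢
      omega

end Spans

/-! ### Linear systems of parameters -/

section Lsop

variable {F : Type v} [Field F] {V : Type u} [Fintype V] [LinearOrder V]
variable {K L : PreAbstractSimplicialComplex V} {d : ℕ} {Θ : Fin d → MvPolynomial V F}

theorem mem_span_faceMonomial (hΘ : ∀ j, (Θ j).IsHomogeneous 1)
    (hs : ∀ s, IsFace K s → SpansOn Θ s) {p : MvPolynomial V F} {n : ℕ} (hp : p.IsHomogeneous n) :
    p ∈ Submodule.span F {p | ∃ s, IsFace K s ∧ s.card = n ∧ p = faceMonomial F s} ⊔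
        (thetaIdeal K Θ).restrictScalars F := by
  rw [← support_sum_monomial_coeff p]
  refine Submodule.sum_mem _ fun a ha => ?_
  have h := monomial_mem_span_faceMonomial (K := K) hΘ hs a
  rw [show a.degree = n from by_contra fun hn => mem_support_iff.mp ha (hp.coeff_eq_zero hn)] at h
  have := Submodule.smul_mem _ (coeff a p) h
  rwa [smul_monomial, smul_eq_mul, mul_one] at this

theorem finite_reducedRing_of_spansOn (hΘ : ∀ j, (Θ j).IsHomogeneous 1)
    (hs : ∀ s, IsFace K s → SpansOn Θ s) : Module.Finite F (ReducedRing K Θ) := by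
  classical
  refine ⟨⟨Finset.univ.image fun s => Ideal.Quotient.mk (thetaIdeal K Θ) (faceMonomial F s), ?_⟩⟩
  rw [eq_top_iff]
  rintro x -
  obtain ⟨p, rfl⟩ := Ideal.Quotient.mk_surjective x
  have h : ∀ p : MvPolynomial V F, ∀ a ∈ p.support, Ideal.Quotient.mk (thetaIdeal K Θ)
      (monomial a (1 : F)) ∈ Submodule.span F ((Finset.univ.image fun s =>
        Ideal.Quotient.mk (thetaIdeal K Θ) (faceMonomial F s) : Finset _) : Set (ReducedRing K Θ)) := by
    intro p a _
    obtain ⟨q, hq, r, hr, hqr⟩ :=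
      Submodule.mem_sup.mp (monomial_mem_span_faceMonomial (K := K) hΘ hs a)
    rw [← hqr, map_add, Ideal.Quotient.eq_zero_iff_mem.mpr hr, add_zero]
    have := Submodule.mem_map_of_mem (f := (Ideal.Quotient.mkₐ F (thetaIdeal K Θ)).toLinearMap) hq
    rw [Submodule.map_span] at this
    refine Submodule.span_mono ?_ this
    rintro _ ⟨_, ⟨s, -, -, rfl⟩, rfl⟩
    simp only [Finset.coe_image, Finset.coe_univ, Set.image_univ, Set.mem_range]
    exact ⟨s, rfl⟩
  rw [← support_sum_monomial_coeff p, map_sum]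
  refine Submodule.sum_mem _ fun a ha => ?_
  have h1 : monomial a (coeff a p) = coeff a p • monomial a (1 : F) := by
    rw [smul_monomial, smul_eq_mul, mul_one]
  rw [h1]
  exact Submodule.smul_mem _ (coeff a p) (h p a ha)

/-- In degree `d`, everything is a multiple of a given facet monomial. -/
theorem IsGorensteinStar.exists_sub_mem_thetaIdeal (hK : IsGorensteinStar F K)
    (hΘ : ∀ j, (Θ j).IsHomogeneous 1) (hs : ∀ s, IsFace K s → SpansOn Θ s)
    {σ : Finset V} (hσ : IsFacet K σ) {p : MvPolynomial V F} (hp : p.IsHomogeneous (size K)) :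
    ∃ c : F, p - C c * faceMonomial F σ ∈ thetaIdeal K Θ := by
  have key : ∀ t, IsFacet K t → faceMonomial F t ∈
      Submodule.span F {faceMonomial F σ} ⊔ (thetaIdeal K Θ).restrictScalars F := by
    intro t ht
    refine hK.facet_induction (P := fun t => faceMonomial F t ∈
      Submodule.span F {faceMonomial F σ} ⊔ (thetaIdeal K Θ).restrictScalars F) ?_ hσ ht
      (Submodule.mem_sup_left (Submodule.mem_span_singleton_self _))
    intro τ a b hτ ha hb hab haf hbf h
    -- Rewrite `X b` by variables off the facet and multiply by the ridge monomial: only the term of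
    -- `a` survives, the ridge lying in no third facet.
    obtain ⟨e, he⟩ := (hs _ hbf).exists_sum_mem (K := K) hΘ (Finset.mem_insert_self b τ)
    have h1 := Ideal.mul_mem_left _ (faceMonomial F τ) he
    have hins : ∀ u, u ∉ τ → faceMonomial F τ * X u = faceMonomial F (insert u τ) := fun u hu => by
      rw [faceMonomial, faceMonomial, Finset.prod_insert hu, mul_comm]
    have ha' : a ∈ (insert b τ)ᶜ := by simp [ha, hab]
    rw [mul_add, hins b hb, Finset.mul_sum, ← Finset.add_sum_erase _ _ ha'] at h1
    have h2 : ∑ u ∈ ((insert b τ)ᶜ).erase a, faceMonomial F τ * (C (e u) * X u) ∈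
        thetaIdeal K Θ := by
      refine Ideal.sum_mem _ fun u hu => ?_
      simp only [Finset.mem_erase, Finset.mem_compl, Finset.mem_insert, not_or] at hu
      rw [mul_left_comm, hins u hu.2.2]
      refine Ideal.mul_mem_left _ _ (faceIdeal_le_thetaIdeal (faceMonomial_mem_faceIdeal ?_))
      intro huf
      rcases hK.eq_or_eq_ridge hτ ha haf hb hbf hu.2.2 huf hab with h' | h'
      · exact hu.1 h'
      · exact hu.2.1 h'
    have h3 : faceMonomial F (insert b τ) = (faceMonomial F (insert b τ) +
        (faceMonomial F τ * (C (e a) * X a) + ∑ u ∈ ((insert b τ)ᶜ).erase a,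
          faceMonomial F τ * (C (e u) * X u))) - e a • faceMonomial F (insert a τ) -
        ∑ u ∈ ((insert b τ)ᶜ).erase a, faceMonomial F τ * (C (e u) * X u) := by
      rw [mul_left_comm, hins a ha, smul_eq_C_mul]; ring
    rw [h3]
    exact Submodule.sub_mem _ (Submodule.sub_mem _ (Submodule.mem_sup_right h1)
      (Submodule.smul_mem _ _ h)) (Submodule.mem_sup_right h2)
  have h1 : p ∈ Submodule.span F {faceMonomial F σ} ⊔ (thetaIdeal K Θ).restrictScalars F := by
    have h2 := mem_span_faceMonomial (K := K) hΘ hs hp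
    have h3 : Submodule.span F {p | ∃ s, IsFace K s ∧ s.card = size K ∧ p = faceMonomial F s} ≤
        Submodule.span F {faceMonomial F σ} ⊔ (thetaIdeal K Θ).restrictScalars F := by
      rw [Submodule.span_le]
      rintro _ ⟨s, hsf, hsc, rfl⟩
      exact key s (isFacet_of_card_eq_size hsf hsc)
    exact (sup_le h3 le_sup_right) h2
  obtain ⟨q, hq, r, hr, rfl⟩ := Submodule.mem_sup.mp h1
  obtain ⟨c, rfl⟩ := Submodule.mem_span_singleton.mp hq
  refine ⟨c, ?_⟩
  rw [smul_eq_C_mul, add_sub_cancel_left]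
  exact hr

/-- Otherwise all `Θ j` vanish at some nonzero point supported on `s`. The line through it lies in
the zero set, so `H(K, Θ)` maps onto a polynomial ring in one variable and is infinite-dimensional.
-/
theorem IsLSOP.spansOn (h : IsLSOP K Θ) {s : Finset V} (hs : IsFace K s) : SpansOn Θ s := by
  have := h.finite
  let T : (Fin d → F) →ₗ[F] (s → F) :=
    ∑ j, (LinearMap.proj (R := F) (φ := fun _ : Fin d => F) j).smulRight
      (fun u : s => coeff (Finsupp.single u.1 1) (Θ j))
  have hT : ∀ c u, T c u = ∑ j, c j * coeff (Finsupp.single u.1 1) (Θ j) := fun c u => by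
    simp [T, LinearMap.sum_apply, Finset.sum_apply]
  by_cases htop : LinearMap.range T = ⊤
  · intro v hv
    obtain ⟨c, hc⟩ := LinearMap.range_eq_top.mp htop (Pi.single ⟨v, hv⟩ 1)
    refine ⟨c, fun u hu => ?_⟩
    rw [← hT c ⟨u, hu⟩, hc]
    simp [Pi.single_apply]
  · exfalso
    obtain ⟨f, hf0, hf⟩ := Submodule.exists_le_ker_of_lt_top _ (lt_top_iff_ne_top.mpr htop)
    -- The functional `f` killing all restrictions of `Θ` to `s`, read as a point and extended by
    -- zero.
    let a : V → F := fun v => if hv : v ∈ s then f (Pi.single ⟨v, hv⟩ 1) else 0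
    have hfa : ∀ g : s → F, f g = ∑ u : s, g u * a u.1 := by
      intro g
      conv_lhs => rw [← Finset.univ_sum_single g, map_sum]
      refine Finset.sum_congr rfl fun u _ => ?_
      have : (Pi.single u (g u) : s → F) = g u • Pi.single u 1 := by
        rw [← Pi.single_smul, smul_eq_mul, mul_one]
      rw [this, map_smul, smul_eq_mul]
      simp [a]
    have ha : ∀ j, ∑ v, coeff (Finsupp.single v 1) (Θ j) * a v = 0 := by
      intro j
      have h1 : f (T (Pi.single j 1)) = 0 := hf ⟨_, rfl⟩
      have h2 : T (Pi.single j 1) = fun u : s => coeff (Finsupp.single u.1 1) (Θ j) := by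
        ext u; rw [hT]; simp [Pi.single_apply]
      rw [hfa, h2, Finset.sum_coe_sort s
        (fun v => coeff (Finsupp.single v 1) (Θ j) * a v)] at h1
      rw [← h1]
      symm
      refine Finset.sum_subset (Finset.subset_univ _) fun v _ hv => ?_
      simp [a, hv]
    obtain ⟨v, hv⟩ : ∃ v, a v ≠ 0 := by
      by_contra! h0
      exact hf0 (LinearMap.ext fun g => by rw [hfa]; simp [h0])
    have hvs : ∀ v, v ∉ s → a v = 0 := fun v hv => by simp [a, hv]
    let χ : MvPolynomial V F →ₐ[F] Polynomial F :=
      aeval fun v => Polynomial.C (a v) * Polynomial.X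
    have hχ : ∀ p ∈ thetaIdeal K Θ, χ p = 0 := by
      intro p hp
      change p ∈ RingHom.ker χ.toRingHom
      refine (sup_le (Ideal.span_le.mpr ?_) (Ideal.span_le.mpr ?_) :
        thetaIdeal K Θ ≤ RingHom.ker χ.toRingHom) hp
      · rintro _ ⟨b, hb, rfl⟩
        change χ (monomial b 1) = 0
        obtain ⟨w, hw, hws⟩ := Finset.not_subset.mp fun hbs => hb (hs.subset hbs)
        rw [aeval_monomial, map_one, one_mul]
        refine Finset.prod_eq_zero hw ?_
        change (Polynomial.C (a w) * Polynomial.X) ^ b w = 0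
        rw [hvs w hws, map_zero, zero_mul, zero_pow (Finsupp.mem_support_iff.mp hw)]
      · rintro _ ⟨j, rfl⟩
        change χ (Θ j) = 0
        rw [IsHomogeneous.eq_sum_X (h.linear j), map_sum]
        have : ∀ u, χ (C (coeff (Finsupp.single u 1) (Θ j)) * X u) =
            Polynomial.C (coeff (Finsupp.single u 1) (Θ j) * a u) * Polynomial.X := fun u => by
          rw [map_mul, aeval_X, ← algebraMap_eq, AlgHom.commutes, ← mul_assoc, map_mul]; rfl
        simp_rw [this]
        rw [← Finset.sum_mul, ← map_sum, ha j, map_zero, zero_mul]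
    let χ' : ReducedRing K Θ →ₐ[F] Polynomial F := Ideal.Quotient.liftₐ (thetaIdeal K Θ) χ hχ
    have hX : Function.Surjective χ' := by
      rw [← AlgHom.range_eq_top, eq_top_iff, ← Polynomial.adjoin_X, Algebra.adjoin_le_iff,
        Set.singleton_subset_iff]
      refine ⟨Ideal.Quotient.mk _ (C (a v)⁻¹ * X v), ?_⟩
      change χ (C (a v)⁻¹ * X v) = _
      rw [map_mul, aeval_X, ← algebraMap_eq, AlgHom.commutes, ← mul_assoc,
        show algebraMap F (Polynomial F) (a v)⁻¹ = Polynomial.C (a v)⁻¹ from rfl, ← map_mul,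
        inv_mul_cancel₀ hv, map_one, one_mul]
    have h3 : Module.Finite F (Polynomial F) := Module.Finite.of_surjective χ'.toLinearMap hX
    exact Polynomial.not_finite h3

/-- The coefficients of the first `s.card` forms of `θ` at the variables in `s`. -/
def coeffMatrix (θ : ℕ → MvPolynomial V F) (s : Finset V) : Matrix (Fin s.card) (Fin s.card) F :=
  Matrix.of fun i l => coeff (Finsupp.single (s.equivFin.symm l).1 1) (θ i)

/-- If the first forms of `θ` restrict to a basis of the linear forms on `s`, they are coordinates
of the face ring of the simplex on `s`. -/
theorem exists_coordinates {θ : ℕ → MvPolynomial V F} (hθ : ∀ i, (θ i).IsHomogeneous 1)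
    {s : Finset V} (hs : (coeffMatrix θ s).det ≠ 0) :
    ∃ φ : MvPolynomial V F →ₐ[F] MvPolynomial (Fin s.card) F,
      (∀ i : Fin s.card, φ (θ i) = X i) ∧ (∀ p ∈ faceIdeal F (simplex s), φ p = 0) ∧
      ∀ p, p - aeval (fun i : Fin s.card => θ i) (φ p) ∈ faceIdeal F (simplex s) := by
  set N := coeffMatrix θ s with hN
  have hu : IsUnit N.det := hs.isUnit
  -- The inverse matrix expresses each variable in `s` through the forms; variables outside `s` are
  -- zero in the face ring.
  let φ : MvPolynomial V F →ₐ[F] MvPolynomial (Fin s.card) F := aeval fun v =>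
    if hv : v ∈ s then ∑ i, C (N⁻¹ (s.equivFin ⟨v, hv⟩) i) * X i else 0
  have hφ1 : ∀ l, φ (X (s.equivFin.symm l).1) = ∑ i, C (N⁻¹ l i) * X i := fun l => by
    simp [φ]
  have hφ0 : ∀ v ∉ s, φ (X v) = 0 := fun v hv => by simp [φ, hv]

  have hC : ∀ c : F, φ (C c) = C c := fun c => by rw [← algebraMap_eq, AlgHom.commutes]; rfl
  refine ⟨φ, fun i => ?_, fun p hp => ?_, fun p => ?_⟩
  · rw [IsHomogeneous.eq_sum_X (hθ i), map_sum, ← Finset.sum_subset (Finset.subset_univ s)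
      (fun v _ hv => by rw [map_mul, hφ0 v hv, mul_zero]), ← Finset.sum_coe_sort s,
      ← s.equivFin.symm.sum_comp]
    have : ∀ l, φ (C (coeff (Finsupp.single (s.equivFin.symm l).1 1) (θ i)) *
        X (s.equivFin.symm l).1) = ∑ i', C (N i l * N⁻¹ l i') * X i' := fun l => by
      rw [map_mul, hC, hφ1, Finset.mul_sum]
      refine Finset.sum_congr rfl fun i' _ => ?_
      rw [map_mul, mul_assoc]; rfl
    simp_rw [this]
    rw [Finset.sum_comm]
    simp_rw [← Finset.sum_mul, ← map_sum, ← Matrix.mul_apply, Matrix.mul_nonsing_inv N hu,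
      Matrix.one_apply]
    simp
  · change p ∈ RingHom.ker φ.toRingHom
    refine (Ideal.span_le.mpr ?_ : faceIdeal F (simplex s) ≤ RingHom.ker φ.toRingHom) hp
    rintro _ ⟨b, hb, rfl⟩
    change φ (monomial b 1) = 0
    rw [isFace_simplex] at hb
    obtain ⟨w, hw, hws⟩ := Finset.not_subset.mp hb
    rw [monomial_eq, map_mul, hC, map_one, one_mul, Finsupp.prod, map_prod]
    refine Finset.prod_eq_zero hw ?_
    rw [map_pow, hφ0 w hws, zero_pow (Finsupp.mem_support_iff.mp hw)]
  · rw [← Ideal.Quotient.eq_zero_iff_mem, map_sub, sub_eq_zero]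
    -- Going to coordinates and back is the identity modulo the face ideal, which only needs
    -- checking on variables.
    have h : (Ideal.Quotient.mkₐ F (faceIdeal F (simplex s))) =
        (Ideal.Quotient.mkₐ F (faceIdeal F (simplex s))).comp
          ((aeval fun i : Fin s.card => θ i).comp φ) := by
      refine MvPolynomial.algHom_ext fun v => ?_
      rw [AlgHom.comp_apply, AlgHom.comp_apply, Ideal.Quotient.mkₐ_eq_mk]
      by_cases hv : v ∈ s
      · obtain ⟨l, rfl⟩ : ∃ l, (s.equivFin.symm l).1 = v := ⟨s.equivFin ⟨v, hv⟩, by simp⟩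
        have h1 : ∀ i, Ideal.Quotient.mk (faceIdeal F (simplex s)) (θ i) =
            Ideal.Quotient.mk (faceIdeal F (simplex s))
              (∑ l, C (coeff (Finsupp.single (s.equivFin.symm l).1 1) (θ i)) *
                X (s.equivFin.symm l).1) := fun i => by
          conv_lhs => rw [IsHomogeneous.eq_sum_X (hθ i)]
          rw [← Finset.sum_add_sum_compl s, map_add, s.equivFin.symm.sum_comp (fun v : s =>
            C (coeff (Finsupp.single v.1 1) (θ i)) * (X v.1 : MvPolynomial V F)),
            Finset.sum_coe_sort s
              (fun v => C (coeff (Finsupp.single v 1) (θ i)) * (X v : MvPolynomial V F))]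
          rw [add_eq_left, Ideal.Quotient.eq_zero_iff_mem]
          refine Ideal.sum_mem _ fun v hv => Ideal.mul_mem_left _ _ (X_mem_faceIdeal ?_)
          rw [isFace_simplex, Finset.singleton_subset_iff]
          exact Finset.mem_compl.mp hv
        rw [hφ1, map_sum, map_sum]
        have h2 : ∀ i : Fin s.card, Ideal.Quotient.mk (faceIdeal F (simplex s))
            (aeval (fun i : Fin s.card => θ i) (C (N⁻¹ l i) * X i)) =
            ∑ l', Ideal.Quotient.mk (faceIdeal F (simplex s))
              (C (N⁻¹ l i * N i l') * X (s.equivFin.symm l').1) := fun i => by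
          rw [map_mul, aeval_X, aeval_C, map_mul, h1, ← map_mul, Finset.mul_sum, map_sum]
          refine Finset.sum_congr rfl fun l' _ => ?_
          rw [map_mul C, mul_assoc]; rfl
        simp_rw [h2]
        rw [Finset.sum_comm]
        simp_rw [← map_sum, ← Finset.sum_mul, ← map_sum, ← Matrix.mul_apply,
          Matrix.nonsing_inv_mul N hu, Matrix.one_apply]
        simp
      · rw [hφ0 v hv, map_zero, map_zero, Ideal.Quotient.eq_zero_iff_mem]
        exact X_mem_faceIdeal (by rwa [isFace_simplex, Finset.singleton_subset_iff])
    exact DFunLike.congr_fun h p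

end Lsop

/-! ### Weakly regular sequences and exact sequences -/

section Regular

variable {A : Type u} [CommRing A] {M M' M'' : Type*} [AddCommGroup M] [Module A M]
  [AddCommGroup M'] [Module A M'] [AddCommGroup M''] [Module A M'']

/-- The submodule `θ₀ M + ⋯ + θ_{j-1} M`. -/
def partialSpan (θ : ℕ → A) (M : Type*) [AddCommGroup M] [Module A M] (j : ℕ) : Submodule A M where
  carrier := {m | ∃ q : ℕ → M, m = ∑ i ∈ Finset.range j, θ i • q i}
  add_mem' := by
    rintro _ _ ⟨p, rfl⟩ ⟨q, rfl⟩
    exact ⟨fun i => p i + q i, by simp [Finset.sum_add_distrib]⟩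
  zero_mem' := ⟨0, by simp⟩
  smul_mem' := by
    rintro r _ ⟨q, rfl⟩
    exact ⟨fun i => r • q i, by rw [Finset.smul_sum]; simp_rw [smul_comm r]⟩

/-- `θ₀, …, θ_{k-1}` is a weakly regular sequence on `M`. -/
def IsRegularUpTo (θ : ℕ → A) (M : Type*) [AddCommGroup M] [Module A M] (k : ℕ) : Prop :=
  ∀ j < k, ∀ m : M, θ j • m ∈ partialSpan θ M j → m ∈ partialSpan θ M j

variable {θ : ℕ → A} {j k : ℕ}

theorem mem_partialSpan {m : M} :
    m ∈ partialSpan θ M j ↔ ∃ q : ℕ → M, m = ∑ i ∈ Finset.range j, θ i • q i := Iff.rfl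

theorem mem_partialSpan_zero {m : M} : m ∈ partialSpan θ M 0 ↔ m = 0 := by
  simp [mem_partialSpan]

theorem smul_mem_partialSpan {i : ℕ} (hi : i < j) (m : M) : θ i • m ∈ partialSpan θ M j :=
  ⟨Pi.single i m, by
    rw [Finset.sum_eq_single i] <;> simp +contextual [hi]⟩

theorem mem_partialSpan_succ {m : M} :
    m ∈ partialSpan θ M (j + 1) ↔ ∃ n, m - θ j • n ∈ partialSpan θ M j := by
  constructor
  · rintro ⟨q, rfl⟩
    exact ⟨q j, q, by rw [Finset.sum_range_succ, add_sub_cancel_right]⟩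
  · rintro ⟨n, q, h⟩
    rw [sub_eq_iff_eq_add] at h
    rw [h]
    exact add_mem (sum_mem fun i hi => smul_mem_partialSpan
      ((Finset.mem_range.mp hi).trans (Nat.lt_succ_self j)) _)
      (smul_mem_partialSpan (Nat.lt_succ_self j) _)

theorem partialSpan_mono {i : ℕ} (hij : i ≤ j) : partialSpan θ M i ≤ partialSpan θ M j := by
  rintro _ ⟨q, rfl⟩
  exact sum_mem fun l hl => smul_mem_partialSpan ((Finset.mem_range.mp hl).trans_le hij) _

theorem map_mem_partialSpan (f : M →ₗ[A] M') {m : M} (hm : m ∈ partialSpan θ M j) :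
    f m ∈ partialSpan θ M' j := by
  obtain ⟨q, rfl⟩ := hm
  exact ⟨fun i => f (q i), by simp⟩

theorem exists_of_mem_partialSpan {g : M →ₗ[A] M''} (hg : Function.Surjective g) {y : M''}
    (hy : y ∈ partialSpan θ M'' j) : ∃ x ∈ partialSpan θ M j, g x = y := by
  obtain ⟨q, rfl⟩ := hy
  choose p hp using hg
  exact ⟨_, ⟨fun i => p (q i), rfl⟩, by simp [hp]⟩

theorem partialSpan_self_eq_span : partialSpan θ A j = Ideal.span (θ '' Set.Iio j) := by
  refine le_antisymm ?_ (Ideal.span_le.mpr ?_)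
  · rintro _ ⟨q, rfl⟩
    exact sum_mem fun i hi => Ideal.mul_mem_right _ _
      (Ideal.subset_span ⟨i, Finset.mem_range.mp hi, rfl⟩)
  · rintro _ ⟨i, hi, rfl⟩
    simpa using smul_mem_partialSpan (θ := θ) (M := A) (Set.mem_Iio.mp hi) 1

section Exact

variable {f : M' →ₗ[A] M} {g : M →ₗ[A] M''}

/-- Regularity on the quotient `M''` makes the first Tor vanish, so `M' → M` remains injective
modulo the first `j` elements; here by induction on `j`. -/
theorem mem_partialSpan_of_exact (hf : Function.Injective f) (hg : Function.Surjective g)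
    (hfg : ∀ m, g m = 0 ↔ ∃ m', f m' = m) (h : IsRegularUpTo θ M'' k) (hj : j ≤ k) {m' : M'}
    (hm : f m' ∈ partialSpan θ M j) : m' ∈ partialSpan θ M' j := by
  induction j generalizing m' with
  | zero =>
    rw [mem_partialSpan_zero] at hm ⊢
    exact hf (by rw [hm, map_zero])
  | succ j ih =>
    obtain ⟨n, hn⟩ := mem_partialSpan_succ.mp hm
    have h0 : g (f m') = 0 := (hfg _).mpr ⟨_, rfl⟩
    have h1 := map_mem_partialSpan g hn
    rw [map_sub, h0, zero_sub, map_smul, Submodule.neg_mem_iff] at h1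
    -- Regularity puts `g n` in the span; subtracting a lift `u` from the span moves `n` into the
    -- kernel of `g`, hence into the image of `f`.
    obtain ⟨u, hu, hun⟩ := exists_of_mem_partialSpan hg (h j hj _ h1)
    obtain ⟨n', hn'⟩ := (hfg (n - u)).mp (by rw [map_sub, hun, sub_self])
    refine mem_partialSpan_succ.mpr ⟨n', ih (Nat.le_of_succ_le hj) ?_⟩
    rw [map_sub, map_smul, hn', smul_sub]
    have := add_mem hn (Submodule.smul_mem _ (θ j) hu)
    convert this using 1
    abel

/-- The depth lemma: a kernel may have depth one more than the quotient. -/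
theorem IsRegularUpTo.of_exact (hf : Function.Injective f) (hg : Function.Surjective g)
    (hfg : ∀ m, g m = 0 ↔ ∃ m', f m' = m) (hM : IsRegularUpTo θ M (k + 1))
    (h : IsRegularUpTo θ M'' k) : IsRegularUpTo θ M' (k + 1) := by
  intro j hj m' hm'
  refine mem_partialSpan_of_exact hf hg hfg h (Nat.le_of_lt_succ hj) (hM j hj _ ?_)
  rw [← map_smul]
  exact map_mem_partialSpan f hm'

end Exact

theorem mem_span_X_of_X_mul_mem {F : Type v} [Field F] {n : ℕ} {S : Set (Fin n)} {i : Fin n}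
    (hi : i ∉ S) {p : MvPolynomial (Fin n) F}
    (h : X i * p ∈ Ideal.span (X '' S : Set (MvPolynomial (Fin n) F))) :
    p ∈ Ideal.span (X '' S : Set (MvPolynomial (Fin n) F)) := by
  rw [mem_ideal_span_X_image] at h ⊢
  intro a ha
  obtain ⟨l, hl, hal⟩ := h (Finsupp.single i 1 + a) (by
    rw [mem_support_iff, coeff_X_mul]; exact mem_support_iff.mp ha)
  refine ⟨l, hl, ?_⟩
  have : l ≠ i := by rintro rfl; exact hi hl
  simpa [Finsupp.single_apply, this.symm] using hal

end Regular

/-! ### Regularity on the face ring of a simplex -/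

section SimplexRegular

variable {F : Type v} [Field F] {V : Type u} [Fintype V] [LinearOrder V]

theorem mem_partialSpan_faceRing {K : PreAbstractSimplicialComplex V} {θ : ℕ → MvPolynomial V F}
    {j : ℕ} {p : MvPolynomial V F} :
    Ideal.Quotient.mk (faceIdeal F K) p ∈ partialSpan θ (FaceRing F K) j ↔
      ∃ i ∈ faceIdeal F K, ∃ q : ℕ → MvPolynomial V F,
        p = i + ∑ l ∈ Finset.range j, θ l * q l := by
  have hmk : ∀ q : ℕ → MvPolynomial V F, ∑ l ∈ Finset.range j, θ l • Ideal.Quotient.mk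
      (faceIdeal F K) (q l) = Ideal.Quotient.mk (faceIdeal F K)
        (∑ l ∈ Finset.range j, θ l * q l) := fun q => by
    rw [map_sum]
    exact Finset.sum_congr rfl fun l _ => rfl
  constructor
  · rintro ⟨q, hq⟩
    choose r hr using fun l => Ideal.Quotient.mk_surjective (q l)
    simp_rw [← hr, hmk] at hq
    exact ⟨_, Ideal.Quotient.eq.mp hq, r, by ring⟩
  · rintro ⟨i, hi, q, rfl⟩
    refine ⟨fun l => Ideal.Quotient.mk _ (q l), ?_⟩
    rw [hmk, map_add, Ideal.Quotient.eq_zero_iff_mem.mpr hi, zero_add]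

/-- In the coordinates of `exists_coordinates` the forms are the variables of a polynomial ring. -/
theorem isRegularUpTo_simplex {θ : ℕ → MvPolynomial V F} (hθ : ∀ i, (θ i).IsHomogeneous 1)
    {s : Finset V} (hs : (coeffMatrix θ s).det ≠ 0) :
    IsRegularUpTo θ (FaceRing F (simplex s)) s.card := by
  obtain ⟨φ, hφ1, hφ2, hφ3⟩ := exists_coordinates hθ hs
  intro j hj m hm
  obtain ⟨p, rfl⟩ := Ideal.Quotient.mk_surjective m
  obtain ⟨i, hi, q, h⟩ := mem_partialSpan_faceRing.mp
    (show Ideal.Quotient.mk (faceIdeal F (simplex s)) (θ j * p) ∈ _ from hm)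
  let Y : ℕ → MvPolynomial (Fin s.card) F := fun l => if h : l < s.card then X ⟨l, h⟩ else 0
  have hY : ∀ l (hl : l < s.card), Y l = X ⟨l, hl⟩ := fun l hl => dif_pos hl
  have hφY : ∀ l, l < s.card → φ (θ l) = Y l := fun l hl => by rw [hY l hl, ← hφ1]
  have himg : Y '' Set.Iio j = X '' {l : Fin s.card | l.1 < j} := by
    ext y
    constructor
    · rintro ⟨l, hl, rfl⟩
      exact ⟨⟨l, lt_trans hl hj⟩, hl, (hY l _).symm⟩
    · rintro ⟨l, hl, rfl⟩
      exact ⟨l, hl, hY l l.2⟩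
  have h1 : φ p ∈ partialSpan Y (MvPolynomial (Fin s.card) F) j := by
    rw [partialSpan_self_eq_span, himg]
    refine mem_span_X_of_X_mul_mem (i := ⟨j, hj⟩) (by simp) ?_
    rw [← himg, ← partialSpan_self_eq_span, ← hφ1, ← map_mul, h, map_add, hφ2 i hi, zero_add,
      map_sum]
    refine sum_mem fun l hl => ?_
    rw [map_mul, hφY l (lt_trans (Finset.mem_range.mp hl) hj)]
    exact smul_mem_partialSpan (Finset.mem_range.mp hl) _
  obtain ⟨r, hr⟩ := h1
  refine mem_partialSpan_faceRing.mpr ⟨_, hφ3 p, fun l => aeval (fun i : Fin s.card => θ i) (r l), ?_⟩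
  rw [hr, map_sum]
  have : ∀ l ∈ Finset.range j, aeval (fun i : Fin s.card => θ i) (Y l • r l) =
      θ l * aeval (fun i : Fin s.card => θ i) (r l) := fun l hl => by
    rw [smul_eq_mul, map_mul, hY l (lt_trans (Finset.mem_range.mp hl) hj), aeval_X]
  rw [Finset.sum_congr rfl this, sub_add_cancel]

end SimplexRegular

/-! ### Chains on the star of a face -/

section Star

variable {F : Type v} [Field F] {V : Type u} [Fintype V] [LinearOrder V]
variable {K : PreAbstractSimplicialComplex V} {s : Finset V} {k : ℕ} {c z : Finset V → F}

/-- The product of the signs of the elements of `t` relative to `s`. -/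
def joinSign (F : Type v) [Field F] {V : Type u} [LinearOrder V] (s t : Finset V) : F :=
  ∏ v ∈ t, vertexSign F s v

theorem joinSign_mul_self (s t : Finset V) : joinSign F s t * joinSign F s t = 1 := by
  rw [joinSign, ← Finset.prod_mul_distrib]
  exact Finset.prod_eq_one fun v _ => vertexSign_mul_self s v

/-- The chain of the link of `s` given by a chain on the star of `s`. -/
def toLink (s : Finset V) (c : Finset V → F) : Finset V → F :=
  fun t => if Disjoint t s then joinSign F s t * c (t ∪ s) else 0

/-- The sign of a vertex relative to a disjoint union is the product of its two signs; `joinSign`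
absorbs the one relative to `s`. -/
theorem boundary_toLink (s : Finset V) (c : Finset V → F) :
    boundary F V (toLink s c) = toLink s (boundary F V c) := by
  ext t
  rw [boundary_apply, toLink]
  split_ifs with ht
  · rw [boundary_apply, Finset.mul_sum]
    have hsub : (t ∪ s)ᶜ ⊆ tᶜ := Finset.compl_subset_compl.mpr Finset.subset_union_left
    rw [← Finset.sum_subset hsub]
    · refine Finset.sum_congr rfl fun v hv => ?_
      simp only [Finset.mem_compl, Finset.mem_union, not_or] at hv
      have hd : Disjoint (insert v t) s := Finset.disjoint_insert_left.mpr ⟨hv.2, ht⟩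
      rw [toLink, if_pos hd, Finset.insert_union, joinSign, Finset.prod_insert hv.1,
        vertexSign_union ht, joinSign]
      ring
    · intro v hv hv'
      simp only [Finset.mem_compl, Finset.mem_union, not_or, not_and, not_not] at hv hv'
      rw [toLink, if_neg, mul_zero]
      rw [Finset.disjoint_insert_left, not_and]
      exact fun h => absurd (hv' hv) h
  · refine Finset.sum_eq_zero fun v _ => ?_
    rw [toLink, if_neg, mul_zero]
    exact fun h => ht (Finset.disjoint_of_subset_left (Finset.subset_insert _ _) h)

theorem toLink_mem_cycles (hs : IsFace K s) (hc : c ∈ chains F K (k + s.card))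
    (h : ∀ t, s ⊆ t → boundary F V c t = 0) : toLink s c ∈ cycles F (link K s) k := by
  refine ⟨mem_chains.mpr fun t ht => ?_, ?_⟩
  · rw [toLink] at ht
    simp only [ne_eq, ite_eq_right_iff, Classical.not_imp] at ht
    obtain ⟨h1, h2⟩ := mem_chains.mp hc _ (right_ne_zero_of_mul ht.2)
    rw [Finset.card_union_of_disjoint ht.1] at h2
    exact ⟨(isFace_link hs).mpr ⟨ht.1, h1⟩, by omega⟩
  · change boundary F V (toLink s c) = 0
    rw [boundary_toLink]
    ext t
    rw [toLink, h _ Finset.subset_union_right]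
    simp

theorem apply_eq_of_toLink {t : Finset V} (hst : s ⊆ t) :
    c t = joinSign F s (t \ s) * toLink s c (t \ s) := by
  rw [toLink, if_pos Finset.sdiff_disjoint, Finset.sdiff_union_of_subset hst, ← mul_assoc,
    joinSign_mul_self, one_mul]

/-- Looking only at faces containing `s` gives the chain complex of the link of `s`, shifted by
`s.card`, which is exact below the top. -/
theorem IsGorensteinStar.exists_boundary_eq_star (hK : IsGorensteinStar F K) (hs : IsFace K s)
    (hk : k ≠ size K) (hc : c ∈ chains F K k) (h : ∀ t, s ⊆ t → boundary F V c t = 0) :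
    ∃ b ∈ chains F K (k + 1), ∀ t, s ⊆ t → boundary F V b t = c t := by
  -- No face with fewer vertices than `s` contains `s`, so the zero chain works.
  by_cases hks : k < s.card
  · refine ⟨0, Submodule.zero_mem _, fun t ht => ?_⟩
    rw [map_zero, Pi.zero_apply]
    by_contra h0
    have := (mem_chains.mp hc t (Ne.symm h0)).2
    have := Finset.card_le_card ht
    omega
  obtain ⟨l, rfl⟩ := Nat.exists_eq_add_of_le' (not_lt.mp hks)
  have hsz := hK.1.size_link hs
  obtain ⟨b, hb, hbc⟩ := (hK.2 s hs).exists_boundary_eq (by omega) (toLink_mem_cycles hs hc h)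
  have hb' : ∀ t, b t ≠ 0 → Disjoint t s ∧ IsFace K (t ∪ s) ∧ t.card = l + 1 := fun t ht => by
    have := mem_chains.mp hb t ht
    rw [isFace_link hs] at this
    exact ⟨this.1.1, this.1.2, this.2⟩
  let e : Finset V → F := fun t => if s ⊆ t then joinSign F s (t \ s) * b (t \ s) else 0
  have he : toLink s e = b := by
    ext t
    by_cases ht : Disjoint t s
    · rw [toLink, if_pos ht]
      simp only [e]
      rw [if_pos Finset.subset_union_right, Finset.union_sdiff_right,
        Finset.sdiff_eq_self_of_disjoint ht, ← mul_assoc, joinSign_mul_self, one_mul]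
    · rw [toLink, if_neg ht]
      by_contra h0
      exact ht (hb' t (Ne.symm h0)).1
  refine ⟨e, mem_chains.mpr fun t ht => ?_, fun t ht => ?_⟩
  · simp only [e, ne_eq, ite_eq_right_iff, Classical.not_imp] at ht
    obtain ⟨-, h2, h3⟩ := hb' _ (right_ne_zero_of_mul ht.2)
    rw [Finset.sdiff_union_of_subset ht.1] at h2
    have := Finset.card_sdiff_add_card_eq_card ht.1
    exact ⟨h2, by omega⟩
  · rw [apply_eq_of_toLink (c := boundary F V e) ht, ← boundary_toLink, he, hbc,
      ← apply_eq_of_toLink ht]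

/-- In the top degree the link has a one-dimensional space of cycles, spanned by the image of `z`,
which is nonzero because `z` is nonzero on every facet. -/
theorem IsGorensteinStar.exists_eq_mul_star (hK : IsGorensteinStar F K) (hs : IsFace K s)
    (hz : z ∈ cycles F K (size K)) (hz0 : z ≠ 0)
    (hc : c ∈ chains F K (size K)) (h : ∀ t, s ⊆ t → boundary F V c t = 0) :
    ∃ a : F, ∀ t, s ⊆ t → c t = a * z t := by
  have hsz := hK.1.size_link hs
  rw [← hsz] at hc
  have hz' := hz
  rw [← hsz] at hz'
  have h1 := toLink_mem_cycles hs hc h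
  have h2 := toLink_mem_cycles hs hz'.1 fun t _ => by
    rw [show boundary F V z = 0 from hz.2]; rfl
  obtain ⟨t, hst, ht⟩ := hs.exists_isFacet
  have h3 : toLink s z ≠ 0 := fun h0 => by
    have := hK.fundamental_cycle_ne_zero hz hz0 ht
    rw [apply_eq_of_toLink (c := z) hst, h0] at this
    simp at this
  obtain ⟨a, ha⟩ := (hK.2 s hs).exists_eq_smul h2 h3 h1
  refine ⟨a, fun t hst => ?_⟩
  rw [apply_eq_of_toLink (c := c) hst, ha, apply_eq_of_toLink (c := z) hst, Pi.smul_apply, smul_eq_mul]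
  ring

end Star

/-! ### The complex of face rings of simplices -/

section Resolution

variable {F : Type v} [Field F] {V : Type u} [Fintype V] [LinearOrder V]
variable {K : PreAbstractSimplicialComplex V} {k : ℕ}

/-- Families of elements of the face rings of all simplices on subsets of `V`. -/
abbrev FaceFamily (F : Type v) [Field F] (V : Type u) : Type (max u v) :=
  (s : Finset V) → FaceRing F (simplex s)

/-- The family of residue classes of a family of polynomials. -/
def toFamily (P : Finset V → MvPolynomial V F) : FaceFamily F V :=
  fun s => Ideal.Quotient.mk (faceIdeal F (simplex s)) (P s)

theorem toFamily_apply_eq_zero {P : Finset V → MvPolynomial V F} {s : Finset V} :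
    toFamily P s = 0 ↔ ∀ a : V →₀ ℕ, a.support ⊆ s → coeff a (P s) = 0 := by
  rw [toFamily, Ideal.Quotient.eq_zero_iff_mem, mem_faceIdeal_iff_coeff]
  simp_rw [isFace_simplex]

theorem toFamily_eq_toFamily {P Q : Finset V → MvPolynomial V F} :
    toFamily P = toFamily Q ↔
      ∀ (s : Finset V) (a : V →₀ ℕ), a.support ⊆ s → coeff a (P s) = coeff a (Q s) := by
  rw [funext_iff]
  refine forall_congr' fun s => ?_
  rw [toFamily, toFamily, Ideal.Quotient.eq, mem_faceIdeal_iff_coeff]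
  simp_rw [isFace_simplex, coeff_sub, sub_eq_zero]

theorem faceIdeal_simplex_insert_le (s : Finset V) (v : V) :
    faceIdeal F (simplex (insert v s)) ≤ faceIdeal F (simplex s) :=
  faceIdeal_mono fun _ h => isFace_simplex.mpr
    ((isFace_simplex.mp h).trans (Finset.subset_insert v s))

/-- The signed sum of the restriction maps `F[s ∪ {v}] → F[s]`. -/
def restrictionMap (F : Type v) [Field F] (V : Type u) [Fintype V] [LinearOrder V] :
    FaceFamily F V →ₗ[MvPolynomial V F] FaceFamily F V :=
  LinearMap.pi fun s => ∑ v ∈ sᶜ, (C (vertexSign F s v) : MvPolynomial V F) •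
    ((Ideal.Quotient.factorₐ (MvPolynomial V F) (faceIdeal_simplex_insert_le s v)).toLinearMap ∘ₗ
      LinearMap.proj (insert v s))

theorem restrictionMap_toFamily (P : Finset V → MvPolynomial V F) :
    restrictionMap F V (toFamily P) =
      toFamily fun s => ∑ v ∈ sᶜ, C (vertexSign F s v) * P (insert v s) := by
  funext s
  rw [restrictionMap, LinearMap.pi_apply, LinearMap.sum_apply, toFamily, map_sum]
  refine Finset.sum_congr rfl fun v _ => ?_
  rfl

/-- Monomial by monomial, the restriction map is the simplicial boundary. In `F[s]` the monomial of
`a` counts only if `s` contains its support, which is why stars appear. -/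
theorem coeff_sum_vertexSign (P : Finset V → MvPolynomial V F) (a : V →₀ ℕ) (s : Finset V) :
    coeff a (∑ v ∈ sᶜ, C (vertexSign F s v) * P (insert v s)) =
      boundary F V (fun t => coeff a (P t)) s := by
  rw [boundary_apply, coeff_sum]
  simp_rw [coeff_C_mul]

theorem restrictionMap_toFamily_eq_zero {P : Finset V → MvPolynomial V F} :
    restrictionMap F V (toFamily P) = 0 ↔
      ∀ (s : Finset V) (a : V →₀ ℕ), a.support ⊆ s →
        boundary F V (fun t => coeff a (P t)) s = 0 := by
  rw [restrictionMap_toFamily, funext_iff]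
  refine forall_congr' fun s => ?_
  rw [Pi.zero_apply, toFamily_apply_eq_zero]
  simp_rw [coeff_sum_vertexSign]

theorem restrictionMap_restrictionMap (p : FaceFamily F V) :
    restrictionMap F V (restrictionMap F V p) = 0 := by
  obtain ⟨P, rfl⟩ : ∃ P, toFamily P = p := by
    choose P hP using fun s => Ideal.Quotient.mk_surjective (p s)
    exact ⟨P, funext hP⟩
  rw [restrictionMap_toFamily, restrictionMap_toFamily_eq_zero]
  intro s a _
  simp_rw [coeff_sum_vertexSign]
  rw [show (fun t => boundary F V (fun t => coeff a (P t)) t) =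
    boundary F V (fun t => coeff a (P t)) from rfl, boundary_boundary]
  rfl

/-- The sum of the face rings of the faces of `K` with `k` vertices. -/
def faceSum (F : Type v) [Field F] (K : PreAbstractSimplicialComplex V) (k : ℕ) :
    Submodule (MvPolynomial V F) (FaceFamily F V) where
  carrier := {p | ∀ s, ¬ (IsFace K s ∧ s.card = k) → p s = 0}
  add_mem' := by
    intro a b ha hb s hs
    rw [Pi.add_apply, ha s hs, hb s hs, add_zero]
  zero_mem' := fun _ _ => rfl
  smul_mem' := by
    intro r a ha s hs
    rw [Pi.smul_apply, ha s hs, smul_zero]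

theorem exists_toFamily_eq {p : FaceFamily F V} (hp : p ∈ faceSum F K k) :
    ∃ P : Finset V → MvPolynomial V F, toFamily P = p ∧
      ∀ a, (fun t => coeff a (P t)) ∈ chains F K k := by
  classical
  choose Q hQ using fun s => Ideal.Quotient.mk_surjective (p s)
  refine ⟨fun s => if IsFace K s ∧ s.card = k then Q s else 0, funext fun s => ?_, fun a s hs => ?_⟩
  · rw [toFamily]
    split_ifs with h
    · exact hQ s
    · rw [hp s h, map_zero]
  · simp only [if_neg hs, coeff_zero]

theorem restrictionMap_mem_faceSum {p : FaceFamily F V} (hp : p ∈ faceSum F K (k + 1)) :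
    restrictionMap F V p ∈ faceSum F K k := by
  obtain ⟨P, rfl, hP⟩ := exists_toFamily_eq hp
  intro s hs
  rw [restrictionMap_toFamily, toFamily_apply_eq_zero]
  intro a _
  rw [coeff_sum_vertexSign]
  exact boundary_mem_chains (hP a) s hs

/-- Solve for the coefficient of each monomial separately on the star of its support, then
reassemble. -/
theorem IsGorensteinStar.exists_restrictionMap_eq (hK : IsGorensteinStar F K) (hk : k ≠ size K)
    {p : FaceFamily F V} (hp : p ∈ faceSum F K k) (h : restrictionMap F V p = 0) :
    ∃ q ∈ faceSum F K (k + 1), restrictionMap F V q = p := by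
  classical
  obtain ⟨P, rfl, hP⟩ := exists_toFamily_eq hp
  rw [restrictionMap_toFamily_eq_zero] at h
  have hb : ∀ a : V →₀ ℕ, ∃ b ∈ chains F K (k + 1), ∀ t, a.support ⊆ t →
      boundary F V b t = coeff a (P t) := by
    intro a
    by_cases ha : IsFace K a.support
    · exact hK.exists_boundary_eq_star ha hk (hP a) fun t ht => h t a ht
    · refine ⟨0, Submodule.zero_mem _, fun t ht => ?_⟩
      rw [map_zero, Pi.zero_apply]
      by_contra h0
      exact ha ((mem_chains.mp (hP a) t (Ne.symm h0)).1.subset ht)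
  choose b hb hbP using hb
  -- Only the finitely many monomials occurring in `P` are used, so that the solutions add up to
  -- polynomials.
  let T : Finset (V →₀ ℕ) := Finset.univ.biUnion fun s => (P s).support
  have hT : ∀ a ∉ T, ∀ s, coeff a (P s) = 0 := fun a ha s => by
    simp only [T, Finset.mem_biUnion, Finset.mem_univ, true_and, not_exists] at ha
    exact notMem_support_iff.mp (ha s)
  let Q : Finset V → MvPolynomial V F := fun s => ∑ a ∈ T, monomial a (b a s)
  have hQ : ∀ a s, coeff a (Q s) = if a ∈ T then b a s else 0 := fun a s => by
    simp [Q, coeff_sum, coeff_monomial]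
  refine ⟨toFamily Q, fun s hs => ?_, ?_⟩
  · rw [toFamily_apply_eq_zero]
    intro a _
    rw [hQ, hb a s hs, ite_self]
  · rw [restrictionMap_toFamily, toFamily_eq_toFamily]
    intro s a ha
    rw [coeff_sum_vertexSign]
    simp_rw [hQ]
    by_cases haT : a ∈ T
    · simp_rw [if_pos haT]
      exact hbP a s ha
    · simp_rw [if_neg haT]
      rw [hT a haT, show (fun _ : Finset V => (0 : F)) = 0 from rfl, map_zero]; rfl

theorem isRegularUpTo_faceSum {θ : ℕ → MvPolynomial V F} (hθ : ∀ i, (θ i).IsHomogeneous 1)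
    (hs : ∀ s, IsFace K s → (coeffMatrix θ s).det ≠ 0) :
    IsRegularUpTo θ (faceSum F K k) k := by
  classical
  intro j hj p hp
  have h : ∀ s, IsFace K s ∧ s.card = k → p.1 s ∈ partialSpan θ (FaceRing F (simplex s)) j := by
    intro s hsk
    refine isRegularUpTo_simplex hθ (hs s hsk.1) j (hsk.2 ▸ hj) _ ?_
    exact map_mem_partialSpan ((LinearMap.proj s).comp (faceSum F K k).subtype) hp
  choose q hq using h
  refine ⟨fun i => ⟨fun s => if hs : IsFace K s ∧ s.card = k then q s hs i else 0,
    fun s hs => dif_neg hs⟩, Subtype.ext (funext fun s => ?_)⟩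
  rw [AddSubmonoidClass.coe_finsetSum, Finset.sum_apply]
  by_cases hsk : IsFace K s ∧ s.card = k
  · rw [hq s hsk]
    refine Finset.sum_congr rfl fun i _ => ?_
    simp [hsk]
  · rw [p.2 s hsk]
    symm
    refine Finset.sum_eq_zero fun i _ => ?_
    simp [hsk]

/-- The kernel of the restriction map on the sum of the face rings of the faces with `k` vertices. -/
def faceKer (F : Type v) [Field F] (K : PreAbstractSimplicialComplex V) (k : ℕ) :
    Submodule (MvPolynomial V F) (FaceFamily F V) :=
  faceSum F K k ⊓ LinearMap.ker (restrictionMap F V)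

theorem faceKer_le : faceKer F K k ≤ faceSum F K k := inf_le_left

theorem mem_faceKer {p : FaceFamily F V} :
    p ∈ faceKer F K k ↔ p ∈ faceSum F K k ∧ restrictionMap F V p = 0 := Iff.rfl

/-- The restriction map as a map onto the kernel of the next one. -/
def restrictionMapKer (F : Type v) [Field F] (K : PreAbstractSimplicialComplex V) (k : ℕ) :
    faceSum F K (k + 1) →ₗ[MvPolynomial V F] faceKer F K k :=
  ((restrictionMap F V).comp (faceSum F K (k + 1)).subtype).codRestrict _ fun p =>
    mem_faceKer.mpr ⟨restrictionMap_mem_faceSum p.2, restrictionMap_restrictionMap _⟩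

theorem restrictionMapKer_coe (p : faceSum F K (k + 1)) :
    (restrictionMapKer F K k p).1 = restrictionMap F V p.1 := rfl

theorem restrictionMapKer_eq_zero {p : faceSum F K (k + 1)} :
    restrictionMapKer F K k p = 0 ↔ restrictionMap F V p.1 = 0 := by
  rw [← restrictionMapKer_coe, Submodule.coe_eq_zero]

theorem IsGorensteinStar.restrictionMapKer_surjective (hK : IsGorensteinStar F K)
    (hk : k ≠ size K) : Function.Surjective (restrictionMapKer F K k) := by
  rintro ⟨p, hp⟩
  obtain ⟨q, hq, h⟩ := hK.exists_restrictionMap_eq hk (mem_faceKer.mp hp).1 (mem_faceKer.mp hp).2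
  exact ⟨⟨q, hq⟩, Subtype.ext h⟩

/-- The next kernel sits in `0 → faceKer (k + 1) → faceSum (k + 1) → faceKer k → 0`, whose middle
term is a sum of polynomial rings in `k + 1` variables; each step gains one unit of depth. -/
theorem IsGorensteinStar.isRegularUpTo_faceKer (hK : IsGorensteinStar F K)
    {θ : ℕ → MvPolynomial V F} (hθ : ∀ i, (θ i).IsHomogeneous 1)
    (hs : ∀ s, IsFace K s → (coeffMatrix θ s).det ≠ 0) (hk : k < size K) :
    IsRegularUpTo θ (faceKer F K k) k := by
  induction k with
  | zero => exact fun j hj => absurd hj (Nat.not_lt_zero j)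
  | succ k ih =>
    refine IsRegularUpTo.of_exact (M' := faceKer F K (k + 1)) (M := faceSum F K (k + 1))
      (M'' := faceKer F K k) (f := Submodule.inclusion faceKer_le)
      (g := restrictionMapKer F K k) (Submodule.inclusion_injective _)
      (hK.restrictionMapKer_surjective (by omega)) (fun p => ?_)
      (isRegularUpTo_faceSum hθ hs) (ih (by omega))
    rw [restrictionMapKer_eq_zero]
    constructor
    · exact fun h => ⟨⟨p.1, mem_faceKer.mpr ⟨p.2, h⟩⟩, rfl⟩
    · rintro ⟨q, rfl⟩
      exact (mem_faceKer.mp q.2).2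

open Classical in
/-- The map `F[K] → ∏ F[s]` whose `s`-component is `z s` times the restriction, for the faces `s`
of `K`. -/
def cycleFamilyMap (K : PreAbstractSimplicialComplex V) (z : Finset V → F) :
    FaceRing F K →ₗ[MvPolynomial V F] FaceFamily F V :=
  LinearMap.pi fun s => if hs : IsFace K s then (C (z s) : MvPolynomial V F) •
    (Ideal.Quotient.factorₐ (MvPolynomial V F) (faceIdeal_mono (F := F) fun _ ht =>
      hs.subset (isFace_simplex.mp ht) : faceIdeal F K ≤ faceIdeal F (simplex s))).toLinearMap
    else 0

theorem cycleFamilyMap_mk {z : Finset V → F} {n : ℕ} (hz : z ∈ chains F K n)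
    (p : MvPolynomial V F) :
    cycleFamilyMap K z (Ideal.Quotient.mk _ p) = toFamily fun s => C (z s) * p := by
  funext s
  rw [cycleFamilyMap, LinearMap.pi_apply, toFamily]
  split_ifs with hs
  · rfl
  · rw [hz s (fun h => hs h.1)]; simp

/-- `cycleFamilyMap` as a map into the sum of the face rings of the faces with `n` vertices. -/
def cycleMap {z : Finset V → F} {n : ℕ} (hz : z ∈ chains F K n) :
    FaceRing F K →ₗ[MvPolynomial V F] faceSum F K n :=
  (cycleFamilyMap K z).codRestrict _ fun x s hs => by
    obtain ⟨p, rfl⟩ := Ideal.Quotient.mk_surjective x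
    rw [cycleFamilyMap_mk hz, toFamily, hz s hs]; simp

theorem cycleMap_mk {z : Finset V → F} {n : ℕ} (hz : z ∈ chains F K n) (p : MvPolynomial V F) :
    (cycleMap hz (Ideal.Quotient.mk _ p)).1 = toFamily fun s => C (z s) * p :=
  cycleFamilyMap_mk hz p

/-- `F[K]` is the kernel at the top of the complex, embedded by multiplication with the fundamental
cycle; one more use of the depth lemma gives the full length. -/
theorem IsGorensteinStar.isRegularUpTo_faceRing (hK : IsGorensteinStar F K)
    {θ : ℕ → MvPolynomial V F} (hθ : ∀ i, (θ i).IsHomogeneous 1)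
    (hs : ∀ s, IsFace K s → (coeffMatrix θ s).det ≠ 0) :
    IsRegularUpTo θ (FaceRing F K) (size K) := by
  classical
  obtain ⟨z, hz, hz0, -⟩ := hK.hasSphereHomology.exists_fundamental_cycle
  rcases hn : size K with _ | n
  · exact fun j hj => absurd hj (Nat.not_lt_zero j)
  have hzc := hz.1
  rw [hn] at hzc
  refine IsRegularUpTo.of_exact (M' := FaceRing F K) (M := faceSum F K (n + 1))
    (M'' := faceKer F K n) (f := cycleMap hzc) (g := restrictionMapKer F K n) ?_
    (hK.restrictionMapKer_surjective (by omega)) (fun p => ?_)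
    (isRegularUpTo_faceSum hθ hs) (hK.isRegularUpTo_faceKer hθ hs (by omega))
  · refine (injective_iff_map_eq_zero (cycleMap hzc)).mpr fun x hx => ?_
    obtain ⟨p, rfl⟩ := Ideal.Quotient.mk_surjective x
    have h : (cycleMap hzc (Ideal.Quotient.mk _ p)).1 = 0 := congrArg Subtype.val hx
    rw [cycleMap_mk] at h
    rw [Ideal.Quotient.eq_zero_iff_mem, mem_faceIdeal_iff_coeff]
    intro a ha
    obtain ⟨t, hat, ht⟩ := ha.exists_isFacet
    have h1 := toFamily_apply_eq_zero.mp (congrFun h t) a hat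
    rw [coeff_C_mul] at h1
    exact (mul_eq_zero.mp h1).resolve_left (hK.fundamental_cycle_ne_zero hz hz0 ht)
  rw [restrictionMapKer_eq_zero]
  constructor
  · intro h
    obtain ⟨P, hPp, hP⟩ := exists_toFamily_eq p.2
    have h0 : restrictionMap F V (toFamily P) = 0 := by rw [hPp]; exact h
    rw [restrictionMap_toFamily_eq_zero] at h0
    -- On the star of the support of `a` a top cycle is a multiple of `z`; the multiples are the
    -- coefficients of the preimage.
    have hb : ∀ a : V →₀ ℕ, ∃ r : F, ∀ t, a.support ⊆ t → coeff a (P t) = r * z t := by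
      intro a
      by_cases ha : IsFace K a.support
      · exact hK.exists_eq_mul_star ha hz hz0 (hn ▸ hP a) fun t ht => h0 t a ht
      · refine ⟨0, fun t ht => ?_⟩
        rw [zero_mul]
        by_contra hne
        exact ha ((mem_chains.mp (hP a) t hne).1.subset ht)
    choose r hr using hb
    let T : Finset (V →₀ ℕ) := Finset.univ.biUnion fun s => (P s).support
    have hT : ∀ a ∉ T, ∀ s, coeff a (P s) = 0 := fun a ha s => by
      simp only [T, Finset.mem_biUnion, Finset.mem_univ, true_and, not_exists] at ha
      exact notMem_support_iff.mp (ha s)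
    refine ⟨Ideal.Quotient.mk _ (∑ a ∈ T, monomial a (r a)), Subtype.ext ?_⟩
    rw [cycleMap_mk, ← hPp, toFamily_eq_toFamily]
    intro s a ha
    rw [coeff_C_mul]
    by_cases haT : a ∈ T
    · rw [hr a s ha, mul_comm]
      simp [coeff_sum, coeff_monomial, haT]
    · rw [hT a haT]
      simp [coeff_sum, coeff_monomial, haT]
  · rintro ⟨x, rfl⟩
    obtain ⟨p, rfl⟩ := Ideal.Quotient.mk_surjective x
    rw [cycleMap_mk, restrictionMap_toFamily_eq_zero]
    intro s a _
    have h1 : (fun t => coeff a (C (z t) * p)) = coeff a p • z := funext fun t => by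
      rw [coeff_C_mul, mul_comm]; rfl
    rw [h1, map_smul, show boundary F V z = 0 from hz.2, smul_zero]; rfl

end Resolution

/-! ### Quasi-regularity -/

section QuasiRegular

variable {F : Type v} [Field F] {A : Type u} [CommRing A] [Algebra F A] {M : Type*}
  [AddCommGroup M] [Module A M] {θ : ℕ → A} {d : ℕ} {κ : Type w}

theorem aeval_smul_mem_partialSpan {j : ℕ} {P : MvPolynomial (Fin d) F}
    (hP : P ∈ Ideal.span (X '' {i : Fin d | i.1 < j} : Set (MvPolynomial (Fin d) F))) (m : M) :
    aeval (fun i : Fin d => θ i) P • m ∈ partialSpan θ M j := by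
  induction hP using Submodule.span_induction with
  | mem x hx =>
    obtain ⟨i, hi, rfl⟩ := hx
    rw [aeval_X]
    exact smul_mem_partialSpan hi m
  | zero => rw [map_zero, zero_smul]; exact Submodule.zero_mem _
  | add x y _ _ hx hy => rw [map_add, add_smul]; exact Submodule.add_mem _ hx hy
  | smul r x _ hx =>
    rw [smul_eq_mul, map_mul, mul_smul]; exact Submodule.smul_mem _ _ hx

theorem sub_C_coeff_zero_mem_span_X (P : MvPolynomial (Fin d) F) :
    P - C (coeff 0 P) ∈ Ideal.span (X '' {i : Fin d | i.1 < d} : Set (MvPolynomial (Fin d) F)) := by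
  classical
  rw [mem_ideal_span_X_image]
  intro a ha
  by_contra! h
  have h0 : a = 0 := Finsupp.ext fun i => h i i.2
  subst h0
  rw [mem_support_iff] at ha
  exact ha (by simp)

theorem mem_span_X_of_forall_pow {S : Set (Fin d)} {i : Fin d} {P : MvPolynomial (Fin d) F}
    (h : ∀ n, ∃ s ∈ Ideal.span (X '' S : Set (MvPolynomial (Fin d) F)), ∃ r, P = s + X i ^ n * r) :
    P ∈ Ideal.span (X '' S : Set (MvPolynomial (Fin d) F)) := by
  classical
  rw [mem_ideal_span_X_image]
  intro a ha
  by_contra! h0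
  obtain ⟨s, hs, r, hP⟩ := h (a i + 1)
  rw [mem_support_iff] at ha
  apply ha
  have h1 : coeff a s = 0 := by
    by_contra h1
    obtain ⟨l, hl, hal⟩ := (mem_ideal_span_X_image.mp hs) a (mem_support_iff.mpr h1)
    exact hal (h0 l hl)
  rw [hP, coeff_add, h1, zero_add, X_pow_eq_monomial, coeff_monomial_mul', if_neg]
  rw [Finsupp.single_le_iff]
  omega

/-- Descending induction on `j`. At `j = d` the independence hypothesis kills the constant terms;
the case `j = 0` says that a relation with coefficients polynomial in `θ` is trivial. -/
theorem mem_span_X_of_sum_mem_partialSpan (hθ : IsRegularUpTo θ M d) {m : κ → M} {s : Finset κ}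
    (hm : ∀ c : κ → F, ∑ k ∈ s, algebraMap F A (c k) • m k ∈ partialSpan θ M d → ∀ k ∈ s, c k = 0)
    {j : ℕ} (hj : j ≤ d) {P : κ → MvPolynomial (Fin d) F}
    (hP : ∑ k ∈ s, aeval (fun i : Fin d => θ i) (P k) • m k ∈ partialSpan θ M j) :
    ∀ k ∈ s, P k ∈ Ideal.span (X '' {i : Fin d | i.1 < j} : Set (MvPolynomial (Fin d) F)) := by
  induction hn : d - j generalizing j P with
  | zero =>
    obtain rfl : j = d := by omega
    have h1 : ∑ k ∈ s, algebraMap F A (coeff 0 (P k)) • m k ∈ partialSpan θ M j := by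
      have h2 : ∑ k ∈ s, aeval (fun i : Fin j => θ i) (P k - C (coeff 0 (P k))) • m k ∈
          partialSpan θ M j :=
        sum_mem fun k _ => aeval_smul_mem_partialSpan (sub_C_coeff_zero_mem_span_X _) _
      have h3 := sub_mem hP h2
      rw [← Finset.sum_sub_distrib] at h3
      convert h3 using 2 with k
      rw [← sub_smul, ← map_sub, sub_sub_cancel, aeval_C]
    intro k hk
    have h4 := sub_C_coeff_zero_mem_span_X (P k)
    rwa [hm _ h1 k hk, map_zero, sub_zero] at h4
  | succ n ih =>
    have hjd : j < d := by omega
    have hset : (X '' {i : Fin d | i.1 < j + 1} : Set (MvPolynomial (Fin d) F)) =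
        insert (X ⟨j, hjd⟩) (X '' {i : Fin d | i.1 < j}) := by
      rw [← Set.image_insert_eq]
      congr 1
      ext i
      rw [Set.mem_insert_iff, Set.mem_ofPred_eq, Set.mem_ofPred_eq, Fin.ext_iff]
      simp only
      omega
    -- Modulo the earlier variables `P = X_j q`, and regularity of `θ j` turns the relation for `P`
    -- into one for `q`. Iterating yields every power of `X_j`.
    have key : ∀ n : ℕ, ∀ P : κ → MvPolynomial (Fin d) F,
        ∑ k ∈ s, aeval (fun i : Fin d => θ i) (P k) • m k ∈ partialSpan θ M j → ∀ k ∈ s,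
        ∃ t ∈ Ideal.span (X '' {i : Fin d | i.1 < j} : Set (MvPolynomial (Fin d) F)),
          ∃ r, P k = t + X ⟨j, hjd⟩ ^ n * r := by
      intro n
      induction n with
      | zero => exact fun P _ k _ => ⟨0, Ideal.zero_mem _, P k, by simp⟩
      | succ n ihn =>
        intro P hP
        have h1 := ih (j := j + 1) hjd (partialSpan_mono (Nat.le_succ j) hP) (by omega)
        have h2 : ∀ k ∈ s, ∃ t ∈ Ideal.span (X '' {i : Fin d | i.1 < j} :
            Set (MvPolynomial (Fin d) F)), ∃ q, P k = t + X ⟨j, hjd⟩ * q := by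
          intro k hk
          have h3 := h1 k hk
          rw [hset, Ideal.mem_span_insert] at h3
          obtain ⟨q, t, ht, h⟩ := h3
          exact ⟨t, ht, q, by rw [h]; ring⟩
        choose! t ht q hq using h2
        have h4 : θ j • ∑ k ∈ s, aeval (fun i : Fin d => θ i) (q k) • m k ∈
            partialSpan θ M j := by
          have h5 : ∑ k ∈ s, aeval (fun i : Fin d => θ i) (t k) • m k ∈ partialSpan θ M j :=
            sum_mem fun k hk => aeval_smul_mem_partialSpan (ht k hk) _
          have h6 := sub_mem hP h5
          rw [← Finset.sum_sub_distrib] at h6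
          rw [Finset.smul_sum]
          convert h6 using 1
          refine Finset.sum_congr rfl fun k hk => ?_
          rw [hq k hk, map_add, map_mul, aeval_X, add_smul, mul_smul, add_sub_cancel_left]
        intro k hk
        obtain ⟨t', ht', r, hr⟩ := ihn q (hθ j hjd _ h4) k hk
        refine ⟨t k + X ⟨j, hjd⟩ * t', Ideal.add_mem _ (ht k hk) (Ideal.mul_mem_left _ _ ht'), r, ?_⟩
        rw [hq k hk, hr]
        ring
    exact fun k hk => mem_span_X_of_forall_pow fun n => key n P hP k hk

theorem eq_zero_of_sum_aeval_smul_eq_zero (hθ : IsRegularUpTo θ M d) {m : κ → M} {s : Finset κ}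
    (hm : ∀ c : κ → F, ∑ k ∈ s, algebraMap F A (c k) • m k ∈ partialSpan θ M d → ∀ k ∈ s, c k = 0)
    {P : κ → MvPolynomial (Fin d) F}
    (hP : ∑ k ∈ s, aeval (fun i : Fin d => θ i) (P k) • m k = 0) : ∀ k ∈ s, P k = 0 := by
  intro k hk
  have := mem_span_X_of_sum_mem_partialSpan hθ hm (Nat.zero_le d)
    (by rw [hP]; exact Submodule.zero_mem _) k hk
  simpa using this

end QuasiRegular

/-! ### Regular sequences give freeness -/

section Free

variable {F : Type v} [Field F] {V : Type u} [Fintype V] [LinearOrder V]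
variable {K : PreAbstractSimplicialComplex V} {d : ℕ}

theorem mk_mem_partialSpan_iff {θ : ℕ → MvPolynomial V F} {j : ℕ} {p : MvPolynomial V F} :
    Ideal.Quotient.mk (faceIdeal F K) p ∈ partialSpan θ (FaceRing F K) j ↔
      p ∈ thetaIdeal K (fun i : Fin j => θ i) := by
  rw [mem_partialSpan_faceRing, mem_thetaIdeal]
  refine exists_congr fun i => and_congr_right fun _ => ?_
  constructor
  · rintro ⟨q, rfl⟩
    exact ⟨fun l => q l, by rw [Finset.sum_range]⟩
  · rintro ⟨q, rfl⟩
    refine ⟨fun l => if h : l < j then q ⟨l, h⟩ else 0, ?_⟩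
    rw [Finset.sum_range]
    simp

/-- Lifts of a basis of `H(K, Θ)` generate by graded Nakayama and are independent by
quasi-regularity. -/
theorem free_faceRing_of_isRegularUpTo {θ : ℕ → MvPolynomial V F}
    (hlin : ∀ i, (θ i).IsHomogeneous 1) (hθ : IsRegularUpTo θ (FaceRing F K) d) :
    Module.Free (thetaSubalgebra K fun i : Fin d => θ i) (FaceRing F K) := by
  set Θ : Fin d → MvPolynomial V F := fun i => θ i with hΘ
  have hΘlin : ∀ j, (Θ j).IsHomogeneous 1 := fun j => hlin j
  let mkI := Ideal.Quotient.mk (faceIdeal F K)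
  let mkJ := Ideal.Quotient.mk (thetaIdeal K Θ)
  -- The basis is chosen among monomials, so the span of its lifts is stable under homogeneous
  -- components.
  obtain ⟨κ, e, -, hspan, hind⟩ :=
    exists_linearIndependent' F (fun a : V →₀ ℕ => mkJ (monomial a (1 : F)))
  let m : κ → MvPolynomial V F := fun k => monomial (e k) 1
  have hall : ∀ p : MvPolynomial V F, ∃ q ∈ Submodule.span F (Set.range m), p - q ∈ thetaIdeal K Θ := by
    intro p
    have h1 : mkJ p ∈ Submodule.span F (Set.range fun k => mkJ (m k)) := by
      change mkJ p ∈ Submodule.span F (Set.range ((fun a => mkJ (monomial a (1 : F))) ∘ e))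
      rw [hspan, ← support_sum_monomial_coeff p, map_sum]
      refine Submodule.sum_mem _ fun a _ => ?_
      have h1 : monomial a (coeff a p) = coeff a p • monomial a (1 : F) := by
        rw [smul_monomial, smul_eq_mul, mul_one]
      rw [h1]
      have h2 : mkJ (monomial a (1 : F)) ∈ Submodule.span F (Set.range fun a : V →₀ ℕ =>
          mkJ (monomial a (1 : F))) := Submodule.subset_span ⟨a, rfl⟩
      exact Submodule.smul_mem _ (coeff a p) h2
    have h2 : Set.range (fun k => mkJ (m k)) =
        (Ideal.Quotient.mkₐ F (thetaIdeal K Θ)).toLinearMap '' Set.range m := by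
      rw [← Set.range_comp]; rfl
    rw [h2, ← Submodule.map_span] at h1
    obtain ⟨q, hq, hqp⟩ := h1
    exact ⟨q, hq, Ideal.Quotient.eq.mp hqp.symm⟩
  have hcomp : ∀ q ∈ Submodule.span F (Set.range m), ∀ n,
      homogeneousComponent n q ∈ Submodule.span F (Set.range m) := by
    intro q hq n
    induction hq using Submodule.span_induction with
    | mem x hx =>
      obtain ⟨k, rfl⟩ := hx
      rw [homogeneousComponent_of_mem (isHomogeneous_monomial (1 : F) rfl)]
      split_ifs
      · exact Submodule.subset_span ⟨k, rfl⟩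
      · exact Submodule.zero_mem _
    | zero => rw [map_zero]; exact Submodule.zero_mem _
    | add x y _ _ hx hy => rw [map_add]; exact Submodule.add_mem _ hx hy
    | smul r x _ hx => rw [map_smul]; exact Submodule.smul_mem _ _ hx
  let N : Submodule (thetaSubalgebra K Θ) (FaceRing F K) :=
    Submodule.span (thetaSubalgebra K Θ) (Set.range fun k => mkI (m k))
  have hN : ∀ q ∈ Submodule.span F (Set.range m), mkI q ∈ N := by
    intro q hq
    induction hq using Submodule.span_induction with
    | mem x hx =>
      obtain ⟨k, rfl⟩ := hx
      exact Submodule.subset_span ⟨k, rfl⟩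
    | zero => rw [map_zero]; exact Submodule.zero_mem _
    | add x y _ _ hx hy => rw [map_add]; exact Submodule.add_mem _ hx hy
    | smul r x _ hx =>
      have : mkI (r • x) = algebraMap F (thetaSubalgebra K Θ) r • mkI x := by
        rw [smul_eq_C_mul, map_mul]; rfl
      rw [this]
      exact Submodule.smul_mem _ _ hx
  -- Modulo the lifts, a form of degree `n + 1` is a combination of the `Θ j` with cofactors of
  -- degree `n`.
  have hgen : ∀ n, ∀ p : MvPolynomial V F, p.IsHomogeneous n → mkI p ∈ N := by
    intro n
    induction n with
    | zero =>
      intro p hp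
      obtain ⟨q, hq, hpq⟩ := hall p
      have h1 := homogeneousComponent_mem_thetaIdeal hΘlin hpq 0
      have h2 := coeff_zero_of_mem_thetaIdeal hΘlin hpq
      have h3 : p - homogeneousComponent 0 q = 0 := by
        have h4 := homogeneousComponent_of_mem (n := 0) (m := 0) hp
        rw [if_pos rfl] at h4
        rw [← h4, ← map_sub, homogeneousComponent_zero, h2, map_zero]
      rw [sub_eq_zero.mp h3]
      exact hN _ (hcomp q hq 0)
    | succ n ih =>
      intro p hp
      obtain ⟨q, hq, hpq⟩ := hall p
      have h1 := homogeneousComponent_mem_thetaIdeal hΘlin hpq (n + 1)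
      obtain ⟨i, hi, -, r, hr, h⟩ := exists_of_mem_thetaIdeal_of_isHomogeneous hΘlin h1
        (homogeneousComponent_isHomogeneous _ _)
      rw [map_sub, homogeneousComponent_of_mem hp, if_pos rfl, sub_eq_iff_eq_add] at h
      rw [h, map_add, map_add, map_sum, show mkI i = 0 from Ideal.Quotient.eq_zero_iff_mem.mpr hi,
        zero_add]
      refine Submodule.add_mem _ (Submodule.sum_mem _ fun j _ => ?_) (hN _ (hcomp q hq _))
      have : mkI (Θ j * r j) = (⟨mkI (Θ j), Algebra.subset_adjoin ⟨j, rfl⟩⟩ :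
          thetaSubalgebra K Θ) • mkI (r j) := map_mul _ _ _
      rw [this]
      exact Submodule.smul_mem _ _ (ih _ (hr j))
  refine Module.Free.of_basis (Module.Basis.mk (v := fun k => mkI (m k)) ?_ ?_ : Module.Basis κ _ _)
  · rw [linearIndependent_iff']
    intro s g hg
    have hex : ∀ k, ∃ P : MvPolynomial (Fin d) F,
        aeval (fun j => mkI (Θ j)) P = (g k : FaceRing F K) := fun k => by
      have h := (g k).2
      exact (Algebra.adjoin_range_eq_range_aeval F (fun j => mkI (Θ j))).le h
    choose P hP using hex
    have hsm : ∀ Q : MvPolynomial (Fin d) F, ∀ x : FaceRing F K,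
        aeval (fun i : Fin d => θ i) Q • x = aeval (fun j => mkI (Θ j)) Q * x := by
      intro Q x
      obtain ⟨y, rfl⟩ := Ideal.Quotient.mk_surjective x
      have h : aeval (fun j => mkI (Θ j)) Q = mkI (aeval (fun i : Fin d => θ i) Q) := by
        have := (comp_aeval_apply (R := F) (fun i : Fin d => θ i) (Ideal.Quotient.mkₐ F (faceIdeal F K)) Q)
        exact this.symm
      rw [h, ← map_mul]
      rfl
    have h0 := eq_zero_of_sum_aeval_smul_eq_zero (F := F) (m := fun k => mkI (m k)) (s := s)
      (P := P) hθ ?_ ?_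
    · intro k hk
      refine Subtype.ext ?_
      rw [← hP, h0 k hk, map_zero]; rfl
    · intro c hc
      have h1 : ∑ k ∈ s, algebraMap F (MvPolynomial V F) (c k) • mkI (m k) =
          mkI (∑ k ∈ s, c k • m k) := by
        rw [map_sum]
        refine Finset.sum_congr rfl fun k _ => ?_
        rw [smul_eq_C_mul]; rfl
      rw [h1, mk_mem_partialSpan_iff] at hc
      refine linearIndependent_iff'.mp hind s c ?_
      rw [← Ideal.Quotient.eq_zero_iff_mem, map_sum] at hc
      exact hc
    · rw [← hg]
      refine Finset.sum_congr rfl fun k _ => ?_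
      rw [hsm, hP]; rfl
  · rintro x -
    obtain ⟨p, rfl⟩ := Ideal.Quotient.mk_surjective x
    rw [← sum_homogeneousComponent p, map_sum]
    exact Submodule.sum_mem _ fun n _ => hgen n _ (homogeneousComponent_isHomogeneous _ _)

end Free

/-! ### Graded dimensions of `H(K, Θ)` -/

section Dimension

variable {F : Type v} [Field F] {V : Type u} [Fintype V] [LinearOrder V]
variable {K : PreAbstractSimplicialComplex V} {d : ℕ}

/-- The forms of degree `n` in an ideal. -/
def degreePart (J : Ideal (MvPolynomial V F)) (n : ℕ) : Submodule F (MvPolynomial V F) :=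
  homogeneousSubmodule V F n ⊓ J.restrictScalars F

theorem mem_degreePart {J : Ideal (MvPolynomial V F)} {n : ℕ} {p : MvPolynomial V F} :
    p ∈ degreePart J n ↔ p.IsHomogeneous n ∧ p ∈ J := Iff.rfl

instance finiteDimensional_homogeneousSubmodule (n : ℕ) :
    FiniteDimensional F (homogeneousSubmodule V F n) :=
  Module.Finite.iff_fg.mpr (homogeneousSubmodule_fg V F n)

instance finiteDimensional_degreePart (J : Ideal (MvPolynomial V F)) (n : ℕ) :
    FiniteDimensional F (degreePart J n) :=
  Submodule.finiteDimensional_inf_left _ _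

theorem degreePart_zero {Θ : Fin d → MvPolynomial V F} (hΘ : ∀ j, (Θ j).IsHomogeneous 1) :
    degreePart (thetaIdeal K Θ) 0 = ⊥ := by
  rw [eq_bot_iff]
  rintro p ⟨hp, hpJ⟩
  have h1 := coeff_zero_of_mem_thetaIdeal hΘ hpJ
  have h2 := homogeneousComponent_of_mem (n := 0) (m := 0) hp
  rw [homogeneousComponent_zero, h1, map_zero, if_pos rfl] at h2
  exact h2.symm

/-- In degree `n + 1` the larger ideal is the sum of the smaller one and `θ j` times all forms of
degree `n`. By regularity these meet in `θ j` times the smaller ideal in degree `n`, and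
multiplication by `θ j` is injective. -/
theorem finrank_degreePart_succ {θ : ℕ → MvPolynomial V F} (hlin : ∀ i, (θ i).IsHomogeneous 1)
    (hθ : IsRegularUpTo θ (FaceRing F K) d) {j : ℕ} (hj : j < d) (n : ℕ) :
    Module.finrank F (degreePart (thetaIdeal K fun i : Fin (j + 1) => θ i) (n + 1)) +
        Module.finrank F (degreePart (thetaIdeal K fun i : Fin j => θ i) n) =
      Module.finrank F (degreePart (thetaIdeal K fun i : Fin j => θ i) (n + 1)) +
        Module.finrank F (homogeneousSubmodule V F n) := by
  have hreg : ∀ p, θ j * p ∈ thetaIdeal K (fun i : Fin j => θ i) →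
      p ∈ thetaIdeal K (fun i : Fin j => θ i) := fun p hp =>
    mk_mem_partialSpan_iff.mp (hθ j hj _ (mk_mem_partialSpan_iff.mpr hp))
  have hne : θ j ≠ 0 := by
    intro h0
    have h1 := hreg 1 (by rw [h0, zero_mul]; exact Ideal.zero_mem _)
    have h2 := coeff_zero_of_mem_thetaIdeal (fun i : Fin j => hlin i) h1
    simp at h2
  let f : MvPolynomial V F →ₗ[F] MvPolynomial V F := LinearMap.mulLeft F (θ j)
  have hf : Function.Injective f := mul_right_injective₀ hne
  have hle : thetaIdeal K (fun i : Fin j => θ i) ≤ thetaIdeal K (fun i : Fin (j + 1) => θ i) := by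
    refine sup_le_sup_left (Ideal.span_mono ?_) _
    rintro _ ⟨i, rfl⟩
    exact ⟨i.castSucc, rfl⟩
  have hsup : degreePart (thetaIdeal K fun i : Fin (j + 1) => θ i) (n + 1) =
      degreePart (thetaIdeal K fun i : Fin j => θ i) (n + 1) ⊔
        (homogeneousSubmodule V F n).map f := by
    refine le_antisymm ?_ (sup_le ?_ ?_)
    · rintro p ⟨hp, hpJ⟩
      obtain ⟨i, hi, hin, q, hq, rfl⟩ :=
        exists_of_mem_thetaIdeal_of_isHomogeneous (fun i : Fin (j + 1) => hlin i) hpJ hp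
      rw [Fin.sum_univ_castSucc, ← add_assoc]
      refine Submodule.add_mem_sup (mem_degreePart.mpr ⟨hin.add (IsHomogeneous.sum _ _ _
        fun l _ => ?_), Ideal.add_mem _ (faceIdeal_le_thetaIdeal hi) (Ideal.sum_mem _ fun l _ => ?_)⟩)
        ⟨q (Fin.last j), hq _, rfl⟩
      · rw [add_comm n 1]; exact (hlin _).mul (hq _)
      · exact Ideal.mul_mem_right _ _ (theta_mem_thetaIdeal (Θ := fun i : Fin j => θ i) l)
    · exact fun p hp => ⟨hp.1, hle hp.2⟩
    · rintro _ ⟨q, hq, rfl⟩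
      refine ⟨?_, Ideal.mul_mem_right _ _
        (theta_mem_thetaIdeal (Θ := fun i : Fin (j + 1) => θ i) (Fin.last j))⟩
      have := (hlin j).mul hq
      rwa [add_comm] at this
  have hinf : degreePart (thetaIdeal K fun i : Fin j => θ i) (n + 1) ⊓
      (homogeneousSubmodule V F n).map f =
        (degreePart (thetaIdeal K fun i : Fin j => θ i) n).map f := by
    refine le_antisymm ?_ ?_
    · rintro _ ⟨hp, q, hq, rfl⟩
      exact ⟨q, ⟨hq, hreg q hp.2⟩, rfl⟩
    · rintro _ ⟨q, ⟨hq, hqJ⟩, rfl⟩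
      refine ⟨⟨?_, Ideal.mul_mem_left _ _ hqJ⟩, q, hq, rfl⟩
      have := (hlin j).mul hq
      rwa [add_comm] at this
  have h := Submodule.finrank_sup_add_finrank_inf_eq
    (degreePart (thetaIdeal K fun i : Fin j => θ i) (n + 1)) ((homogeneousSubmodule V F n).map f)
  rw [← hsup, hinf] at h
  rw [← (Submodule.equivMapOfInjective f hf (homogeneousSubmodule V F n)).finrank_eq,
    ← (Submodule.equivMapOfInjective f hf (degreePart (thetaIdeal K fun i : Fin j => θ i)
      n)).finrank_eq] at h
  exact h

/-- The dimension of the graded pieces of `H(K, Θ)` does not depend on the regular sequence `Θ`. -/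
theorem finrank_degreePart_eq {θ η : ℕ → MvPolynomial V F} (hθlin : ∀ i, (θ i).IsHomogeneous 1)
    (hηlin : ∀ i, (η i).IsHomogeneous 1) (hθ : IsRegularUpTo θ (FaceRing F K) d)
    (hη : IsRegularUpTo η (FaceRing F K) d) {j : ℕ} (hj : j ≤ d) (n : ℕ) :
    Module.finrank F (degreePart (thetaIdeal K fun i : Fin j => θ i) n) =
      Module.finrank F (degreePart (thetaIdeal K fun i : Fin j => η i) n) := by
  induction j generalizing n with
  | zero =>
    rw [show (fun i : Fin 0 => θ i) = fun i : Fin 0 => η i from funext fun i => i.elim0]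
  | succ j ih =>
    rcases n with _ | n
    · rw [degreePart_zero fun i => hθlin _, degreePart_zero fun i => hηlin _]
    · have h1 := finrank_degreePart_succ hθlin hθ hj n
      have h2 := finrank_degreePart_succ hηlin hη hj n
      rw [ih (by omega), ih (by omega)] at h1
      omega

end Dimension

/-! ### Conditions generic along lines -/

section Generic

open Filter

variable {F : Type v} [Field F] {n : Type w} [Fintype n] [DecidableEq n]

theorem eventually_cofinite_det_ne_zero (P : Matrix n n (Polynomial F)) {t₀ : F}
    (h : (P.map (Polynomial.eval t₀)).det ≠ 0) :
    ∀ᶠ t in (cofinite : Filter F), (P.map (Polynomial.eval t)).det ≠ 0 := by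
  classical
  have hdet : ∀ t, (P.map (Polynomial.eval t)).det = P.det.eval t := fun t =>
    ((Polynomial.evalRingHom t).map_det P).symm
  have hP : P.det ≠ 0 := by
    intro h0
    rw [hdet, h0, Polynomial.eval_zero] at h
    exact h rfl
  simp_rw [hdet]
  refine (P.det.roots.toFinset.finite_toSet).subset fun t ht => ?_
  simpa [hP] using ht

theorem eventually_cofinite_det_ne_zero_of_linear {E : Type*} [AddCommGroup E] [Module F E]
    (T : E →ₗ[F] Matrix n n F) {x : E} (y : E) (h : (T x).det ≠ 0) :
    ∀ᶠ t in (cofinite : Filter F), (T (x + t • (y - x))).det ≠ 0 := by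
  let P : Matrix n n (Polynomial F) := Matrix.of fun i j =>
    Polynomial.C (T x i j) + Polynomial.X * Polynomial.C (T (y - x) i j)
  have hP : ∀ t, P.map (Polynomial.eval t) = T (x + t • (y - x)) := fun t => by
    ext i j
    simp [P]
  have := eventually_cofinite_det_ne_zero P (t₀ := 0) (by rw [hP]; simpa using h)
  simpa only [hP] using this

/-- If finitely many conditions on the points of a vector space hold at almost all points of every
line through a point at which they hold, then they hold at a common point. -/
theorem exists_forall_of_line [Infinite F] {E : Type*} [AddCommGroup E] [Module F E]
    (W : Submodule F E) {ι : Type*} (S : Finset ι) {P : ι → E → Prop}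
    (hopen : ∀ i, ∀ x y, P i x → ∀ᶠ t in (cofinite : Filter F), P i (x + t • (y - x)))
    (hne : ∀ i ∈ S, ∃ x ∈ W, P i x) : ∃ x ∈ W, ∀ i ∈ S, P i x := by
  classical
  induction S using Finset.induction_on with
  | empty => exact ⟨0, W.zero_mem, by simp⟩
  | insert a S _ ih =>
    obtain ⟨x, hx, hxP⟩ := ih fun i hi => hne i (Finset.mem_insert_of_mem hi)
    obtain ⟨y, hy, hyP⟩ := hne a (Finset.mem_insert_self a S)
    have h1 : ∀ᶠ t in (cofinite : Filter F), ∀ i ∈ S, P i (x + t • (y - x)) :=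
      (S.eventually_all).mpr fun i hi => hopen i x y (hxP i hi)
    have h2 : ∀ᶠ t in (cofinite : Filter F), P a (x + t • (y - x)) := by
      -- The condition at `y` is generic on the line read from `y` to `x`; reversing the parameter
      -- brings it to the same line.
      have h3 : Tendsto (fun t : F => 1 - t) cofinite cofinite :=
        Function.Injective.tendsto_cofinite fun s t h => by simpa using h
      filter_upwards [h3.eventually (hopen a y x hyP)] with t ht
      convert ht using 1
      module
    obtain ⟨t, ht1, ht2⟩ := (h1.and h2).exists
    refine ⟨x + t • (y - x), W.add_mem hx (W.smul_mem t (W.sub_mem hy hx)), fun i hi => ?_⟩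
    rcases Finset.mem_insert.mp hi with rfl | hi
    · exact ht2
    · exact ht1 i hi

end Generic

/-! ### Generic linear forms -/

section GenericForms

open Filter

variable {F : Type v} [Field F] {V : Type u} [Fintype V] [LinearOrder V]
variable {K L : PreAbstractSimplicialComplex V} {d : ℕ} {Θ : Fin d → MvPolynomial V F}

/-- A finite sequence of forms, extended by zero. -/
def extendForms (Θ : Fin d → MvPolynomial V F) : ℕ → MvPolynomial V F :=
  fun i => if h : i < d then Θ ⟨i, h⟩ else 0

theorem extendForms_coe (Θ : Fin d → MvPolynomial V F) :
    (fun i : Fin d => extendForms Θ i) = Θ := by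
  funext i
  simp [extendForms]

theorem isHomogeneous_extendForms (hΘ : ∀ j, (Θ j).IsHomogeneous 1) (i : ℕ) :
    (extendForms Θ i).IsHomogeneous 1 := by
  rw [extendForms]
  split_ifs
  · exact hΘ _
  · exact isHomogeneous_zero _ _ _

/-- `coeffMatrix` of a finite sequence of forms, as a linear map. -/
def coeffMatrixₗ (F : Type v) [Field F] (d : ℕ) (s : Finset V) :
    (Fin d → MvPolynomial V F) →ₗ[F] Matrix (Fin s.card) (Fin s.card) F where
  toFun Θ := coeffMatrix (extendForms Θ) s
  map_add' Θ Θ' := by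
    ext i l
    simp only [coeffMatrix, extendForms, Matrix.of_apply, Matrix.add_apply]
    split_ifs <;> simp
  map_smul' r Θ := by
    ext i l
    simp only [coeffMatrix, extendForms, Matrix.of_apply, Matrix.smul_apply]
    split_ifs <;> simp

/-- The first `s.card` of the forms `Θ` restrict to a basis of the linear forms in the variables
in `s`. -/
def IsGenericOn (Θ : Fin d → MvPolynomial V F) (s : Finset V) : Prop :=
  (coeffMatrix (extendForms Θ) s).det ≠ 0

theorem IsGenericOn.eventually_line {s : Finset V} (h : IsGenericOn Θ s)
    (Θ' : Fin d → MvPolynomial V F) :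
    ∀ᶠ t in (cofinite : Filter F), IsGenericOn (Θ + t • (Θ' - Θ)) s :=
  eventually_cofinite_det_ne_zero_of_linear (coeffMatrixₗ F d s) Θ' h

theorem IsGenericOn.spansOn {s : Finset V} (h : IsGenericOn Θ s) : SpansOn Θ s := by
  intro v hv
  set N := coeffMatrix (extendForms Θ) s with hN
  have hu : IsUnit N.det := (h : N.det ≠ 0).isUnit
  let l := s.equivFin ⟨v, hv⟩
  let b : ℕ → F := fun i => if h : i < s.card then N⁻¹ l ⟨i, h⟩ else 0
  refine ⟨fun j => b j, fun u hu' => ?_⟩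
  let g : ℕ → F := fun i => b i * coeff (Finsupp.single u 1) (extendForms Θ i)
  have h1 : ∑ j : Fin d, b j * coeff (Finsupp.single u 1) (Θ j) = ∑ i ∈ Finset.range d, g i := by
    rw [Finset.sum_range]
    refine Finset.sum_congr rfl fun j _ => ?_
    simp only [g]
    rw [show extendForms Θ j = Θ j from congrFun (extendForms_coe Θ) j]
  -- `d` and `s.card` are not compared by hypothesis; both sums extend by zero to the larger range.
  have h2 : ∑ i ∈ Finset.range d, g i = ∑ i ∈ Finset.range (max d s.card), g i := by
    refine Finset.sum_subset (Finset.range_mono (le_max_left _ _)) fun i _ hi => ?_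
    simp [g, extendForms, Finset.mem_range.not.mp hi]
  have h3 : ∑ i ∈ Finset.range s.card, g i = ∑ i ∈ Finset.range (max d s.card), g i := by
    refine Finset.sum_subset (Finset.range_mono (le_max_right _ _)) fun i _ hi => ?_
    simp [g, b, Finset.mem_range.not.mp hi]
  have h4 : ∀ i : Fin s.card, g i = N⁻¹ l i * N i (s.equivFin ⟨u, hu'⟩) := fun i => by
    simp [g, b, hN, coeffMatrix]
  rw [h1, h2, ← h3, Finset.sum_range, Finset.sum_congr rfl (fun i _ => h4 i), ← Matrix.mul_apply,
    Matrix.nonsing_inv_mul N hu, Matrix.one_apply]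
  simp [l, eq_comm]

theorem isGenericOn_of_spansOn {s : Finset V} (h : SpansOn Θ s) (hs : s.card = d) :
    IsGenericOn Θ s := by
  subst hs
  choose c hc using fun l : Fin s.card => h (s.equivFin.symm l).1 (s.equivFin.symm l).2
  have h1 : Matrix.of c * coeffMatrix (extendForms Θ) s = 1 := by
    ext l l'
    have h2 := hc l (s.equivFin.symm l').1 (s.equivFin.symm l').2
    simp only [Subtype.coe_inj, EmbeddingLike.apply_eq_iff_eq] at h2
    rw [Matrix.mul_apply, Matrix.one_apply, if_congr (eq_comm (a := l) (b := l')) rfl rfl, ← h2]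
    refine Finset.sum_congr rfl fun j _ => ?_
    simp [coeffMatrix, extendForms]
  intro h0
  have h2 := congrArg Matrix.det h1
  rw [Matrix.det_mul, h0, mul_zero, Matrix.det_one] at h2
  exact zero_ne_one h2

/-- The sequences of linear forms. -/
def linearForms (F : Type v) [Field F] (V : Type u) (d : ℕ) :
    Submodule F (Fin d → MvPolynomial V F) :=
  Submodule.pi Set.univ fun _ => homogeneousSubmodule V F 1

theorem mem_linearForms : Θ ∈ linearForms F V d ↔ ∀ j, (Θ j).IsHomogeneous 1 := by
  simp [linearForms]

theorem isHomogeneous_line {Θ' : Fin d → MvPolynomial V F} (hΘ : ∀ j, (Θ j).IsHomogeneous 1)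
    (hΘ' : ∀ j, (Θ' j).IsHomogeneous 1) (t : F) (j : Fin d) :
    ((Θ + t • (Θ' - Θ)) j).IsHomogeneous 1 := by
  rw [← mem_linearForms] at hΘ hΘ'
  exact mem_linearForms.mp (Submodule.add_mem _ hΘ (Submodule.smul_mem _ _
    (Submodule.sub_mem _ hΘ' hΘ))) j

theorem exists_isGenericOn [Infinite F] (S : Finset (Finset V)) (hS : ∀ s ∈ S, s.card ≤ d) :
    ∃ Θ : Fin d → MvPolynomial V F, (∀ j, (Θ j).IsHomogeneous 1) ∧ ∀ s ∈ S, IsGenericOn Θ s := by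
  simp_rw [← mem_linearForms]
  refine exists_forall_of_line (linearForms F V d) S (fun s Θ Θ' h => h.eventually_line Θ')
    fun s hs => ?_
  -- For a single `s` the variables in `s`, padded with zeros, have the identity as coefficient
  -- matrix.
  refine ⟨fun j => if h : j.1 < s.card then X (s.equivFin.symm ⟨j, h⟩).1 else 0, ?_, ?_⟩
  · rw [mem_linearForms]
    intro j
    split_ifs
    · exact isHomogeneous_X _ _
    · exact isHomogeneous_zero _ _ _
  · rw [IsGenericOn]
    have : coeffMatrix (extendForms fun j : Fin d => if h : j.1 < s.card then
        (X (s.equivFin.symm ⟨j, h⟩).1 : MvPolynomial V F) else 0) s = 1 := by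
      ext i l
      have hi : i.1 < d := i.2.trans_le (hS s hs)
      simp only [coeffMatrix, Matrix.of_apply, extendForms, hi, dif_pos, i.2, coeff_X,
        Matrix.one_apply, Fin.eta]
      refine if_congr ?_ rfl rfl
      rw [(Finsupp.single_left_injective one_ne_zero).eq_iff, Subtype.coe_inj,
        EmbeddingLike.apply_eq_iff_eq, eq_comm]
    rw [this, Matrix.det_one]
    exact one_ne_zero

/-- The action of square matrices on sequences of forms. -/
def mulForms (Θ : Fin d → MvPolynomial V F) :
    Matrix (Fin d) (Fin d) F →ₗ[F] (Fin d → MvPolynomial V F) where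
  toFun g j := ∑ i, g j i • Θ i
  map_add' g h := by ext1 j; simp [add_smul, Finset.sum_add_distrib]
  map_smul' r g := by ext1 j; simp [mul_smul, Finset.smul_sum]

theorem mulForms_apply (g : Matrix (Fin d) (Fin d) F) (j : Fin d) :
    mulForms Θ g j = ∑ i, g j i • Θ i := rfl

theorem mulForms_mulForms (g h : Matrix (Fin d) (Fin d) F) :
    mulForms (mulForms Θ g) h = mulForms Θ (h * g) := by
  funext j
  simp_rw [mulForms_apply, Finset.smul_sum, Matrix.mul_apply, Finset.sum_smul, smul_smul]
  rw [Finset.sum_comm]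

theorem thetaIdeal_mulForms_le (g : Matrix (Fin d) (Fin d) F) :
    thetaIdeal K (mulForms Θ g) ≤ thetaIdeal K Θ := by
  refine sup_le faceIdeal_le_thetaIdeal (Ideal.span_le.mpr ?_)
  rintro _ ⟨j, rfl⟩
  rw [mulForms_apply]
  refine Ideal.sum_mem _ fun i _ => ?_
  rw [smul_eq_C_mul]
  exact Ideal.mul_mem_left _ _ (theta_mem_thetaIdeal i)

theorem thetaIdeal_mulForms {g : Matrix (Fin d) (Fin d) F} (hg : g.det ≠ 0) :
    thetaIdeal K (mulForms Θ g) = thetaIdeal K Θ := by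
  refine le_antisymm (thetaIdeal_mulForms_le g) ?_
  have h := thetaIdeal_mulForms_le (K := K) (Θ := mulForms Θ g) g⁻¹
  rw [mulForms_mulForms, Matrix.nonsing_inv_mul g hg.isUnit] at h
  convert h using 2
  funext j
  simp [mulForms_apply, Matrix.one_apply]

/-- An l.s.o.p. spans on each face using all its forms, whereas regularity was proved when the first
`s.card` forms are a basis on each face `s`. A generic invertible recombination achieves this
without changing the ideal. -/
theorem IsLSOP.exists_isGenericOn [Infinite F] (h : IsLSOP K Θ) :
    ∃ Θ' : Fin d → MvPolynomial V F, (∀ j, (Θ' j).IsHomogeneous 1) ∧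
      thetaIdeal K Θ' = thetaIdeal K Θ ∧ ∀ s, IsFace K s → IsGenericOn Θ' s := by
  classical
  -- `none` stands for invertibility of the recombination, `some s` for genericity on `s`.
  let P : Option (Finset V) → Matrix (Fin d) (Fin d) F → Prop := fun o g =>
    o.elim (g.det ≠ 0) fun s => IsGenericOn (mulForms Θ g) s
  have hopen : ∀ o x y, P o x → ∀ᶠ t in (cofinite : Filter F), P o (x + t • (y - x)) := by
    rintro (_ | s) x y hx
    · exact eventually_cofinite_det_ne_zero_of_linear
        (LinearMap.id : Matrix (Fin d) (Fin d) F →ₗ[F] Matrix (Fin d) (Fin d) F) y hx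
    · exact eventually_cofinite_det_ne_zero_of_linear ((coeffMatrixₗ F d s).comp (mulForms Θ)) y hx
  have hne : ∀ o ∈ insert none ((faceFinset K).image some),
      ∃ x ∈ (⊤ : Submodule F (Matrix (Fin d) (Fin d) F)), P o x := by
    intro o ho
    rcases o with _ | s
    · exact ⟨1, trivial, by simp [P]⟩
    · have hs : IsFace K s := by simpa [mem_faceFinset] using ho
      have hsd : s.card ≤ d := h.size_eq ▸ hs.card_le_size
      choose c hc using fun l : Fin s.card =>
        h.spansOn hs (s.equivFin.symm l).1 (s.equivFin.symm l).2
      -- The first rows produce forms dual to the vertices of `s`; invertibility is a separate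
      -- condition, so zero rows do no harm.
      refine ⟨Matrix.of fun i j => if hi : i.1 < s.card then c ⟨i, hi⟩ j else 0, trivial, ?_⟩
      change (coeffMatrix (extendForms (mulForms Θ _)) s).det ≠ 0
      rw [show coeffMatrix (extendForms (mulForms Θ _)) s = 1 from ?_, Matrix.det_one]
      · exact one_ne_zero
      · ext i l
        have hi : i.1 < d := i.2.trans_le hsd
        have h2 := hc i (s.equivFin.symm l).1 (s.equivFin.symm l).2
        simp only [Subtype.coe_inj, EmbeddingLike.apply_eq_iff_eq] at h2
        simp only [coeffMatrix, extendForms, hi, Matrix.of_apply, dif_pos, mulForms_apply, i.2,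
          coeff_sum, coeff_smul, smul_eq_mul, Fin.eta, h2, Matrix.one_apply, eq_comm]
  obtain ⟨g, -, hg⟩ := exists_forall_of_line ⊤ _ hopen hne
  refine ⟨mulForms Θ g, fun j => ?_, thetaIdeal_mulForms (hg none (Finset.mem_insert_self _ _)),
    fun s hs => hg (some s) (Finset.mem_insert_of_mem
      (Finset.mem_image_of_mem some (mem_faceFinset.mpr hs)))⟩
  rw [mulForms_apply]
  refine IsHomogeneous.sum _ _ _ fun i _ => ?_
  rw [smul_eq_C_mul]
  exact (h.linear i).C_mul _

theorem isLSOP_of_isGenericOn (hΘ : ∀ j, (Θ j).IsHomogeneous 1) (hd : d = size K)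
    (h : ∀ s, IsFace K s → IsGenericOn Θ s) : IsLSOP K Θ :=
  ⟨hd, hΘ, finite_reducedRing_of_spansOn hΘ fun s hs => (h s hs).spansOn⟩

theorem IsGorensteinStar.isRegularUpTo_of_isGenericOn (hK : IsGorensteinStar F K)
    (hΘ : ∀ j, (Θ j).IsHomogeneous 1) (hd : d = size K) (h : ∀ s, IsFace K s → IsGenericOn Θ s) :
    IsRegularUpTo (extendForms Θ) (FaceRing F K) d := by
  subst hd
  exact hK.isRegularUpTo_faceRing (isHomogeneous_extendForms hΘ) h

theorem IsGorensteinStar.isCohenMacaulay [Infinite F] (hK : IsGorensteinStar F K) :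
    IsCohenMacaulay F K := by
  obtain ⟨Θ, hΘ, h⟩ := SComplex.exists_isGenericOn (F := F) (d := size K) (faceFinset K)
    fun s hs => (mem_faceFinset.mp hs).card_le_size
  have h' : ∀ s, IsFace K s → IsGenericOn Θ s := fun s hs => h s (mem_faceFinset.mpr hs)
  refine ⟨size K, Θ, isLSOP_of_isGenericOn hΘ rfl h', ?_⟩
  have := free_faceRing_of_isRegularUpTo (isHomogeneous_extendForms hΘ)
    (hK.isRegularUpTo_of_isGenericOn hΘ rfl h')
  rwa [extendForms_coe] at this

theorem IsGorensteinStar.finrank_degreePart_eq [Infinite F] (hK : IsGorensteinStar F K)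
    {Θ' : Fin d → MvPolynomial V F} (hΘ : IsLSOP K Θ) (hΘ' : IsLSOP K Θ') (n : ℕ) :
    Module.finrank F (degreePart (thetaIdeal K Θ) n) =
      Module.finrank F (degreePart (thetaIdeal K Θ') n) := by
  obtain ⟨Ξ, h1, h2, h3⟩ := hΘ.exists_isGenericOn
  obtain ⟨Ξ', h1', h2', h3'⟩ := hΘ'.exists_isGenericOn
  rw [← h2, ← h2']
  have := SComplex.finrank_degreePart_eq (isHomogeneous_extendForms h1)
    (isHomogeneous_extendForms h1') (hK.isRegularUpTo_of_isGenericOn h1 hΘ.size_eq h3)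
    (hK.isRegularUpTo_of_isGenericOn h1' hΘ.size_eq h3') le_rfl n
  rwa [extendForms_coe, extendForms_coe] at this

end GenericForms

/-! ### Openness of surjectivity -/

section LefschetzGeneric

open Filter

variable {F : Type v} [Field F] {V : Type u} [Fintype V] [LinearOrder V]
variable {K : PreAbstractSimplicialComplex V} {d : ℕ} {Θ : Fin d → MvPolynomial V F}
  {ω : MvPolynomial V F}

/-- Multiplication by `ω ^ e` maps onto the forms of degree `m` modulo the ideal of `Θ`. -/
def MulPowSurjective (K : PreAbstractSimplicialComplex V) (Θ : Fin d → MvPolynomial V F)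
    (ω : MvPolynomial V F) (e m : ℕ) : Prop :=
  ∀ p : MvPolynomial V F, p.IsHomogeneous m → ∃ a, p - ω ^ e * a ∈ thetaIdeal K Θ

theorem eval_coeff_map (a : V →₀ ℕ) (G : Polynomial (MvPolynomial V F)) :
    ∃ Q : Polynomial F, ∀ t, Q.eval t = coeff a (G.eval (C t)) := by
  refine ⟨∑ k ∈ G.support, Polynomial.monomial k (coeff a (G.coeff k)), fun t => ?_⟩
  rw [Polynomial.eval_finsetSum, Polynomial.eval_eq_sum, Polynomial.sum, coeff_sum]
  refine Finset.sum_congr rfl fun k _ => ?_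
  rw [Polynomial.eval_monomial, ← map_pow, mul_comm (G.coeff k), coeff_C_mul, mul_comm]

/-- Write each monomial of degree `e + m` as a multiple of `ω ^ e` plus an element of the ideal and
deform `Θ` and `ω` with all cofactors fixed. The coefficient matrix is polynomial in `t` and the
identity at `t = 0`, so the deformed elements span that degree for almost all `t`. -/
theorem MulPowSurjective.eventually_line {e m : ℕ} (h : MulPowSurjective K Θ ω e (e + m))
    (hΘ : ∀ j, (Θ j).IsHomogeneous 1) (hω : ω.IsHomogeneous 1)
    {Θ' : Fin d → MvPolynomial V F} {ω' : MvPolynomial V F}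
    (hΘ' : ∀ j, (Θ' j).IsHomogeneous 1) (hω' : ω'.IsHomogeneous 1) :
    ∀ᶠ t in (cofinite : Filter F),
      MulPowSurjective K (Θ + t • (Θ' - Θ)) (ω + t • (ω' - ω)) e (e + m) := by
  classical
  have hfin : Finite {a : V →₀ ℕ // a.degree = e + m} := by
    have : {a : V →₀ ℕ | a.degree = e + m}.Finite := by
      refine (Finset.univ.finsuppAntidiag (e + m) : Finset (V →₀ ℕ)).finite_toSet.subset ?_
      intro a ha
      rw [Finset.mem_coe, Finset.mem_finsuppAntidiag]
      refine ⟨?_, Finset.subset_univ _⟩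
      rw [← (show a.degree = e + m from ha), Finsupp.degree_eq_sum]
    exact this
  have := Fintype.ofFinite {a : V →₀ ℕ // a.degree = e + m}
  have h1 : ∀ b : {a : V →₀ ℕ // a.degree = e + m}, ∃ a, ∃ i ∈ faceIdeal F K,
      ∃ q : Fin d → MvPolynomial V F, monomial b.1 (1 : F) = ω ^ e * a + (i + ∑ j, Θ j * q j) := by
    intro b
    obtain ⟨a, ha⟩ := h _ (isHomogeneous_monomial (1 : F) b.2)
    obtain ⟨i, hi, q, hq⟩ := mem_thetaIdeal.mp ha
    exact ⟨a, i, hi, q, by rw [← hq]; ring⟩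
  choose a i hi q hq using h1
  let G : {a : V →₀ ℕ // a.degree = e + m} → Polynomial (MvPolynomial V F) := fun b =>
    (Polynomial.C ω + Polynomial.X * Polynomial.C (ω' - ω)) ^ e * Polynomial.C (a b) +
      (Polynomial.C (i b) + ∑ j, (Polynomial.C (Θ j) + Polynomial.X *
        Polynomial.C (Θ' j - Θ j)) * Polynomial.C (q b j))
  have hG : ∀ b t, (G b).eval (C t) = (ω + t • (ω' - ω)) ^ e * a b +
      (i b + ∑ j, (Θ + t • (Θ' - Θ)) j * q b j) := fun b t => by
    simp [G, Polynomial.eval_finsetSum, smul_eq_C_mul]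
  choose Q hQ using fun b c : {a : V →₀ ℕ // a.degree = e + m} => eval_coeff_map b.1 (G c)
  have h0 : ((Matrix.of Q).map (Polynomial.eval 0)).det ≠ 0 := by
    rw [show (Matrix.of Q).map (Polynomial.eval 0) = 1 from ?_, Matrix.det_one]
    · exact one_ne_zero
    · ext b c
      rw [Matrix.map_apply, Matrix.of_apply, hQ, hG, zero_smul, add_zero, zero_smul, add_zero,
        ← hq, coeff_monomial, Matrix.one_apply]
      simp [Subtype.ext_iff, eq_comm]
  filter_upwards [eventually_cofinite_det_ne_zero _ h0] with t ht p hp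
  set N := (Matrix.of Q).map (Polynomial.eval t) with hN
  set Θt := Θ + t • (Θ' - Θ) with hΘt
  set ωt := ω + t • (ω' - ω) with hωt
  have hΘtlin : ∀ j, (Θt j).IsHomogeneous 1 := isHomogeneous_line hΘ hΘ' t
  have hωtlin : ωt.IsHomogeneous 1 := by
    rw [hωt, smul_eq_C_mul]
    exact hω.add ((hω'.sub hω).C_mul t)
  let x := N⁻¹.mulVec fun b => coeff b.1 p
  let r : MvPolynomial V F := ∑ c, x c • (G c).eval (C t)
  -- The cofactors were not chosen homogeneous, so `r` agrees with `p` only in degree `e + m`.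
  have hr : homogeneousComponent (e + m) r = p := by
    ext b
    rw [coeff_homogeneousComponent]
    split_ifs with hb
    · have h2 : N.mulVec x = fun b => coeff b.1 p := by
        rw [Matrix.mulVec_mulVec, Matrix.mul_nonsing_inv N ht.isUnit, Matrix.one_mulVec]
      have h3 := congrFun h2 ⟨b, hb⟩
      simp only at h3
      rw [← h3, coeff_sum]
      refine Finset.sum_congr rfl fun c _ => ?_
      rw [coeff_smul, smul_eq_mul, mul_comm]
      change _ = (Q ⟨b, hb⟩ c).eval t * x c
      rw [hQ]
    · exact (hp.coeff_eq_zero hb).symm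
  have hrJ : r - ωt ^ e * ∑ c, x c • a c ∈ thetaIdeal K Θt := by
    rw [Finset.mul_sum, ← Finset.sum_sub_distrib]
    refine Ideal.sum_mem _ fun c _ => ?_
    rw [mul_smul_comm, ← smul_sub, hG, add_sub_cancel_left, smul_eq_C_mul]
    exact Ideal.mul_mem_left _ _ (mem_thetaIdeal.mpr ⟨i c, hi c, q c, rfl⟩)
  have h4 := homogeneousComponent_mem_thetaIdeal hΘtlin hrJ (e + m)
  have h5 : (ωt ^ e).IsHomogeneous e := by simpa using hωtlin.pow e
  rw [map_sub, hr, homogeneousComponent_mul_of_isHomogeneous h5] at h4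
  exact ⟨_, h4⟩

end LefschetzGeneric

/-! ### Lefschetz elements on the level of polynomials -/

section LefschetzMod

variable {F : Type v} [Field F] {V : Type u} {J : Ideal (MvPolynomial V F)}
  {ω ω' : MvPolynomial V F} {e i : ℕ}

/-- Multiplication by `ω ^ e` is a bijection from degree `i` to degree `e + i` modulo `J`. -/
def LefschetzMod (J : Ideal (MvPolynomial V F)) (ω : MvPolynomial V F) (e i : ℕ) : Prop :=
  (∀ p : MvPolynomial V F, p.IsHomogeneous i → ω ^ e * p ∈ J → p ∈ J) ∧
    ∀ p : MvPolynomial V F, p.IsHomogeneous (e + i) →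
      ∃ a : MvPolynomial V F, a.IsHomogeneous i ∧ p - ω ^ e * a ∈ J

theorem isHomogeneous_pow (hω : ω.IsHomogeneous 1) (e : ℕ) : (ω ^ e).IsHomogeneous e := by
  simpa using hω.pow e

theorem isLefschetzElement_iff {K : PreAbstractSimplicialComplex V} {d : ℕ}
    {Θ : Fin d → MvPolynomial V F} (h : e + 2 * i = d) :
    IsLefschetzElement K Θ ω i ↔ ω.IsHomogeneous 1 ∧ LefschetzMod (thetaIdeal K Θ) ω e i := by
  have h1 : d - 2 * i = e := by omega
  have h2 : d - i = e + i := by omega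
  rw [IsLefschetzElement, h1, h2]
  refine and_congr_right fun hω => ⟨fun h => ⟨fun p hp hpJ => ?_, fun p hp => ?_⟩, fun h => ?_⟩
  · have h3 := h.injOn (mem_gradedPiece.mpr ⟨p, hp, rfl⟩)
      (mem_gradedPiece.mpr ⟨0, isHomogeneous_zero _ _ _, rfl⟩)
    simp only [map_zero, mul_zero] at h3
    rw [← Ideal.Quotient.eq_zero_iff_mem]
    apply h3
    rw [← map_pow, ← map_mul]
    exact Ideal.Quotient.eq_zero_iff_mem.mpr hpJ
  · obtain ⟨x, hx, hxp⟩ := h.surjOn (mem_gradedPiece.mpr ⟨p, hp, rfl⟩)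
    obtain ⟨a, ha, rfl⟩ := mem_gradedPiece.mp hx
    refine ⟨a, ha, Ideal.Quotient.eq.mp ?_⟩
    rw [map_mul, map_pow]
    exact hxp.symm
  · refine ⟨fun x hx => ?_, fun x hx y hy hxy => ?_, fun x hx => ?_⟩
    · obtain ⟨p, hp, rfl⟩ := mem_gradedPiece.mp hx
      exact mem_gradedPiece.mpr ⟨ω ^ e * p, (isHomogeneous_pow hω e).mul hp, by simp⟩
    · obtain ⟨p, hp, rfl⟩ := mem_gradedPiece.mp hx
      obtain ⟨q, hq, rfl⟩ := mem_gradedPiece.mp hy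
      refine Ideal.Quotient.eq.mpr (h.1 _ (hp.sub hq) ?_)
      simp only [← map_pow, ← map_mul] at hxy
      rw [mul_sub]
      exact Ideal.Quotient.eq.mp hxy
    · obtain ⟨p, hp, rfl⟩ := mem_gradedPiece.mp hx
      obtain ⟨a, ha, haJ⟩ := h.2 p hp
      refine ⟨_, mem_gradedPiece.mpr ⟨a, ha, rfl⟩, ?_⟩
      simp only [← map_pow, ← map_mul]
      exact (Ideal.Quotient.eq.mpr haJ).symm

theorem isHLElement_iff {K : PreAbstractSimplicialComplex V} {d : ℕ}
    {Θ : Fin d → MvPolynomial V F} : IsHLElement K Θ ω ↔ ω.IsHomogeneous 1 ∧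
      ∀ e i, e + 2 * i = d → LefschetzMod (thetaIdeal K Θ) ω e i := by
  refine ⟨fun h => ⟨(h 0 (Nat.zero_le _)).1, fun e i hei => ?_⟩, fun h i hi => ?_⟩
  · exact ((isLefschetzElement_iff hei).mp (h i (by omega))).2
  · exact (isLefschetzElement_iff (e := d - 2 * i) (by omega)).mpr ⟨h.1, h.2 _ _ (by omega)⟩

theorem pow_sub_pow_mem (h : ω - ω' ∈ J) (e : ℕ) : ω ^ e - ω' ^ e ∈ J :=
  Ideal.mem_of_dvd _ (sub_dvd_pow_sub_pow ω ω' e) h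

theorem LefschetzMod.congr (hω : LefschetzMod J ω e i) (h : ω - ω' ∈ J) : LefschetzMod J ω' e i := by
  have h1 : ∀ p, ω ^ e * p - ω' ^ e * p ∈ J := fun p => by
    rw [← sub_mul]
    exact Ideal.mul_mem_right _ _ (pow_sub_pow_mem h e)
  refine ⟨fun p hp hpJ => hω.1 p hp ?_, fun p hp => ?_⟩
  · simpa using Ideal.add_mem _ (h1 p) hpJ
  · obtain ⟨a, ha, haJ⟩ := hω.2 p hp
    refine ⟨a, ha, ?_⟩
    simpa using Ideal.add_mem _ haJ (h1 a)

theorem LefschetzMod.C_mul (hω : LefschetzMod J ω e i) {r : F} (hr : r ≠ 0) :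
    LefschetzMod J (C r * ω) e i := by
  have hr' : ∀ p : MvPolynomial V F, C (r⁻¹ ^ e) * (C (r ^ e) * p) = p := fun p => by
    rw [← mul_assoc, ← map_mul, ← mul_pow, inv_mul_cancel₀ hr, one_pow, map_one, one_mul]
  simp only [LefschetzMod, mul_pow, ← map_pow]
  refine ⟨fun p hp hpJ => hω.1 p hp ?_, fun p hp => ?_⟩
  · rw [← hr' (ω ^ e * p), ← mul_assoc (C _) (ω ^ e)]
    exact Ideal.mul_mem_left _ _ hpJ
  · obtain ⟨a, ha, haJ⟩ := hω.2 p hp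
    refine ⟨C (r⁻¹ ^ e) * a, ha.C_mul _, ?_⟩
    rwa [show C (r ^ e) * ω ^ e * (C (r⁻¹ ^ e) * a) =
      ω ^ e * (C (r⁻¹ ^ e) * (C (r ^ e) * a)) by ring, hr']

end LefschetzMod

/-! ### Gluing along the facet -/

section Gluing

variable {F : Type v} [Field F] {V : Type u} [Fintype V] [LinearOrder V]
variable {K L : PreAbstractSimplicialComplex V} {σ : Finset V} {d : ℕ}
  {Θ : Fin d → MvPolynomial V F} {ω : MvPolynomial V F} {e i n : ℕ}

/-- This is injectivity of `H(K ∪ L) → H(K) ⊕ H(L)`. Since `I_K + I_L` is the face ideal of the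
simplex, on which `Θ` are coordinates, each cofactor is a sum of elements of `I_K`, of `I_L` and a
polynomial in `Θ`. -/
theorem inf_thetaIdeal_le_of_isGenericOn (hΘ : ∀ j, (Θ j).IsHomogeneous 1) (hσ : σ.card = d)
    (hΘσ : IsGenericOn Θ σ) (hKL : K ⊓ L = simplex σ) :
    thetaIdeal K Θ ⊓ thetaIdeal L Θ ≤ thetaIdeal (K ⊔ L) Θ := by
  subst hσ
  obtain ⟨φ, hφΘ, hφ0, hφ⟩ := exists_coordinates (isHomogeneous_extendForms hΘ) hΘσ
  rw [extendForms_coe] at hφ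
  replace hφΘ : ∀ j, φ (Θ j) = X j := fun j => by
    rw [← hφΘ j, show extendForms Θ j = Θ j from congrFun (extendForms_coe Θ) j]
  rw [← hKL, faceIdeal_inf] at hφ hφ0
  rintro c ⟨hcK, hcL⟩
  obtain ⟨k, hk, a, hca⟩ := mem_thetaIdeal.mp hcK
  obtain ⟨l, hl, b, hcb⟩ := mem_thetaIdeal.mp hcL
  -- In the coordinates of the simplex both expressions of `c` agree, so their parts polynomial in
  -- `Θ` have the same sum.
  have hX : ∑ j, X j * φ (a j) = ∑ j, X j * φ (b j) := by
    have h := congrArg φ (hca.symm.trans hcb)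
    simpa only [map_add, map_sum, map_mul, hφΘ, hφ0 k (Ideal.mem_sup_left hk),
      hφ0 l (Ideal.mem_sup_right hl), zero_add] using h
  have hP := congrArg (aeval Θ) hX
  simp only [map_sum, map_mul, aeval_X] at hP
  choose a₁ ha₁ a₂ ha₂ ha using fun j => Submodule.mem_sup.mp (hφ (a j))
  choose b₁ hb₁ b₂ hb₂ hb using fun j => Submodule.mem_sup.mp (hφ (b j))
  have hmul : ∀ {M : PreAbstractSimplicialComplex V} {f : Fin σ.card → MvPolynomial V F},
      (∀ j, f j ∈ faceIdeal F M) → ∑ j, Θ j * f j ∈ faceIdeal F M := fun hf =>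
    Ideal.sum_mem _ fun j _ => Ideal.mul_mem_left _ _ (hf j)
  have ha' : ∑ j, Θ j * a j = ∑ j, Θ j * a₁ j + ∑ j, Θ j * a₂ j +
      ∑ j, Θ j * aeval Θ (φ (a j)) := by
    simp only [← Finset.sum_add_distrib, ← mul_add, ha, sub_add_cancel]
  have hb' : ∑ j, Θ j * b j = ∑ j, Θ j * b₁ j + ∑ j, Θ j * b₂ j +
      ∑ j, Θ j * aeval Θ (φ (b j)) := by
    simp only [← Finset.sum_add_distrib, ← mul_add, hb, sub_add_cancel]
  rw [mem_thetaIdeal, faceIdeal_sup]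
  -- Every term of this face part lies in `I_K`; by the equality of the two expressions it is also
  -- `l + ∑ Θ b₂ - ∑ Θ a₂`, which lies in `I_L`.
  refine ⟨k + ∑ j, Θ j * a₁ j - ∑ j, Θ j * b₁ j, ⟨?_, ?_⟩,
    fun j => aeval Θ (φ (a j)) + a₂ j + b₁ j, ?_⟩
  · exact Ideal.sub_mem _ (Ideal.add_mem _ hk (hmul ha₁)) (hmul hb₁)
  · rw [show k + ∑ j, Θ j * a₁ j - ∑ j, Θ j * b₁ j = l + ∑ j, Θ j * b₂ j - ∑ j, Θ j * a₂ j by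
      linear_combination hcb - hca + hb' - ha' - hP]
    exact Ideal.sub_mem _ (Ideal.add_mem _ hl (hmul hb₂)) (hmul ha₂)
  · simp only [mul_add, Finset.sum_add_distrib]
    linear_combination hca + ha'

/-- Below degree `d` no monomial has support `σ`, so the face ideals of the connected sum and of `K
∪ L` agree there. -/
theorem mem_thetaIdeal_connectedSum_iff (hΘ : ∀ j, (Θ j).IsHomogeneous 1) (hσ : σ.card = d)
    (hΘσ : IsGenericOn Θ σ) (hσK : IsFacet K σ) (hσL : IsFacet L σ) (hKL : K ⊓ L = simplex σ)
    {p : MvPolynomial V F} (hp : p.IsHomogeneous n) (hn : 0 < n) (hnd : n < d) :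
    p ∈ thetaIdeal (connectedSum K L σ) Θ ↔ p ∈ thetaIdeal K Θ ∧ p ∈ thetaIdeal L Θ := by
  have hne : σ.Nonempty := Finset.card_pos.mp (by omega)
  have hface : ∀ {s}, IsFace (connectedSum K L σ) s ↔ (IsFace K s ∨ IsFace L s) ∧ s ≠ σ :=
    isFace_connectedSum_of_facet hne hσK hσL
  obtain ⟨m, rfl⟩ := Nat.exists_eq_add_of_le' hn
  constructor
  · intro h
    obtain ⟨g, hg, hgm, q, -, rfl⟩ := exists_of_mem_thetaIdeal_of_isHomogeneous hΘ h hp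
    have hlt : ∀ a : V →₀ ℕ, coeff a g ≠ 0 → a.support ≠ σ := by
      rintro a ha rfl
      have h1 : a.degree = m + 1 := by
        by_contra h2
        exact ha (hgm.coeff_eq_zero h2)
      have h2 : a.support.card ≤ a.degree := by
        rw [Finset.card_eq_sum_ones]
        exact Finset.sum_le_sum fun v hv => Nat.one_le_iff_ne_zero.mpr (Finsupp.mem_support_iff.mp hv)
      omega
    have hsum : ∀ M : PreAbstractSimplicialComplex V, ∑ j, Θ j * q j ∈ thetaIdeal M Θ := fun M =>
      Ideal.sum_mem _ fun j _ => Ideal.mul_mem_right _ _ (theta_mem_thetaIdeal j)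
    refine ⟨Ideal.add_mem _ (faceIdeal_le_thetaIdeal ?_) (hsum K),
      Ideal.add_mem _ (faceIdeal_le_thetaIdeal ?_) (hsum L)⟩ <;>
    refine mem_faceIdeal_iff_coeff.mpr fun a ha => by_contra fun h0 => h0 ?_
    · exact mem_faceIdeal_iff_coeff.mp hg a (hface.mpr ⟨Or.inl ha, hlt a h0⟩)
    · exact mem_faceIdeal_iff_coeff.mp hg a (hface.mpr ⟨Or.inr ha, hlt a h0⟩)
  · intro h
    exact thetaIdeal_mono (fun s hs => isFace_sup.mpr (hface.mp hs).1)
      (inf_thetaIdeal_le_of_isGenericOn hΘ hσ hΘσ hKL h)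

theorem mem_thetaIdeal_simplex (hΘ : ∀ j, (Θ j).IsHomogeneous 1) (hΘσ : SpansOn Θ σ)
    {p : MvPolynomial V F} (hp : p.IsHomogeneous n) (hn : 0 < n) :
    p ∈ thetaIdeal (simplex σ) Θ := by
  have hout : ∀ u, u ∉ σ → (X u : MvPolynomial V F) ∈ thetaIdeal (simplex σ) Θ := fun u hu =>
    faceIdeal_le_thetaIdeal (X_mem_faceIdeal (by simpa [isFace_simplex] using hu))
  have hX : ∀ u, (X u : MvPolynomial V F) ∈ thetaIdeal (simplex σ) Θ := by
    intro u
    by_cases hu : u ∈ σ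
    · obtain ⟨g, hg⟩ := hΘσ.exists_sum_mem (K := simplex σ) hΘ hu
      refine (Ideal.add_mem_iff_left _ (Ideal.sum_mem _ fun w hw => ?_)).mp hg
      exact Ideal.mul_mem_left _ _ (hout w (Finset.mem_compl.mp hw))
    · exact hout u hu
  rw [p.as_sum]
  refine Ideal.sum_mem _ fun a ha => ?_
  have ha0 : a ≠ 0 := by
    rintro rfl
    have := hp (mem_support_iff.mp ha)
    simp at this
    omega
  obtain ⟨u, hu⟩ := Finsupp.ne_iff.mp ha0
  exact Ideal.mem_of_dvd _ (X_dvd_monomial.mpr (Or.inr hu)) (hX u)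

/-- Surjectivity of `H(K ∪ L)_n → H(K)_n ⊕ H(L)_n`: the obstruction `a - b` lies in `H(⟨σ⟩)_n`,
which is zero in positive degree. -/
theorem exists_sub_mem_thetaIdeal_of_inf_eq_simplex (hΘ : ∀ j, (Θ j).IsHomogeneous 1)
    (hΘσ : SpansOn Θ σ) (hKL : K ⊓ L = simplex σ) {a b : MvPolynomial V F}
    (ha : a.IsHomogeneous n) (hb : b.IsHomogeneous n) (hn : 0 < n) :
    ∃ c : MvPolynomial V F, c.IsHomogeneous n ∧ c - a ∈ thetaIdeal K Θ ∧
      c - b ∈ thetaIdeal L Θ := by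
  have h := mem_thetaIdeal_simplex hΘ hΘσ (ha.sub hb) hn
  obtain ⟨g, hg, q, hq⟩ := mem_thetaIdeal.mp h
  rw [← hKL, faceIdeal_inf] at hg
  obtain ⟨k, hk, l, hl, rfl⟩ := Submodule.mem_sup.mp hg
  have h1 : (a - k) - a ∈ thetaIdeal K Θ := by
    rw [sub_sub_cancel_left]
    exact Ideal.neg_mem_iff _ |>.mpr (faceIdeal_le_thetaIdeal hk)
  have h2 : (a - k) - b ∈ thetaIdeal L Θ := by
    rw [show a - k - b = l + ∑ j, Θ j * q j by linear_combination hq]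
    exact mem_thetaIdeal.mpr ⟨l, hl, q, rfl⟩
  have h1' := homogeneousComponent_mem_thetaIdeal hΘ h1 n
  have h2' := homogeneousComponent_mem_thetaIdeal hΘ h2 n
  rw [map_sub, homogeneousComponent_of_mem ha, if_pos rfl] at h1'
  rw [map_sub, homogeneousComponent_of_mem hb, if_pos rfl] at h2'
  exact ⟨_, homogeneousComponent_isHomogeneous n (a - k), h1', h2'⟩

/-- Since `i > 0`, both `i` and `e + i = d - i` lie strictly between 0 and `d`, where the pieces are
direct sums. -/
theorem LefschetzMod.connectedSum (hΘ : ∀ j, (Θ j).IsHomogeneous 1) (hσ : σ.card = d)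
    (hΘσ : SpansOn Θ σ) (hσK : IsFacet K σ) (hσL : IsFacet L σ) (hKL : K ⊓ L = simplex σ)
    (hω : ω.IsHomogeneous 1) (hi : 0 < i) (hei : e + 2 * i = d)
    (hK : LefschetzMod (thetaIdeal K Θ) ω e i) (hL : LefschetzMod (thetaIdeal L Θ) ω e i) :
    LefschetzMod (thetaIdeal (connectedSum K L σ) Θ) ω e i := by
  have hgen := isGenericOn_of_spansOn hΘσ hσ
  have hmem : ∀ {n} {p : MvPolynomial V F}, p.IsHomogeneous n → 0 < n → n < d →
      (p ∈ thetaIdeal (SComplex.connectedSum K L σ) Θ ↔ p ∈ thetaIdeal K Θ ∧ p ∈ thetaIdeal L Θ) :=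
    fun hp hn hnd => mem_thetaIdeal_connectedSum_iff hΘ hσ hgen hσK hσL hKL hp hn hnd
  refine ⟨fun p hp hpJ => ?_, fun p hp => ?_⟩
  · rw [hmem ((isHomogeneous_pow hω e).mul hp) (by omega) (by omega)] at hpJ
    exact (hmem hp hi (by omega)).mpr ⟨hK.1 p hp hpJ.1, hL.1 p hp hpJ.2⟩
  · obtain ⟨a, ha, haJ⟩ := hK.2 p hp
    obtain ⟨b, hb, hbJ⟩ := hL.2 p hp
    obtain ⟨c, hc, hca, hcb⟩ := exists_sub_mem_thetaIdeal_of_inf_eq_simplex hΘ hΘσ hKL ha hb hi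
    refine ⟨c, hc, (hmem (hp.sub ((isHomogeneous_pow hω e).mul hc)) (by omega) (by omega)).mpr
      ⟨?_, ?_⟩⟩
    · rw [show p - ω ^ e * c = p - ω ^ e * a - ω ^ e * (c - a) by ring]
      exact Ideal.sub_mem _ haJ (Ideal.mul_mem_left _ _ hca)
    · rw [show p - ω ^ e * c = p - ω ^ e * b - ω ^ e * (c - b) by ring]
      exact Ideal.sub_mem _ hbJ (Ideal.mul_mem_left _ _ hcb)

/-- `H_0` is `F` and `H_d` is spanned by a single facet monomial, so a nonzero map between them is
bijective. -/
theorem IsGorensteinStar.lefschetzMod_zero_iff (hK : IsGorensteinStar F K) (hΘ : IsLSOP K Θ)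
    (hω : ω.IsHomogeneous 1) :
    LefschetzMod (thetaIdeal K Θ) ω d 0 ↔ ω ^ d ∉ thetaIdeal K Θ := by
  have hconst : ∀ {p : MvPolynomial V F}, p.IsHomogeneous 0 → p = C (coeff 0 p) := fun hp => by
    rw [← homogeneousComponent_zero, homogeneousComponent_of_mem hp, if_pos rfl]
  constructor
  · intro h h'
    have h1 := coeff_zero_of_mem_thetaIdeal hΘ.linear
      (h.1 1 (isHomogeneous_one _ _) (by rwa [mul_one]))
    simp at h1
  · intro h
    obtain ⟨τ, -, hτ⟩ := (isFace_empty K).exists_isFacet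
    have key : ∀ {p : MvPolynomial V F}, p.IsHomogeneous d →
        ∃ c : F, p - C c * faceMonomial F τ ∈ thetaIdeal K Θ := fun hp =>
      hK.exists_sub_mem_thetaIdeal hΘ.linear (fun s hs => hΘ.spansOn hs) hτ (hΘ.size_eq ▸ hp)
    refine ⟨fun p hp hpJ => ?_, fun p hp => ?_⟩
    · rw [hconst hp] at hpJ ⊢
      by_contra h0
      have hc : coeff 0 p ≠ 0 := fun hc => h0 (by simp [hc])
      refine h ?_
      have := Ideal.mul_mem_right (C (coeff 0 p)⁻¹) _ hpJ
      rwa [mul_assoc, ← map_mul, mul_inv_cancel₀ hc, map_one, mul_one] at this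
    · obtain ⟨a, ha⟩ := key (isHomogeneous_pow hω d)
      obtain ⟨c, hc⟩ := key hp
      have ha0 : a ≠ 0 := by
        rintro rfl
        simp only [map_zero, zero_mul, sub_zero] at ha
        exact h ha
      refine ⟨C (c / a), isHomogeneous_C _ _, ?_⟩
      have h1 := Ideal.sub_mem _ hc (Ideal.mul_mem_left _ (C (c / a)) ha)
      have h2 : (C c : MvPolynomial V F) = C (c / a) * C a := by
        rw [← map_mul, div_mul_cancel₀ _ ha0]
      convert h1 using 1
      rw [h2]
      ring

end Gluing

/-! ### Degree zero: rescaling one half of `ω` -/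

section Rescaling

variable {F : Type v} [Field F] {V : Type u} [Fintype V] [LinearOrder V]
variable {K L : PreAbstractSimplicialComplex V} {σ : Finset V} {d : ℕ}
  {Θ : Fin d → MvPolynomial V F} {ω : MvPolynomial V F} {e i n : ℕ}

theorem exists_sub_sum_compl_mem_thetaIdeal (hΘ : ∀ j, (Θ j).IsHomogeneous 1) (hΘσ : SpansOn Θ σ)
    (hω : ω.IsHomogeneous 1) :
    ∃ g : V → F, ω - ∑ u ∈ σᶜ, C (g u) * X u ∈ thetaIdeal K Θ := by
  have hX : ∀ v, ∃ g : V → F, X v - ∑ u ∈ σᶜ, C (g u) * X u ∈ thetaIdeal K Θ := by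
    intro v
    by_cases hv : v ∈ σ
    · obtain ⟨g, hg⟩ := hΘσ.exists_sum_mem (K := K) hΘ hv
      exact ⟨fun u => -g u, by simpa using hg⟩
    · refine ⟨fun u => if u = v then 1 else 0, ?_⟩
      rw [Finset.sum_eq_single_of_mem v (Finset.mem_compl.mpr hv) fun u _ huv => by simp [huv]]
      simp
  choose g hg using hX
  refine ⟨fun u => ∑ v, coeff (Finsupp.single v 1) ω * g v u, ?_⟩
  have h : ω - ∑ u ∈ σᶜ, C (∑ v, coeff (Finsupp.single v 1) ω * g v u) * X u =
      ∑ v, C (coeff (Finsupp.single v 1) ω) * (X v - ∑ u ∈ σᶜ, C (g v u) * X u) := by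
    conv_lhs => enter [1]; rw [IsHomogeneous.eq_sum_X hω]
    simp_rw [mul_sub, Finset.sum_sub_distrib, Finset.mul_sum, map_sum, Finset.sum_mul, map_mul,
      mul_assoc]
    rw [Finset.sum_comm]
  rw [h]
  exact Ideal.sum_mem _ fun v _ => Ideal.mul_mem_left _ _ (hg v)

/-- Modulo `Θ` a linear form splits into a part that vanishes on `K` and a part that vanishes
on `L`. -/
theorem exists_isHomogeneous_sub_mem (hΘ : ∀ j, (Θ j).IsHomogeneous 1) (hΘσ : SpansOn Θ σ)
    (hKL : K ⊓ L = simplex σ) (hω : ω.IsHomogeneous 1) :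
    ∃ α β : MvPolynomial V F, α.IsHomogeneous 1 ∧ β.IsHomogeneous 1 ∧
      α ∈ thetaIdeal L Θ ∧ β ∈ thetaIdeal K Θ ∧
      ω - α ∈ thetaIdeal K Θ ∧ ω - β ∈ thetaIdeal L Θ := by
  classical
  obtain ⟨g, hg⟩ := exists_sub_sum_compl_mem_thetaIdeal (K := K ⊔ L) hΘ hΘσ hω
  have hgK := thetaIdeal_mono (fun s hs => isFace_sup.mpr (Or.inl hs)) hg
  have hgL := thetaIdeal_mono (fun s hs => isFace_sup.mpr (Or.inr hs)) hg
  -- A vertex outside `σ` lies in at most one of `K` and `L`, so sorting the variables by membership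
  -- in `K` separates the two parts.
  set α : MvPolynomial V F := ∑ u ∈ σᶜ with IsFace K {u}, C (g u) * X u with hα
  set β : MvPolynomial V F := ∑ u ∈ σᶜ with ¬ IsFace K {u}, C (g u) * X u with hβ
  have hαβ : ∑ u ∈ σᶜ, C (g u) * X u = α + β :=
    (Finset.sum_filter_add_sum_filter_not _ _ _).symm
  have hlin : ∀ S : Finset V, (∑ u ∈ S, C (g u) * X u).IsHomogeneous 1 := fun S =>
    IsHomogeneous.sum _ _ _ fun u _ => (isHomogeneous_X F u).C_mul _
  have hαL : α ∈ thetaIdeal L Θ := Ideal.sum_mem _ fun u hu => by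
    rw [Finset.mem_filter, Finset.mem_compl] at hu
    refine Ideal.mul_mem_left _ _ (faceIdeal_le_thetaIdeal (X_mem_faceIdeal fun h => hu.1 ?_))
    exact Finset.singleton_subset_iff.mp ((isFace_of_inf_eq_simplex hKL).mpr ⟨hu.2, h⟩)
  have hβK : β ∈ thetaIdeal K Θ := Ideal.sum_mem _ fun u hu =>
    Ideal.mul_mem_left _ _ (faceIdeal_le_thetaIdeal (X_mem_faceIdeal (Finset.mem_filter.mp hu).2))
  rw [hαβ] at hgK hgL
  refine ⟨α, β, hlin _, hlin _, hαL, hβK, ?_, ?_⟩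
  · convert Ideal.add_mem _ hgK hβK using 1; ring
  · convert Ideal.add_mem _ hgL hαL using 1; ring

theorem exists_ne_zero_pow_mul_ne [Infinite F] (d : ℕ) {a : F} (b : F) (ha : a ≠ 0) (hd : 0 < d) :
    ∃ r : F, r ≠ 0 ∧ r ^ d * a ≠ b := by
  by_contra! h
  -- The extra factor `X` takes care of `r = 0`.
  have h1 : (Polynomial.X * (Polynomial.C a * Polynomial.X ^ d - Polynomial.C b) :
      Polynomial F) = 0 := Polynomial.funext fun r => by
    by_cases hr : r = 0
    · simp [hr]
    · simp only [Polynomial.eval_mul, Polynomial.eval_X, Polynomial.eval_sub, Polynomial.eval_C,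
        Polynomial.eval_pow, Polynomial.eval_zero, ← h r hr]
      ring
  rcases mul_eq_zero.mp h1 with h2 | h2
  · exact Polynomial.X_ne_zero h2
  · have h3 := congrArg (fun p => Polynomial.coeff p d) h2
    simp [Polynomial.coeff_C, hd.ne', ha] at h3

/-- A form of degree `σ.card` that vanishes on the connected sum is, up to a multiple of the
monomial of `σ`, one that vanishes on `K ∪ L`. -/
theorem exists_sub_mem_faceIdeal_sup (hσK : IsFacet K σ) (hσL : IsFacet L σ) (hσ : σ.Nonempty)
    {p : MvPolynomial V F} (hp : p ∈ faceIdeal F (connectedSum K L σ))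
    (hpd : p.IsHomogeneous σ.card) :
    ∃ c : F, p - C c * faceMonomial F σ ∈ faceIdeal F (K ⊔ L) := by
  classical
  set b : V →₀ ℕ := ∑ v ∈ σ, Finsupp.single v 1 with hb
  have hbs : b.support = σ := support_sum_single σ
  refine ⟨coeff b p, mem_faceIdeal_iff_coeff.mpr fun a ha => ?_⟩
  rw [faceMonomial_eq_monomial, ← hb, C_mul_monomial, mul_one, coeff_sub, coeff_monomial]
  split_ifs with h
  · rw [h, sub_self]
  · rw [sub_zero]
    by_cases has : a.support = σ
    · refine hpd.coeff_eq_zero fun hdeg => h ?_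
      have hle : ∀ v ∈ σ, 1 ≤ a v := fun v hv => by
        rw [← has, Finsupp.mem_support_iff] at hv; omega
      have hsum : ∑ v ∈ σ, 1 = ∑ v ∈ σ, a v := by
        rw [← Finset.card_eq_sum_ones, ← hdeg, Finsupp.degree_apply, has]
      have heq := (Finset.sum_eq_sum_iff_of_le hle).mp hsum
      ext v
      rw [hb, Finsupp.finsetSum_apply]
      by_cases hv : v ∈ σ
      · rw [← heq v hv]; simp [Finsupp.single_apply, hv]
      · rw [← has, Finsupp.notMem_support_iff] at hv
        rw [hv]
        simp [Finsupp.single_apply, ← has, hv]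
    · exact mem_faceIdeal_iff_coeff.mp hp a
        ((isFace_connectedSum_of_facet hσ hσK hσL).mpr ⟨isFace_sup.mp ha, has⟩)

/-- With `ω' = C r * α + β`, the power `ω' ^ d` is `r ^ d a` times the monomial of `σ` on `K` and
`b` times it on `L`. It can vanish on the connected sum only if these agree, as there the monomial
of `σ` is all that is added to the ideal of `K ∪ L` in degree `d`. -/
theorem exists_isHLElement_connectedSum [Infinite F] (hK : IsGorensteinStar F K)
    (hL : IsGorensteinStar F L) (hσ : σ.Nonempty) (hσK : IsFacet K σ) (hσL : IsFacet L σ)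
    (hKL : K ⊓ L = simplex σ) (hΘK : IsLSOP K Θ) (hΘL : IsLSOP L Θ)
    (hΘ : IsLSOP (connectedSum K L σ) Θ) (hωK : IsHLElement K Θ ω) (hωL : IsHLElement L Θ ω) :
    ∃ ω', IsHLElement (connectedSum K L σ) Θ ω' := by
  have hdσ : σ.card = d := by rw [hK.1 σ hσK, hΘK.size_eq]
  have hd : 0 < d := hdσ ▸ hσ.card_pos
  have hlin := hΘK.linear
  have hΘσ : SpansOn Θ σ := hΘK.spansOn hσK.1
  obtain ⟨hω, hωK⟩ := isHLElement_iff.mp hωK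
  obtain ⟨-, hωL⟩ := isHLElement_iff.mp hωL
  obtain ⟨α, β, hα, hβ, hαL, hβK, hωα, hωβ⟩ := exists_isHomogeneous_sub_mem hlin hΘσ hKL hω
  obtain ⟨a, ha⟩ := hK.exists_sub_mem_thetaIdeal hlin (fun s hs => hΘK.spansOn hs) hσK
    (p := α ^ d) (hΘK.size_eq ▸ isHomogeneous_pow hα d)
  obtain ⟨b, hb⟩ := hL.exists_sub_mem_thetaIdeal hlin (fun s hs => hΘL.spansOn hs) hσL
    (p := β ^ d) (hΘL.size_eq ▸ isHomogeneous_pow hβ d)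
  have hαd := (hK.lefschetzMod_zero_iff hΘK hα).mp ((hωK d 0 rfl).congr hωα)
  have hβd := (hL.lefschetzMod_zero_iff hΘL hβ).mp ((hωL d 0 rfl).congr hωβ)
  -- The monomial of `σ` is nonzero in `H(K, Θ)`, since the nonzero `α ^ d` is a multiple of it.
  have hK' : ∀ {r : F}, C r * faceMonomial F σ ∈ thetaIdeal K Θ → r = 0 := fun {r} h => by
    by_contra hr
    refine hαd ?_
    have h1 := Ideal.add_mem _ ha (Ideal.mul_mem_left _ (C (a / r)) h)
    rwa [← mul_assoc, ← map_mul, div_mul_cancel₀ _ hr, sub_add_cancel] at h1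
  have hL' : ∀ {r : F}, C r * faceMonomial F σ ∈ thetaIdeal L Θ → r = 0 := fun {r} h => by
    by_contra hr
    refine hβd ?_
    have h1 := Ideal.add_mem _ hb (Ideal.mul_mem_left _ (C (b / r)) h)
    rwa [← mul_assoc, ← map_mul, div_mul_cancel₀ _ hr, sub_add_cancel] at h1
  have ha0 : a ≠ 0 := by
    rintro rfl
    simp only [map_zero, zero_mul, sub_zero] at ha
    exact hαd ha
  obtain ⟨r, hr, hrab⟩ := exists_ne_zero_pow_mul_ne d b ha0 hd
  set ω' := C r * α + β with hω'
  have hω'lin : ω'.IsHomogeneous 1 := (hα.C_mul r).add hβ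
  have h1 : C r * α - ω' ∈ thetaIdeal K Θ := by
    rw [hω', sub_add_cancel_left]
    exact (Ideal.neg_mem_iff _).mpr hβK
  have h2 : β - ω' ∈ thetaIdeal L Θ := by
    rw [hω', sub_add_cancel_right]
    exact (Ideal.neg_mem_iff _).mpr (Ideal.mul_mem_left _ _ hαL)
  refine ⟨ω', isHLElement_iff.mpr ⟨hω'lin, fun e i hei => ?_⟩⟩
  rcases Nat.eq_zero_or_pos i with rfl | hi
  · obtain rfl : e = d := by omega
    refine ((hK.connectedSum hL hσ hσK hσL hKL).lefschetzMod_zero_iff hΘ hω'lin).mpr fun h => ?_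
    obtain ⟨m, rfl⟩ := Nat.exists_eq_add_of_le' hd
    obtain ⟨g, hg, hgd, q, -, hgq⟩ := exists_of_mem_thetaIdeal_of_isHomogeneous hlin h
      (isHomogeneous_pow hω'lin _)
    obtain ⟨c, hc⟩ := exists_sub_mem_faceIdeal_sup hσK hσL hσ hg (hdσ.symm ▸ hgd)
    have hc' : ω' ^ (m + 1) - C c * faceMonomial F σ ∈ thetaIdeal (K ⊔ L) Θ :=
      mem_thetaIdeal.mpr ⟨_, hc, q, by rw [hgq]; ring⟩
    have hcK := thetaIdeal_mono (fun s hs => isFace_sup.mpr (Or.inl hs)) hc'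
    have hcL := thetaIdeal_mono (fun s hs => isFace_sup.mpr (Or.inr hs)) hc'
    have h3 : r ^ (m + 1) * a - c = 0 := hK' <| by
      have h4 := Ideal.sub_mem _ (Ideal.add_mem _ (pow_sub_pow_mem h1 (m + 1)) hcK)
        (Ideal.mul_mem_left _ (C (r ^ (m + 1))) ha)
      convert h4 using 1
      rw [map_sub, map_mul, map_pow]
      ring
    have h4 : b - c = 0 := hL' <| by
      have h5 := Ideal.sub_mem _ (Ideal.add_mem _ (pow_sub_pow_mem h2 (m + 1)) hcL) hb
      convert h5 using 1
      rw [map_sub]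
      ring
    exact hrab ((sub_eq_zero.mp h3).trans (sub_eq_zero.mp h4).symm)
  · exact LefschetzMod.connectedSum hlin hdσ hΘσ hσK hσL hKL hω'lin hi hei
      ((((hωK e i hei).congr hωα).C_mul hr).congr h1) (((hωL e i hei).congr hωβ).congr h2)

end Rescaling

/-! ### Common parameters and a common Lefschetz element -/

section CommonParameters

open Filter

variable {F : Type v} [Field F] {V : Type u} [Fintype V] [LinearOrder V]
variable {K L : PreAbstractSimplicialComplex V} {σ : Finset V} {d : ℕ}
  {Θ : Fin d → MvPolynomial V F} {ω : MvPolynomial V F} {e i n : ℕ}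

theorem isCommonLSOP_of_isGenericOn (hΘ : ∀ j, (Θ j).IsHomogeneous 1)
    (hK : IsGorensteinStar F K) (hL : IsGorensteinStar F L) (hσ : σ.Nonempty) (hσd : σ.card = d)
    (hσK : IsFacet K σ) (hσL : IsFacet L σ) (hΘK : ∀ s, IsFace K s → IsGenericOn Θ s)
    (hΘL : ∀ s, IsFace L s → IsGenericOn Θ s) : IsCommonLSOP K L σ Θ := by
  refine ⟨isLSOP_of_isGenericOn hΘ (by rw [← hK.1 σ hσK, hσd]) hΘK,
    isLSOP_of_isGenericOn hΘ (by rw [← hL.1 σ hσL, hσd]) hΘL,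
    isLSOP_of_isGenericOn hΘ (by rw [size_simplex, hσd]) fun s hs =>
      hΘK s (hσK.1.subset (isFace_simplex.mp hs)),
    isLSOP_of_isGenericOn hΘ (by rw [hK.size_connectedSum hL hσ hσK hσL, hσd]) fun s hs => ?_⟩
  exact ((isFace_connectedSum_of_facet hσ hσK hσL).mp hs).1.elim (hΘK s) (hΘL s)

theorem exists_isCommonLSOP [Infinite F] (hK : IsGorensteinStar F K) (hL : IsGorensteinStar F L)
    (hσ : σ.Nonempty) (hσd : σ.card = d) (hσK : IsFacet K σ) (hσL : IsFacet L σ) :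
    ∃ Θ : Fin d → MvPolynomial V F, IsCommonLSOP K L σ Θ := by
  classical
  obtain ⟨Θ, hΘ, h⟩ := SComplex.exists_isGenericOn (F := F) (d := d)
    (faceFinset K ∪ faceFinset L) fun s hs => by
      rcases Finset.mem_union.mp hs with hs | hs
      · exact (mem_faceFinset.mp hs).card_le_size.trans_eq (by rw [← hK.1 σ hσK, hσd])
      · exact (mem_faceFinset.mp hs).card_le_size.trans_eq (by rw [← hL.1 σ hσL, hσd])
  exact ⟨Θ, isCommonLSOP_of_isGenericOn hΘ hK hL hσ hσd hσK hσL
    (fun s hs => h s (Finset.mem_union_left _ (mem_faceFinset.mpr hs)))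
    (fun s hs => h s (Finset.mem_union_right _ (mem_faceFinset.mpr hs)))⟩

theorem finrank_map_add_finrank_inf_ker {E E' : Type*} [AddCommGroup E] [Module F E]
    [AddCommGroup E'] [Module F E'] (W : Submodule F E) [FiniteDimensional F W] (f : E →ₗ[F] E') :
    Module.finrank F (W.map f) + Module.finrank F (W ⊓ LinearMap.ker f : Submodule F E) =
      Module.finrank F W := by
  have h := LinearMap.finrank_range_add_finrank_ker (f.domRestrict W)
  rw [LinearMap.range_domRestrict] at h
  rw [← h, ← Submodule.map_comap_subtype]
  congr 1
  exact ((Submodule.equivMapOfInjective W.subtype W.injective_subtype _).finrank_eq).symm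

/-- The forms of degree `i` that `ω ^ e` multiplies into `J`. -/
def powKernel (J : Ideal (MvPolynomial V F)) (ω : MvPolynomial V F) (e i : ℕ) :
    Submodule F (MvPolynomial V F) :=
  homogeneousSubmodule V F i ⊓
    (J.restrictScalars F).comap (LinearMap.mulLeft F (ω ^ e))

theorem mem_powKernel {J : Ideal (MvPolynomial V F)} {p : MvPolynomial V F} :
    p ∈ powKernel J ω e i ↔ p.IsHomogeneous i ∧ ω ^ e * p ∈ J := Iff.rfl

/-- By surjectivity the forms of degree `i` times `ω ^ e` and all forms of degree `e + i` have the
same image modulo `J`; compare rank–nullity for both. -/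
theorem finrank_powKernel (hω : ω.IsHomogeneous 1) {J : Ideal (MvPolynomial V F)}
    (h : ∀ p : MvPolynomial V F, p.IsHomogeneous (e + i) →
      ∃ a : MvPolynomial V F, a.IsHomogeneous i ∧ p - ω ^ e * a ∈ J) :
    Module.finrank F (powKernel J ω e i) +
        Module.finrank F (homogeneousSubmodule V F (e + i)) =
      Module.finrank F (homogeneousSubmodule V F i) + Module.finrank F (degreePart J (e + i)) := by
  let π := (J.restrictScalars F).mkQ
  have h1 := finrank_map_add_finrank_inf_ker (homogeneousSubmodule V F (e + i)) π
  have h2 := finrank_map_add_finrank_inf_ker (homogeneousSubmodule V F i)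
    (π.comp (LinearMap.mulLeft F (ω ^ e)))
  rw [Submodule.ker_mkQ] at h1
  rw [LinearMap.ker_comp, Submodule.ker_mkQ] at h2
  have h3 : (homogeneousSubmodule V F i).map (π.comp (LinearMap.mulLeft F (ω ^ e))) =
      (homogeneousSubmodule V F (e + i)).map π := by
    refine le_antisymm ?_ ?_
    · rintro _ ⟨p, hp, rfl⟩
      exact ⟨ω ^ e * p, (isHomogeneous_pow hω e).mul hp, rfl⟩
    · rintro _ ⟨p, hp, rfl⟩
      obtain ⟨a, ha, haJ⟩ := h p hp
      refine ⟨a, ha, ((Submodule.Quotient.eq _).mpr ?_).symm⟩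
      exact haJ
  rw [h3] at h2
  change _ + Module.finrank F (degreePart J (e + i)) = _ at h1
  change _ + Module.finrank F (powKernel J ω e i) = _ at h2
  omega

theorem MulPowSurjective.exists_isHomogeneous (h : MulPowSurjective K Θ ω e (e + i))
    (hΘ : ∀ j, (Θ j).IsHomogeneous 1) (hω : ω.IsHomogeneous 1) {p : MvPolynomial V F}
    (hp : p.IsHomogeneous (e + i)) :
    ∃ a : MvPolynomial V F, a.IsHomogeneous i ∧ p - ω ^ e * a ∈ thetaIdeal K Θ := by
  obtain ⟨a, ha⟩ := h p hp
  have h1 := homogeneousComponent_mem_thetaIdeal hΘ ha (e + i)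
  rw [map_sub, homogeneousComponent_of_mem hp, if_pos rfl,
    homogeneousComponent_mul_of_isHomogeneous (isHomogeneous_pow hω e)] at h1
  exact ⟨_, homogeneousComponent_isHomogeneous i a, h1⟩

/-- The graded dimensions for `Θ` and `Θ'` agree, so the bijection for `Θ` shows that source and
target for `Θ'` have equal dimension; surjectivity then forces injectivity. -/
theorem LefschetzMod.of_mulPowSurjective [Infinite F] (hK : IsGorensteinStar F K)
    {Θ' : Fin d → MvPolynomial V F} {ω' : MvPolynomial V F} (hΘ : IsLSOP K Θ) (hΘ' : IsLSOP K Θ')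
    (hω : ω.IsHomogeneous 1) (hω' : ω'.IsHomogeneous 1) (h : LefschetzMod (thetaIdeal K Θ) ω e i)
    (h' : MulPowSurjective K Θ' ω' e (e + i)) : LefschetzMod (thetaIdeal K Θ') ω' e i := by
  have hsurj : ∀ p : MvPolynomial V F, p.IsHomogeneous (e + i) → _ := fun p hp =>
    h'.exists_isHomogeneous hΘ'.linear hω' hp
  have h1 := finrank_powKernel hω h.2
  have h2 := finrank_powKernel hω' hsurj
  have h3 : powKernel (thetaIdeal K Θ) ω e i = degreePart (thetaIdeal K Θ) i :=
    le_antisymm (fun p hp => ⟨hp.1, h.1 p hp.1 hp.2⟩)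
      fun p hp => ⟨hp.1, Ideal.mul_mem_left _ _ hp.2⟩
  have h4 : degreePart (thetaIdeal K Θ') i = powKernel (thetaIdeal K Θ') ω' e i := by
    have : FiniteDimensional F (powKernel (thetaIdeal K Θ') ω' e i) :=
      Submodule.finiteDimensional_inf_left _ _
    refine Submodule.eq_of_le_of_finrank_eq (fun p hp => ⟨hp.1, Ideal.mul_mem_left _ _ hp.2⟩) ?_
    rw [h3] at h1
    have h5 := hK.finrank_degreePart_eq hΘ hΘ' i
    have h6 := hK.finrank_degreePart_eq hΘ hΘ' (e + i)
    omega
  exact ⟨fun p hp hpJ => (h4.ge (mem_powKernel.mpr ⟨hp, hpJ⟩)).2, hsurj⟩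

/-- A pair of a generic sequence of linear forms and a linear form whose powers multiply
onto the upper degrees of `H(K, Θ)`. -/
def IsGenericLefschetz (K : PreAbstractSimplicialComplex V) (Θ : Fin d → MvPolynomial V F)
    (ω : MvPolynomial V F) : Prop :=
  (∀ s ∈ faceFinset K, IsGenericOn Θ s) ∧
    ∀ i ∈ Finset.range (d / 2 + 1), MulPowSurjective K Θ ω (d - 2 * i) (d - 2 * i + i)

theorem IsGenericLefschetz.eventually_line (h : IsGenericLefschetz K Θ ω)
    {Θ' : Fin d → MvPolynomial V F} {ω' : MvPolynomial V F}
    (hΘ : ∀ j, (Θ j).IsHomogeneous 1) (hω : ω.IsHomogeneous 1)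
    (hΘ' : ∀ j, (Θ' j).IsHomogeneous 1) (hω' : ω'.IsHomogeneous 1) :
    ∀ᶠ t in (cofinite : Filter F), IsGenericLefschetz K (Θ + t • (Θ' - Θ)) (ω + t • (ω' - ω)) :=
  ((Finset.eventually_all _).mpr fun s hs => (h.1 s hs).eventually_line Θ').and
    ((Finset.eventually_all _).mpr fun i hi => (h.2 i hi).eventually_line hΘ hω hΘ' hω')

theorem IsHLElement.exists_isGenericLefschetz [Infinite F] (hΘ : IsLSOP K Θ)
    (h : IsHLElement K Θ ω) : ∃ Θ' : Fin d → MvPolynomial V F, (∀ j, (Θ' j).IsHomogeneous 1) ∧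
      IsGenericLefschetz K Θ' ω := by
  obtain ⟨Θ', hlin, hJ, hgen⟩ := hΘ.exists_isGenericOn
  refine ⟨Θ', hlin, fun s hs => hgen s (mem_faceFinset.mp hs), fun i hi p hp => ?_⟩
  rw [Finset.mem_range] at hi
  obtain ⟨a, -, ha⟩ := ((isHLElement_iff.mp h).2 (d - 2 * i) i (by omega)).2 p hp
  exact ⟨a, hJ ▸ ha⟩

theorem IsHLElement.of_isGenericLefschetz [Infinite F] (hK : IsGorensteinStar F K)
    {Θ' : Fin d → MvPolynomial V F} {ω' : MvPolynomial V F} (hΘ : IsLSOP K Θ)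
    (hω : IsHLElement K Θ ω) (hΘ' : IsLSOP K Θ') (hω' : ω'.IsHomogeneous 1)
    (h : IsGenericLefschetz K Θ' ω') : IsHLElement K Θ' ω' := by
  obtain ⟨hωlin, hω⟩ := isHLElement_iff.mp hω
  refine isHLElement_iff.mpr ⟨hω', fun e i hei => ?_⟩
  have h1 := h.2 i (Finset.mem_range.mpr (by omega))
  rw [show d - 2 * i = e by omega] at h1
  exact (hω e i hei).of_mulPowSurjective hK hΘ hΘ' hωlin hω' h1

/-- Two complexes with the hard Lefschetz property have a common sequence of parameters and a
common Lefschetz element. -/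
theorem exists_common_isHLElement [Infinite F] (hK : IsGorensteinStar F K)
    (hL : IsGorensteinStar F L) (hσ : σ.Nonempty) (hσd : σ.card = d) (hσK : IsFacet K σ)
    (hσL : IsFacet L σ) (hHK : IsHL F K) (hHL : IsHL F L) :
    ∃ (Θ : Fin d → MvPolynomial V F) (ω : MvPolynomial V F),
      IsCommonLSOP K L σ Θ ∧ IsHLElement K Θ ω ∧ IsHLElement L Θ ω := by
  obtain ⟨-, -, d₁, Θ₁, ω₁, hΘ₁, h₁⟩ := hHK
  obtain ⟨-, -, d₂, Θ₂, ω₂, hΘ₂, h₂⟩ := hHL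
  obtain rfl : d₁ = d := by rw [hΘ₁.size_eq, ← hK.1 σ hσK, hσd]
  obtain rfl : d₂ = d₁ := by rw [hΘ₂.size_eq, ← hL.1 σ hσL, hσd]
  obtain ⟨Ξ₁, hΞ₁, hg₁⟩ := h₁.exists_isGenericLefschetz hΘ₁
  obtain ⟨Ξ₂, hΞ₂, hg₂⟩ := h₂.exists_isGenericLefschetz hΘ₂
  have hω₁ := (isHLElement_iff.mp h₁).1
  have hω₂ := (isHLElement_iff.mp h₂).1
  let W : Submodule F ((Fin d₂ → MvPolynomial V F) × MvPolynomial V F) :=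
    (linearForms F V d₂).prod (homogeneousSubmodule V F 1)
  -- The two conditions, for `K` and for `L`, on a point of the vector space of pairs `(Θ, ω)` of
  -- linear forms.
  let P : Bool → W → Prop := fun b x =>
    IsGenericLefschetz (if b then K else L) x.1.1 x.1.2
  have hlin : ∀ x : W, (∀ j, (x.1.1 j).IsHomogeneous 1) ∧ x.1.2.IsHomogeneous 1 := fun x =>
    ⟨mem_linearForms.mp x.2.1, x.2.2⟩
  have hopen : ∀ b x y, P b x → ∀ᶠ t in (cofinite : Filter F), P b (x + t • (y - x)) :=
    fun b x y hx => IsGenericLefschetz.eventually_line hx (hlin x).1 (hlin x).2 (hlin y).1 (hlin y).2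
  have hne : ∀ b ∈ (Finset.univ : Finset Bool), ∃ x ∈ (⊤ : Submodule F W), P b x := by
    rintro (_ | _) -
    · exact ⟨⟨(Ξ₂, ω₂), mem_linearForms.mpr hΞ₂, hω₂⟩, trivial, hg₂⟩
    · exact ⟨⟨(Ξ₁, ω₁), mem_linearForms.mpr hΞ₁, hω₁⟩, trivial, hg₁⟩
  obtain ⟨x, -, hx⟩ := exists_forall_of_line ⊤ _ hopen hne
  have hxK : IsGenericLefschetz K x.1.1 x.1.2 := hx true (Finset.mem_univ _)
  have hxL : IsGenericLefschetz L x.1.1 x.1.2 := hx false (Finset.mem_univ _)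
  have hc : IsCommonLSOP K L σ x.1.1 := isCommonLSOP_of_isGenericOn (hlin x).1 hK hL hσ hσd hσK hσL
    (fun s hs => hxK.1 s (mem_faceFinset.mpr hs)) (fun s hs => hxL.1 s (mem_faceFinset.mpr hs))
  exact ⟨x.1.1, x.1.2, hc, h₁.of_isGenericLefschetz hK hΘ₁ hc.1 (hlin x).2 hxK,
    h₂.of_isGenericLefschetz hL hΘ₂ hc.2.1 (hlin x).2 hxL⟩

theorem isHL_connectedSum [Infinite F] (hK : IsGorensteinStar F K)
    (hL : IsGorensteinStar F L) (hσ : σ.Nonempty) (hσK : IsFacet K σ) (hσL : IsFacet L σ)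
    (hKL : K ⊓ L = simplex σ) (hΘ : IsCommonLSOP K L σ Θ) (hωK : IsHLElement K Θ ω)
    (hωL : IsHLElement L Θ ω) : IsHL F (connectedSum K L σ) := by
  have hG := hK.connectedSum hL hσ hσK hσL hKL
  obtain ⟨ω', hω'⟩ := exists_isHLElement_connectedSum hK hL hσ hσK hσL hKL hΘ.1 hΘ.2.1 hΘ.2.2.2
    hωK hωL
  exact ⟨hG.isCohenMacaulay, hG.hasSymmetricH, d, Θ, ω', hΘ.2.2.2, hω'⟩

end CommonParameters

end SComplex

end

/-! ### The main theorem -/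

theorem mainTheorem4 {F : Type*} [Field F] {V : Type*} [Fintype V] [LinearOrder V]
    (K L : PreAbstractSimplicialComplex V) (σ : Finset V) (d : ℕ)
    (hd : σ.card = d) (hd1 : 1 ≤ d)
    (hK : SComplex.IsGorensteinStar F K) (hL : SComplex.IsGorensteinStar F L)
    (hσK : SComplex.IsFacet K σ) (hσL : SComplex.IsFacet L σ)
    (hKL : K ⊓ L = SComplex.simplex σ) :
    -- (0) the connected sum is Gorenstein* of dimension `d - 1`, with symmetric `h`-vector
    (SComplex.IsGorensteinStar F (SComplex.connectedSum K L σ) ∧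
      SComplex.size (SComplex.connectedSum K L σ) = d ∧
      SComplex.HasSymmetricH (SComplex.connectedSum K L σ)) ∧
    -- (1) common l.s.o.p.s exist over infinite fields, and for each of them
    -- HL elements of both `K` and `L` are `i`-Lefschetz for `0 < i ≤ d / 2`
    (Infinite F → ∃ Θ : Fin d → MvPolynomial V F, SComplex.IsCommonLSOP K L σ Θ) ∧
    (∀ (Θ : Fin d → MvPolynomial V F) (ω : MvPolynomial V F),
      SComplex.IsCommonLSOP K L σ Θ →
      SComplex.IsHLElement K Θ ω → SComplex.IsHLElement L Θ ω →
      (∀ i : ℕ, 0 < i → 2 * i ≤ d →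
        SComplex.IsLefschetzElement (SComplex.connectedSum K L σ) Θ ω i) ∧
      -- (2) under the same assumption the connected sum is HL
      (Infinite F → SComplex.IsHL F (SComplex.connectedSum K L σ))) ∧
    -- (2) the connected sum of HL complexes is HL
    (Infinite F → SComplex.IsHL F K → SComplex.IsHL F L →
      SComplex.IsHL F (SComplex.connectedSum K L σ)) := by
  have hσ : σ.Nonempty := Finset.card_pos.mp (by omega)
  have hG := hK.connectedSum hL hσ hσK hσL hKL
  refine ⟨⟨hG, (hK.size_connectedSum hL hσ hσK hσL).trans hd, hG.hasSymmetricH⟩,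
    fun _ => SComplex.exists_isCommonLSOP hK hL hσ hd hσK hσL,
    fun Θ ω hΘ hωK hωL => ⟨fun i hi hid => ?_, fun _ =>
      SComplex.isHL_connectedSum hK hL hσ hσK hσL hKL hΘ hωK hωL⟩, fun _ hHK hHL => ?_⟩
  · obtain ⟨hω, hωK⟩ := SComplex.isHLElement_iff.mp hωK
    obtain ⟨-, hωL⟩ := SComplex.isHLElement_iff.mp hωL
    have hei : d - 2 * i + 2 * i = d := by omega
    exact (SComplex.isLefschetzElement_iff hei).mpr ⟨hω, SComplex.LefschetzMod.connectedSum
      hΘ.1.linear hd (hΘ.1.spansOn hσK.1) hσK hσL hKL hω hi hei (hωK _ _ hei) (hωL _ _ hei)⟩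
  · obtain ⟨Θ, ω, hΘ, hωK, hωL⟩ :=
      SComplex.exists_common_isHLElement hK hL hσ hd hσK hσL hHK hHL
    exact SComplex.isHL_connectedSum hK hL hσ hσK hσL hKL hΘ hωK hωL
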